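/- **Proposition 5.1 (Identification of the quadratic resonant Birkhoff normal form).** Let $\kappa>0$, $g\ge 0$, $h\in(0,+\infty]$, and consider the gravity-capillary water waves system on $\mathbb T=\mathbb R/2\pi\mathbb Z$ $$\partial_t\eta=G(\eta)\psi,\qquad \partial_t\psi=-g\eta-\tfrac12\psi_x^2+\tfrac12\frac{(\eta_x\psi_x+G(\eta)\psi)^2}{1+\eta_x^2}+\kappa\,\partial_x\Big(\frac{\eta_x}{(1+\eta_x^2)^{1/2}}\Big),\tag{1}$$ where $\int_{\mathbb T}\eta\,dx=0$, $\psi$ is considered modulo constants, and $G(\eta)\psi=(\partial_y\Phi-\eta_x\partial_x\Phi)(x,\eta(x))$ is the Dirichlet–Neumann operator: $\Delta\Phi=0$ in $-h<y<\eta(x)$, $\Phi=\psi$ at $y=\eta(x)$, $\partial_y\Phi=0$ at $y=-h$ ($\partial_y\Phi\to0$ as $y\to-\infty$, uniformly in $x$, if $h=+\infty$). *Notation.* For $j\in\mathbb Z\setminus\{0\}$ let $G_j=j\tanh(hj)$ ($=|j|$ if $h=+\infty$), $\Omega(j)=\sqrt{(\kappa j^2+g)\,G_j}$ and $\Lambda(j)=G_j^{1/4}(g+\kappa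 j^2)^{-1/4}$. Functions are expanded as $u(x)=\sum_{n\ne0}u_n\frac{e^{inx}}{\sqrt{2\pi}}$, with $u_n^+=u_n$, $u_n^-=\overline{u_n}$; $\|u\|_{\dot H^s}^2=\sum_{n\neq 0}|n|^{2s}|u_n|^2$. Put $w=\frac1{\sqrt2}\big(\Lambda(D)\psi+i\Lambda(D)^{-1}\eta\big)$, $W=(w,\overline w)$, $E=\mathrm{diag}(1,-1)$. A translation invariant, real-to-real $2\times2$ matrix of operators $R(U)$, linear in $U=(u,\overline u)$, is given by coefficients $r^{\sigma,\sigma'}_{\epsilon,n,k}\in\mathbb C$ ($\epsilon,\sigma,\sigma'=\pm$, $n,k\in\mathbb Z\setminus\{0\}$) with $r^{-\sigma,-\sigma'}_{-\epsilon,n,k}=\overline{r^{\sigma,\sigma'}_{\epsilon,n,k}}$, through $$(R(U)[Z])^\sigma=\frac1{\sqrt{2\pi}}\sum_{j\ne0}\Big(\frac1{\sqrt{2\pi}}\sum_{\sigma',\epsilon=\pm}\ \sum_{\epsilon n+\sigma'k=\sigma j}r^{\sigma,\sigma'}_{\epsilon,n,k}\,u_n^\epsilon z_k^{\sigma'}\Big)e^{i\sigma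 jx},\qquad \sigma=\pm .$$ It is a homogeneous map of order $m\ge 0$ if $|r^{\sigma,\sigma'}_{\epsilon,n,k}|\le C(|n|+|k|+|j|)^m$, and $\rho$-smoothing ($\rho\ge0$) if $|r^{\sigma,\sigma'}_{\epsilon,n,k}|\le C\min(|n|,|k|)^{\rho+\mu}\max(|n|,|k|)^{-\rho}$ for some $\mu\ge0$, whenever $\sigma j=\epsilon n+\sigma'k\neq 0$. Its resonant part $R^{res}(U)$ is obtained by keeping only the coefficients such that, with $\sigma j=\epsilon n+\sigma'k$, $\sigma\Omega(j)-\sigma'\Omega(k)-\epsilon\Omega(n)=0$. *Reduction to normal form.* Let $m,\rho\ge0$, $s\in\mathbb R$. Let $M_1$ be a real-to-real homogeneous map of order $m$, let $\mathtt R_1$ be a real-to-real $\rho$-smoothing operator, and let $$Y=(y,\overline y)=W+M_1(W)[W]+M_{\ge2}(W)\tag{2}$$ be a change of variables which conjugates (1) to $$\partial_tY=i\Omega(D)E\,Y+\mathtt R_1^{res}(Y)[Y]+\mathcal X_{\ge3},\tag{3}$$ with $M_{\ge2}$ and $\mathcal X_{\ge3}$ cubic, in the following sense: there are $r,C>0$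 such that for every smooth state $(\eta,\psi)$ with $\eta>-h$ and $\|w\|_{\dot H^s}<r$ (and smooth velocity potential up to the boundary) there is a curve $t\mapsto w(t)$ of smooth functions, $w(0)=w$, differentiable at $t=0$ in every Sobolev norm with derivative given by the right-hand side of (1) at $(\eta,\psi)$ (for instance the solution of (1) with initial datum $(\eta,\psi)$), along which $M_{\ge2}$ and $Y$ are differentiable at $t=0$ (each Fourier coefficient), $Y$ satisfies (3) at $t=0$, and $\|M_{\ge2}\|_{\dot H^{s-m}}$, $\|\partial_tM_{\ge2}\|_{\dot H^{s-m}}$, $\|\mathcal X_{\ge3}\|_{\dot H^{s-m}}$ are at most $C\|w\|_{\dot H^s}^3$ at $t=0$. (The paradifferential reduction of the water waves system is of this form.) *Conclusion.* For every $Y=(y,\overline y)$, $$\mathtt R_1^{res}(Y)[Y]=X_{H^{(3)}_{BNF}}(Y),\qquad X_F=\begin{pmatrix}i\,\partial_{\overline y}F\\-i\,\partial_yF\end{pmatrix}=\frac1{\sqrt{2\pi}}\sum_{k\neq0}\begin{pmatrix}i\,\partial_{\overline{y_k}}F\,e^{ikx}\\-i\,\partial_{y_k}F\,e^{-ikx}\end{pmatrix},$$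 where $H^{(3)}_{BNF}$ is the resonant part of the cubic term of the water waves Hamiltonian in complex variables: $$H^{(3)}_{BNF}=\sum H^{\sigma_1,\sigma_2,\sigma_3}_{j_1,j_2,j_3}\,y_{j_1}^{\sigma_1}y_{j_2}^{\sigma_2}y_{j_3}^{\sigma_3},\qquad H^{\sigma_1,\sigma_2,\sigma_3}_{j_1,j_2,j_3}=\frac{i\sigma_2}{8\sqrt\pi}\big(\sigma_1\sigma_3j_1j_3+G_{j_1}G_{j_3}\big)\frac{\Lambda(j_2)}{\Lambda(j_1)\Lambda(j_3)},$$ the sum being over the (finitely many) $\sigma_i=\pm$, $j_i\in\mathbb Z\setminus\{0\}$ with $\sigma_1j_1+\sigma_2j_2+\sigma_3j_3=0$ and $\sigma_1\Omega(j_1)+\sigma_2\Omega(j_2)+\sigma_3\Omega(j_3)=0$. -/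

import Mathlib

open scoped ENNReal NNReal ContDiff ComplexConjugate

noncomputable section

namespace WaterWaves

/-! ## Symbols

The depth is `h ∈ (0, ∞]`.  All symbols are used at integers `j ≠ 0` only and are even in `j`. -/

/-- `tanh (h |j|)`, which is `1` in infinite depth. -/
def tanhDepth (h : ℝ≥0∞) (j : ℤ) : ℝ :=
  if h = ⊤ then 1 else Real.tanh (h.toReal * |(j : ℝ)|)

/-- The symbol `tanh (h j) j` of the Dirichlet-Neumann operator of the flat surface. -/
def G₀ (h : ℝ≥0∞) (j : ℤ) : ℝ := tanhDepth h j * |(j : ℝ)|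

/-- The dispersion relation. -/
def Ω (g κ : ℝ) (h : ℝ≥0∞) (j : ℤ) : ℝ :=
  Real.sqrt (κ * |(j : ℝ)| ^ 3 + g * |(j : ℝ)|) * Real.sqrt (tanhDepth h j)

/-- The symbol of the multiplier `(D tanh (h D))^{1/4} (g + κ D²)^{-1/4}`. -/
def Λ (g κ : ℝ) (h : ℝ≥0∞) (j : ℤ) : ℝ :=
  (G₀ h j) ^ (1 / 4 : ℝ) * (g + κ * (j : ℝ) ^ 2) ^ (-(1 / 4) : ℝ)

/-! ## Fourier coefficients and Sobolev norms

A complex function `u` with zero average (or modulo constants) is represented by its Fourier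
coefficients `u n`, `n ≠ 0`, with respect to `e^{i n x} / √(2π)`; the value at `n = 0` is
never used. -/

/-- The `n`-th Fourier coefficient, with respect to `e^{i n x} / √(2π)`. -/
def fourierCoef (f : ℝ → ℝ) (n : ℤ) : ℂ :=
  ((1 / Real.sqrt (2 * Real.pi) : ℝ) : ℂ) *
    ∫ x in (0 : ℝ)..(2 * Real.pi), (f x : ℂ) * Complex.exp (-(Complex.I * n * x))

/-- The homogeneous Sobolev norm `(∑_{n ≠ 0} |n|^{2s} |u_n|²)^{1/2} ∈ [0, ∞]`. -/
def sobolevNorm (s : ℝ) (u : ℤ → ℂ) : ℝ≥0∞ :=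
  (∑' n : ℤ, if n = 0 then 0 else ENNReal.ofReal (|(n : ℝ)| ^ (2 * s) * ‖u n‖ ^ 2)) ^ (1 / 2 : ℝ)

/-- `u` is (the Fourier series of) a smooth function. -/
def IsSmoothSeq (u : ℤ → ℂ) : Prop :=
  ∀ N : ℕ, ∃ C : ℝ, ∀ n : ℤ, n ≠ 0 → |(n : ℝ)| ^ N * ‖u n‖ ≤ C

/-- `t ↦ c t` is a curve of smooth functions with `c 0 = w`, differentiable at `t = 0`, with
respect to every Sobolev norm, with derivative `v`. -/
def IsCurveThrough (c : ℝ → ℤ → ℂ) (w v : ℤ → ℂ) : Prop :=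
  c 0 = w ∧ (∀ t, IsSmoothSeq (c t)) ∧
    ∀ (N : ℕ) (δ : ℝ), 0 < δ → ∀ᶠ t in nhds (0 : ℝ), ∀ n : ℤ, n ≠ 0 →
      |(n : ℝ)| ^ N * ‖c t n - w n - (t : ℂ) * v n‖ ≤ δ * |t|

/-- `z^+ = z` and `z^- = conj z`. -/
def sgn (σ : ℤˣ) (z : ℂ) : ℂ := if σ = 1 then z else conj z

/-! ## The water waves system -/

/-- The point `(x, y)` lies in the fluid domain `-h < y < η x`. -/
def InFluid (h : ℝ≥0∞) (η : ℝ → ℝ) (x y : ℝ) : Prop :=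
  (h ≠ ⊤ → -h.toReal < y) ∧ y < η x

/-- `Φ` is the velocity potential in the fluid domain with Dirichlet datum `ψ` on the free
surface: it is `2π`-periodic in `x`, smooth up to the boundary (that is, it is the restriction
of a smooth function on the plane), harmonic in the fluid domain, and satisfies the Neumann
condition at the bottom (at `y → -∞` if the depth is infinite). -/
structure IsPotential (h : ℝ≥0∞) (η ψ : ℝ → ℝ) (Φ : ℝ → ℝ → ℝ) : Prop where
  smooth : ContDiff ℝ ∞ (fun p : ℝ × ℝ => Φ p.1 p.2)
  periodic : ∀ x y, Φ (x + 2 * Real.pi) y = Φ x y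
  harmonic : ∀ x y, InFluid h η x y →
    iteratedDeriv 2 (fun x' => Φ x' y) x + iteratedDeriv 2 (fun y' => Φ x y') y = 0
  bottom : h ≠ ⊤ → ∀ x, deriv (fun y' => Φ x y') (-h.toReal) = 0
  bottom_infinite : h = ⊤ →
    TendstoUniformly (fun y x => deriv (fun y' => Φ x y') y) (fun _ => 0) Filter.atBot
  dirichlet : ∀ x, Φ x (η x) = ψ x

/-- `Gψ = G(η)ψ`: the Dirichlet-Neumann operator `(∂_y Φ - η_x ∂_x Φ)(x, η x)`. -/
def IsDirichletNeumann (h : ℝ≥0∞) (η ψ Gψ : ℝ → ℝ) : Prop :=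
  ∃ Φ : ℝ → ℝ → ℝ, IsPotential h η ψ Φ ∧
    ∀ x, Gψ x = deriv (fun y' => Φ x y') (η x) - deriv η x * deriv (fun x' => Φ x' (η x)) x

/-- `(η, ψ)` is a smooth state of the fluid (`2π`-periodic, `η` with zero average, free surface
above the bottom), and `(ηt, ψt)` is the water waves vector field at `(η, ψ)`, that is, the
right hand side of the gravity-capillary water waves system. -/
structure IsWaterWavesVelocity (g κ : ℝ) (h : ℝ≥0∞) (η ψ ηt ψt : ℝ → ℝ) : Prop where
  smooth_η : ContDiff ℝ ∞ η
  smooth_ψ : ContDiff ℝ ∞ ψ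
  periodic_η : ∀ x, η (x + 2 * Real.pi) = η x
  periodic_ψ : ∀ x, ψ (x + 2 * Real.pi) = ψ x
  average_η : ∫ x in (0 : ℝ)..(2 * Real.pi), η x = 0
  above_bottom : h ≠ ⊤ → ∀ x, -h.toReal < η x
  eq_η : IsDirichletNeumann h η ψ ηt
  eq_ψ : ∀ x, ψt x = -g * η x - (1 / 2) * deriv ψ x ^ 2
    + (1 / 2) * (deriv η x * deriv ψ x + ηt x) ^ 2 / (1 + deriv η x ^ 2)
    + κ * deriv (fun x' => deriv η x' / Real.sqrt (1 + deriv η x' ^ 2)) x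

/-- The complex variable `(Λ ψ + i Λ⁻¹ η) / √2`. -/
def complexVar (g κ : ℝ) (h : ℝ≥0∞) (η ψ : ℝ → ℝ) (n : ℤ) : ℂ :=
  ((1 / Real.sqrt 2 : ℝ) : ℂ) *
    ((Λ g κ h n : ℂ) * fourierCoef ψ n + Complex.I * ((Λ g κ h n)⁻¹ : ℝ) * fourierCoef η n)

/-! ## Operators that are homogeneous of degree one in `U`

A translation invariant `2 × 2` matrix of operators `R(U)`, linear in `U = (u, conj u)`, is given
by its coefficients `r ε σ σ' n k = (r_{1,ε})^{σ,σ'}_{n,k}`, `n, k ≠ 0`: the entry `(σ, σ')` of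
`R(U)` sends `z^{σ'}` to
`(2π)^{-1/2} ∑_{j ≠ 0} ((2π)^{-1/2} ∑_{ε, n, k, ε n + σ' k = σ j} r ε σ σ' n k u_n^ε z_k^{σ'}) e^{i σ j x}`. -/

/-- Coefficients `r ε σ σ' n k`. -/
abbrev OpCoef := ℤˣ → ℤˣ → ℤˣ → ℤ → ℤ → ℂ

/-- The matrix of operators is real-to-real: the entry `(-σ, -σ')` is the complex conjugate of
the entry `(σ, σ')`. -/
def IsRealToReal (r : OpCoef) : Prop :=
  ∀ ε σ σ' n k, r (-ε) (-σ) (-σ') n k = conj (r ε σ σ' n k)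

/-- The entries are homogeneous maps of order `m`, that is, in `𝓜̃₁^m`. -/
def IsHomogeneousMap (m : ℝ) (r : OpCoef) : Prop :=
  ∃ C : ℝ, ∀ (ε σ σ' : ℤˣ) (n k : ℤ), n ≠ 0 → k ≠ 0 → (ε : ℤ) * n + (σ' : ℤ) * k ≠ 0 →
    ‖r ε σ σ' n k‖ ≤ C * (|(n : ℝ)| + |(k : ℝ)| + |(((ε : ℤ) * n + (σ' : ℤ) * k : ℤ) : ℝ)|) ^ m

/-- The entries are homogeneous `ρ`-smoothing operators, that is, in `𝓡̃₁^{-ρ}`. -/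
def IsSmoothingOp (ρ : ℝ) (r : OpCoef) : Prop :=
  ∃ μ : ℝ, 0 ≤ μ ∧ ∃ C : ℝ, ∀ (ε σ σ' : ℤˣ) (n k : ℤ), n ≠ 0 → k ≠ 0 →
    (ε : ℤ) * n + (σ' : ℤ) * k ≠ 0 →
    ‖r ε σ σ' n k‖ ≤ C * (min |(n : ℝ)| |(k : ℝ)|) ^ (ρ + μ) / (max |(n : ℝ)| |(k : ℝ)|) ^ ρ

open Classical in
/-- The quadratic vector field `R(Y)[Y]`, `Y = (y, conj y)`: the component `σ = ±` (first or
second component) has coefficient `quadField r y σ j` on `e^{i σ j x} / √(2π)`. -/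
def quadField (r : OpCoef) (y : ℤ → ℂ) (σ : ℤˣ) (j : ℤ) : ℂ :=
  ∑ σ' : ℤˣ, ∑ ε : ℤˣ, ((1 / Real.sqrt (2 * Real.pi) : ℝ) : ℂ) *
    ∑' p : ℤ × ℤ,
      if p.1 ≠ 0 ∧ p.2 ≠ 0 ∧ (ε : ℤ) * p.1 + (σ' : ℤ) * p.2 = (σ : ℤ) * j then
        r ε σ σ' p.1 p.2 * sgn ε (y p.1) * sgn σ' (y p.2)
      else 0

open Classical in
/-- The Poincaré-Birkhoff resonant part: only the coefficients with
`σ Ω(j) - σ' Ω(k) - ε Ω(n) = 0`, where `σ j = ε n + σ' k`, are kept. -/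
def resonantPart (g κ : ℝ) (h : ℝ≥0∞) (r : OpCoef) : OpCoef := fun ε σ σ' n k =>
  if ((σ : ℤ) : ℝ) * Ω g κ h ((σ : ℤ) * ((ε : ℤ) * n + (σ' : ℤ) * k))
      - ((σ' : ℤ) : ℝ) * Ω g κ h k - ((ε : ℤ) : ℝ) * Ω g κ h n = 0 then
    r ε σ σ' n k
  else 0

/-! ## The Birkhoff normal form Hamiltonian -/

/-- The coefficients `H_{j₁,j₂,j₃}^{σ₁,σ₂,σ₃}` of the cubic water waves Hamiltonian. -/
def hamCoef (g κ : ℝ) (h : ℝ≥0∞) (σ : Fin 3 → ℤˣ) (j : Fin 3 → ℤ) : ℂ :=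
  Complex.I * ((σ 1 : ℤ) : ℂ) / ((8 * Real.sqrt Real.pi : ℝ) : ℂ) *
    (((((σ 0 : ℤ) * (σ 2 : ℤ) * j 0 * j 2 : ℤ) : ℝ) + G₀ h (j 0) * G₀ h (j 2) : ℝ) : ℂ) *
    ((Λ g κ h (j 1) / (Λ g κ h (j 0) * Λ g κ h (j 2)) : ℝ) : ℂ)

/-- The three waves resonances. -/
def IsResonant (g κ : ℝ) (h : ℝ≥0∞) (σ : Fin 3 → ℤˣ) (j : Fin 3 → ℤ) : Prop :=
  (∀ i, j i ≠ 0) ∧ ∑ i, (σ i : ℤ) * j i = 0 ∧ ∑ i, ((σ i : ℤ) : ℝ) * Ω g κ h (j i) = 0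

open Classical in
/-- The cubic Birkhoff normal form Hamiltonian (the sum has finitely many nonzero terms). -/
def HBNF (g κ : ℝ) (h : ℝ≥0∞) (y : ℤ → ℂ) : ℂ :=
  ∑ σ : Fin 3 → ℤˣ, ∑' j : Fin 3 → ℤ,
    if IsResonant g κ h σ j then hamCoef g κ h σ j * ∏ i, sgn (σ i) (y (j i)) else 0

/-- The Wirtinger derivative `∂F/∂y_k^σ`, i.e. `∂F/∂y_k` for `σ = +` and `∂F/∂(conj y_k)`
for `σ = -`. -/
def wirtinger (F : (ℤ → ℂ) → ℂ) (y : ℤ → ℂ) (σ : ℤˣ) (k : ℤ) : ℂ :=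
  (1 / 2) * (deriv (fun t : ℝ => F (y + Pi.single k (t : ℂ))) 0
    - ((σ : ℤ) : ℂ) * Complex.I * deriv (fun t : ℝ => F (y + Pi.single k ((t : ℂ) * Complex.I))) 0)

/-- The Hamiltonian vector field `(i ∂F/∂(conj y), -i ∂F/∂y)`: the component `σ` has coefficient
`i σ ∂F/∂y_k^{-σ}` on `e^{i σ k x} / √(2π)`. -/
def hamField (F : (ℤ → ℂ) → ℂ) (y : ℤ → ℂ) (σ : ℤˣ) (k : ℤ) : ℂ :=
  Complex.I * ((σ : ℤ) : ℂ) * wirtinger F y (-σ) k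

/-! ## Conjugation of the water waves system to normal form -/

/-- The first component of the change of variables `W ↦ Y = W + M₁(W)[W] + M_{≥2}(W)`,
where `W = (w, conj w)` and the last term is `N w`. -/
def changeVar (M₁ : OpCoef) (N : (ℤ → ℂ) → ℤ → ℂ) (w : ℤ → ℂ) (j : ℤ) : ℂ :=
  w j + quadField M₁ w 1 j + N w j

/-- The change of variables `changeVar M₁ N`, written in the complex variable
`w = (Λ ψ + i Λ⁻¹ η) / √2`, conjugates the water waves system, in a ball of the Sobolev space of
order `s`, to `∂_t Y = i Ω(D) E Y + R(Y)[Y] + X_{≥3}`, up to a loss of `m` derivatives: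
at each smooth state of the ball, along some curve with the water waves velocity (as is the
solution of the Cauchy problem), `Y` satisfies this equation, and `N`, its time derivative and
`X_{≥3}` are cubic.  The second component of the equation is the complex conjugate of the
first one. -/
def ConjugatesTo (g κ : ℝ) (h : ℝ≥0∞) (s m : ℝ) (M₁ : OpCoef) (N : (ℤ → ℂ) → ℤ → ℂ)
    (R : OpCoef) : Prop :=
  ∃ (r : ℝ≥0∞) (C : ℝ≥0), 0 < r ∧
    ∀ (η ψ ηt ψt : ℝ → ℝ) (w v : ℤ → ℂ), IsWaterWavesVelocity g κ h η ψ ηt ψt →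
      w = complexVar g κ h η ψ → v = complexVar g κ h ηt ψt → sobolevNorm s w < r →
      sobolevNorm (s - m) (N w) ≤ C * sobolevNorm s w ^ 3 ∧
      ∃ (c : ℝ → ℤ → ℂ) (N' X : ℤ → ℂ), IsCurveThrough c w v ∧
        (∀ j, j ≠ 0 → HasDerivAt (fun t : ℝ => N (c t) j) (N' j) 0) ∧
        sobolevNorm (s - m) N' ≤ C * sobolevNorm s w ^ 3 ∧
        (∀ j, j ≠ 0 → HasDerivAt (fun t : ℝ => changeVar M₁ N (c t) j)
          (Complex.I * (Ω g κ h j : ℂ) * changeVar M₁ N w j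
            + quadField R (changeVar M₁ N w) 1 j + X j) 0) ∧
        sobolevNorm (s - m) X ≤ C * sobolevNorm s w ^ 3

end WaterWaves

end

/-!
The proof compares the quadratic terms of the two sides of the conjugated equation at explicit
states, and then keeps the resonant ones.

*Explicit states.*  No theory of the Dirichlet-Neumann operator is needed: instead of solving for
the velocity potential, take `ε Φ` with `Φ` a finite sum of harmonic functions
`Re (c_n e^{i n x}) (cosh (|n| y) + tanh (h |n|) sinh (|n| y))` of the whole plane
(`isEntirePotential_potential`), take `ε η` with `η` a trigonometric polynomial, and define `ψ` as
the trace of `ε Φ` on the surface `y = ε η(x)`.  The water waves vector field at this state is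
explicit and smooth in `(ε, x)` (`isWaterWavesVelocity_family`), so that the complex variable and
its velocity are `ε W(ε)` and `ε V(ε)` with Fourier coefficients that decay rapidly, uniformly in
`ε`, and are differentiable at `ε = 0`.  The first order part `w` of the complex variable is an
arbitrary finitely supported sequence.

*Quadratic terms.*  The conjugated equation divided by `ε²` gives, as `ε → 0`
(`quadratic_part_of_conjugation`, `quadratic_identity`),
`X(w) + (dM(w)[i Ω w] - i Ω M(w)) = R(w)`, where `X` is the quadratic part of the water waves
vector field, `M(w) = M₁(w)[w]` and `R` is the quadratic resonant vector field.  The term in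
brackets multiplies each coefficient of `M₁` by `i` times the difference between the frequency of
its monomial and `Ω(j)`, which is zero on resonances.

*Resonances.*  Replacing `w` by `e^{i Ω t} w` and using that the functions `e^{i θ t}` are linearly
independent, the resonant parts of `X` and `R` agree (`resonant_identity`).  The dispersion
relation is strictly superadditive at high frequency (`Ω_add_lt`), so there are finitely many
resonances and the identity extends from finitely supported to arbitrary sequences.  Finally
`wirtinger_HBNF` and `I_mul_hamTriple_eq_fieldCoef` identify the resonant part of `X` with the
Hamiltonian vector field of the normal form; the second component is the complex conjugate of
the first one.
-/

namespace WaterWaves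

/-! ### Symbols and three waves resonances -/

lemma tanhDepth_pos {h : ℝ≥0∞} (hh : 0 < h) {j : ℤ} (hj : j ≠ 0) : 0 < tanhDepth h j := by
  unfold tanhDepth
  split_ifs with ht
  · exact one_pos
  · rw [Real.tanh_eq_sinh_div_cosh]
    have h1 : 0 < h.toReal := ENNReal.toReal_pos hh.ne' ht
    have h2 : (0 : ℝ) < |(j : ℝ)| := abs_pos.2 (by exact_mod_cast hj)
    exact div_pos (Real.sinh_pos_iff.2 (mul_pos h1 h2)) (Real.cosh_pos _)

lemma tanhDepth_nonneg (h : ℝ≥0∞) (j : ℤ) : 0 ≤ tanhDepth h j := by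
  unfold tanhDepth
  split_ifs with ht
  · exact zero_le_one
  · rw [Real.tanh_eq_sinh_div_cosh]
    exact div_nonneg (Real.sinh_nonneg_iff.2 (by positivity)) (Real.cosh_pos _).le

lemma tanhDepth_le_one (h : ℝ≥0∞) (j : ℤ) : tanhDepth h j ≤ 1 := by
  unfold tanhDepth
  split_ifs with ht
  · exact le_rfl
  · exact (Real.tanh_lt_one _).le

lemma tanhDepth_mono (h : ℝ≥0∞) {i j : ℤ} (hij : |i| ≤ |j|) : tanhDepth h i ≤ tanhDepth h j := by
  unfold tanhDepth
  split_ifs with ht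
  · exact le_rfl
  · have hij' : |(i : ℝ)| ≤ |(j : ℝ)| := by exact_mod_cast hij
    set a := h.toReal * |(i : ℝ)| with ha
    set b := h.toReal * |(j : ℝ)| with hb
    have hab : a ≤ b := mul_le_mul_of_nonneg_left hij' ENNReal.toReal_nonneg
    rw [Real.tanh_eq_sinh_div_cosh, Real.tanh_eq_sinh_div_cosh,
      div_le_div_iff₀ (Real.cosh_pos _) (Real.cosh_pos _)]
    have h1 : 0 ≤ Real.sinh (b - a) := Real.sinh_nonneg_iff.2 (by linarith)
    rw [Real.sinh_sub] at h1
    nlinarith [h1]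

lemma tanhDepth_neg (h : ℝ≥0∞) (j : ℤ) : tanhDepth h (-j) = tanhDepth h j :=
  le_antisymm (tanhDepth_mono h (by simp)) (tanhDepth_mono h (by simp))

lemma G₀_neg (h : ℝ≥0∞) (j : ℤ) : G₀ h (-j) = G₀ h j := by
  simp [G₀, tanhDepth_neg]

lemma Λ_neg (g κ : ℝ) (h : ℝ≥0∞) (j : ℤ) : Λ g κ h (-j) = Λ g κ h j := by
  simp [Λ, G₀_neg]

lemma Ω_abs (g κ : ℝ) (h : ℝ≥0∞) (j : ℤ) : Ω g κ h |j| = Ω g κ h j := by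
  have : tanhDepth h |j| = tanhDepth h j :=
    le_antisymm (tanhDepth_mono h (by simp)) (tanhDepth_mono h (by simp))
  simp [Ω, this]

lemma G₀_pos {h : ℝ≥0∞} (hh : 0 < h) {j : ℤ} (hj : j ≠ 0) : 0 < G₀ h j :=
  mul_pos (tanhDepth_pos hh hj) (abs_pos.2 (by exact_mod_cast hj))

lemma one_le_abs_cast {j : ℤ} (hj : j ≠ 0) : (1 : ℝ) ≤ |(j : ℝ)| := by
  exact_mod_cast Int.one_le_abs hj

section

variable {g κ : ℝ} (hg : 0 ≤ g) (hκ : 0 < κ) {h : ℝ≥0∞} (hh : 0 < h)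

include hg hκ

lemma gravity_capillary_pos {j : ℤ} (hj : j ≠ 0) : 0 < g + κ * (j : ℝ) ^ 2 := by
  have : (j : ℝ) ≠ 0 := by exact_mod_cast hj
  positivity

include hh in
lemma Λ_pos {j : ℤ} (hj : j ≠ 0) : 0 < Λ g κ h j :=
  mul_pos (Real.rpow_pos_of_pos (G₀_pos hh hj) _)
    (Real.rpow_pos_of_pos (gravity_capillary_pos hg hκ hj) _)

lemma Ω_eq_sqrt_mul_sqrt {j : ℤ} (hj : j ≠ 0) :
    Ω g κ h j = (g + κ * (j : ℝ) ^ 2) ^ (1 / 2 : ℝ) * G₀ h j ^ (1 / 2 : ℝ) := by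
  have h1 : κ * |(j : ℝ)| ^ 3 + g * |(j : ℝ)| = (g + κ * (j : ℝ) ^ 2) * |(j : ℝ)| := by
    rw [← sq_abs]; ring
  have h2 := (gravity_capillary_pos hg hκ hj).le
  rw [Ω, h1, ← Real.sqrt_eq_rpow, ← Real.sqrt_eq_rpow, G₀, Real.sqrt_mul h2,
    Real.sqrt_mul (tanhDepth_nonneg h j)]
  ring

include hh

/-- In the variables `Λ ψ`, `Λ⁻¹ η` the linearized system is a rotation of frequency `Ω`: this
is the equation for `η`. -/
lemma Ω_mul_Λ {j : ℤ} (hj : j ≠ 0) : Ω g κ h j * Λ g κ h j = (Λ g κ h j)⁻¹ * G₀ h j := by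
  have ha := gravity_capillary_pos hg hκ hj
  have hb := G₀_pos hh hj
  have hΛ := Λ_pos hg hκ hh hj
  rw [eq_inv_mul_iff_mul_eq₀ hΛ.ne', Ω_eq_sqrt_mul_sqrt hg hκ hj, Λ]
  set a := g + κ * (j : ℝ) ^ 2
  set b := G₀ h j
  calc b ^ (1 / 4 : ℝ) * a ^ (-(1 / 4) : ℝ) *
        (a ^ (1 / 2 : ℝ) * b ^ (1 / 2 : ℝ) * (b ^ (1 / 4 : ℝ) * a ^ (-(1 / 4) : ℝ)))
      = (a ^ (-(1 / 4) : ℝ) * a ^ (1 / 2 : ℝ) * a ^ (-(1 / 4) : ℝ)) *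
        (b ^ (1 / 4 : ℝ) * b ^ (1 / 2 : ℝ) * b ^ (1 / 4 : ℝ)) := by ring
    _ = b := by
      rw [← Real.rpow_add ha, ← Real.rpow_add ha, ← Real.rpow_add hb, ← Real.rpow_add hb]
      norm_num

/-- The companion of `Ω_mul_Λ` for `ψ`. -/
lemma Λ_mul_gravity_capillary {j : ℤ} (hj : j ≠ 0) :
    Λ g κ h j * (g + κ * (j : ℝ) ^ 2) = Ω g κ h j * (Λ g κ h j)⁻¹ := by
  have ha := gravity_capillary_pos hg hκ hj
  have hb := G₀_pos hh hj
  have hΛ := Λ_pos hg hκ hh hj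
  rw [eq_mul_inv_iff_mul_eq₀ hΛ.ne', Ω_eq_sqrt_mul_sqrt hg hκ hj, Λ]
  set a := g + κ * (j : ℝ) ^ 2
  set b := G₀ h j
  calc b ^ (1 / 4 : ℝ) * a ^ (-(1 / 4) : ℝ) * a * (b ^ (1 / 4 : ℝ) * a ^ (-(1 / 4) : ℝ))
      = (a ^ (-(1 / 4) : ℝ) * a ^ (1 : ℝ) * a ^ (-(1 / 4) : ℝ)) *
        (b ^ (1 / 4 : ℝ) * b ^ (1 / 4 : ℝ)) := by rw [Real.rpow_one]; ring
    _ = _ := by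
      rw [← Real.rpow_add ha, ← Real.rpow_add ha, ← Real.rpow_add hb]
      norm_num

lemma exists_Λ_le : ∃ K : ℝ, 0 ≤ K ∧ ∀ j : ℤ, j ≠ 0 →
    Λ g κ h j ≤ K ∧ (Λ g κ h j)⁻¹ ≤ K * |(j : ℝ)| := by
  set T := tanhDepth h 1
  have hT : 0 < T := tanhDepth_pos hh one_ne_zero
  refine ⟨max ((1 / κ) ^ (1 / 4 : ℝ)) (((g + κ) / T) ^ (1 / 4 : ℝ)), by positivity,
    fun j hj => ⟨le_max_of_le_left ?_, ?_⟩⟩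
  · have ha := gravity_capillary_pos hg hκ hj
    have hb := G₀_pos hh hj
    rw [Λ, Real.rpow_neg ha.le, ← div_eq_mul_inv, ← Real.div_rpow hb.le ha.le]
    refine Real.rpow_le_rpow (by positivity) ?_ (by norm_num)
    rw [div_le_div_iff₀ ha hκ, one_mul]
    have h1 := one_le_abs_cast hj
    have h2 : G₀ h j ≤ (j : ℝ) ^ 2 := by
      rw [G₀, ← sq_abs]
      nlinarith [tanhDepth_le_one h j, tanhDepth_nonneg h j]
    nlinarith
  · have ha := gravity_capillary_pos hg hκ hj
    have hb := G₀_pos hh hj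
    have h1 := one_le_abs_cast hj
    have h3 : (Λ g κ h j)⁻¹ ≤ (((g + κ) / T) * |(j : ℝ)|) ^ (1 / 4 : ℝ) := by
      rw [Λ, Real.rpow_neg ha.le, mul_inv, inv_inv, mul_comm, ← div_eq_mul_inv,
        ← Real.div_rpow ha.le hb.le]
      refine Real.rpow_le_rpow (by positivity) ?_ (by norm_num)
      rw [div_le_iff₀ hb, div_mul_eq_mul_div, div_mul_eq_mul_div, le_div_iff₀ hT]
      have h2 : T ≤ tanhDepth h j := tanhDepth_mono h (by simpa using Int.one_le_abs hj)
      have h4 : g + κ * (j : ℝ) ^ 2 ≤ (g + κ) * (|(j : ℝ)| * |(j : ℝ)|) := by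
        rw [← sq_abs]; nlinarith [mul_le_mul h1 h1 zero_le_one (abs_nonneg _)]
      rw [G₀]
      have := mul_le_mul h4 h2 hT.le (by positivity)
      linarith
    refine h3.trans ?_
    rw [Real.mul_rpow (by positivity) (by positivity)]
    refine mul_le_mul (le_max_right _ _) ?_ (by positivity) (by positivity)
    calc |(j : ℝ)| ^ (1 / 4 : ℝ) ≤ |(j : ℝ)| ^ (1 : ℝ) :=
          Real.rpow_le_rpow_of_exponent_le h1 (by norm_num)
      _ = |(j : ℝ)| := Real.rpow_one _

/-- Strict superadditivity of the dispersion relation: `Ω(j) / j` is the square root of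
`(κ j + g / j) tanh (h j)`, and `κ s + g / s > κ a + g / a` as soon as `κ a s > g`. -/
lemma Ω_add_lt {a b : ℤ} (ha : 0 < a) (hb : 0 < b) (hab : g < κ * (a + b : ℤ)) :
    Ω g κ h a + Ω g κ h b < Ω g κ h (a + b) := by
  have key : ∀ c : ℤ, 0 < c → c < a + b →
      Ω g κ h c < c * (Real.sqrt (κ * (a + b : ℤ) + g / (a + b : ℤ)) *
        Real.sqrt (tanhDepth h (a + b))) := by
    intro c hc hcs
    have hc' : (1 : ℝ) ≤ c := by exact_mod_cast hc
    have hcs' : (c : ℝ) < (a + b : ℤ) := by exact_mod_cast hcs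
    set s : ℝ := ((a + b : ℤ) : ℝ)
    have h0 : κ * |(c : ℝ)| ^ 3 + g * |(c : ℝ)| = (c : ℝ) ^ 2 * (κ * c + g / c) := by
      rw [abs_of_pos (by linarith)]; field_simp
    have h1 : Real.sqrt (κ * c + g / c) < Real.sqrt (κ * s + g / s) := by
      apply Real.sqrt_lt_sqrt (by positivity)
      have hs : 0 < s := by linarith
      have h2 : κ * s + g / s - (κ * c + g / c) = (s - c) * (κ * (c * s) - g) / (c * s) := by
        field_simp
        ring
      have h3 : 0 < (s - c) * (κ * (c * s) - g) / (c * s) := by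
        apply div_pos _ (by positivity)
        apply mul_pos (by linarith)
        nlinarith [mul_pos hκ hs]
      linarith
    have h2 : Real.sqrt (tanhDepth h c) ≤ Real.sqrt (tanhDepth h (a + b)) := by
      apply Real.sqrt_le_sqrt
      apply tanhDepth_mono
      rw [abs_of_pos hc, abs_of_pos (by lia)]
      exact hcs.le
    have h3 : 0 < Real.sqrt (tanhDepth h c) := Real.sqrt_pos.2 (tanhDepth_pos hh hc.ne')
    rw [Ω, h0, Real.sqrt_mul (by positivity), Real.sqrt_sq (by linarith), mul_assoc]
    apply mul_lt_mul_of_pos_left _ (by linarith)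
    exact mul_lt_mul h1 h2 h3 (Real.sqrt_nonneg _)
  have hs : (0 : ℝ) < (a + b : ℤ) := by exact_mod_cast add_pos ha hb
  have hab' : Ω g κ h (a + b) = (a + b : ℤ) * (Real.sqrt (κ * (a + b : ℤ) + g / (a + b : ℤ)) *
        Real.sqrt (tanhDepth h (a + b))) := by
    have h0 : κ * |((a + b : ℤ) : ℝ)| ^ 3 + g * |((a + b : ℤ) : ℝ)| =
        ((a + b : ℤ) : ℝ) ^ 2 * (κ * (a + b : ℤ) + g / (a + b : ℤ)) := by
      rw [abs_of_pos hs]; field_simp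
    rw [Ω, h0, Real.sqrt_mul (by positivity), Real.sqrt_sq hs.le, mul_assoc]
  have h1 := key a ha (by lia)
  have h2 := key b hb (by lia)
  rw [hab']
  have : ((a + b : ℤ) : ℝ) = a + b := by push_cast; ring
  calc _ < _ := add_lt_add h1 h2
    _ = _ := by rw [this]; ring

/-- There are finitely many three waves resonances. -/
lemma exists_resonance_bound : ∃ A : ℤ, ∀ (σ₀ σ₁ σ₂ : ℤˣ) (a b c : ℤ),
    a ≠ 0 → b ≠ 0 → c ≠ 0 → (σ₀ : ℤ) * a + (σ₁ : ℤ) * b + (σ₂ : ℤ) * c = 0 →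
    ((σ₀ : ℤ) : ℝ) * Ω g κ h a + ((σ₁ : ℤ) : ℝ) * Ω g κ h b + ((σ₂ : ℤ) : ℝ) * Ω g κ h c = 0 →
    |a| ≤ A ∧ |b| ≤ A ∧ |c| ≤ A := by
  obtain ⟨A, hA⟩ := exists_nat_gt (g / κ)
  have core : ∀ a b c : ℤ, b ≠ 0 → c ≠ 0 → |a| = |b| + |c| →
      Ω g κ h a ≤ Ω g κ h b + Ω g κ h c → |a| ≤ A := by
    intro a b c hb hc habc hle
    by_contra! hlt
    rw [← Ω_abs _ _ _ a, ← Ω_abs _ _ _ b, ← Ω_abs _ _ _ c, habc] at hle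
    refine absurd hle (not_le.2 (Ω_add_lt hg hκ hh (abs_pos.2 hb) (abs_pos.2 hc) ?_))
    rw [← habc]
    have : (A : ℝ) < (|a| : ℤ) := by exact_mod_cast hlt
    rw [div_lt_iff₀ hκ] at hA
    nlinarith
  have hnn : ∀ a, 0 ≤ Ω g κ h a := fun a => by unfold Ω; positivity
  refine ⟨A, fun σ₀ σ₁ σ₂ a b c ha hb hc hsum hΩ => ?_⟩
  have h3 : |a| = |b| + |c| ∧ Ω g κ h a ≤ Ω g κ h b + Ω g κ h c ∨
      |b| = |a| + |c| ∧ Ω g κ h b ≤ Ω g κ h a + Ω g κ h c ∨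
      |c| = |a| + |b| ∧ Ω g κ h c ≤ Ω g κ h a + Ω g κ h b := by
    have h4 := hnn a
    have h5 := hnn b
    have h6 := hnn c
    have h7 : Ω g κ h a ≤ Ω g κ h b + Ω g κ h c ∧ Ω g κ h b ≤ Ω g κ h a + Ω g κ h c ∧
        Ω g κ h c ≤ Ω g κ h a + Ω g κ h b := by
      rcases Int.units_eq_one_or σ₀ with rfl | rfl <;>
        rcases Int.units_eq_one_or σ₁ with rfl | rfl <;>
        rcases Int.units_eq_one_or σ₂ with rfl | rfl <;>
        push_cast at hΩ <;> refine ⟨?_, ?_, ?_⟩ <;> linarith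
    have h8 : |a| = |b| + |c| ∨ |b| = |a| + |c| ∨ |c| = |a| + |b| := by
      rcases Int.units_eq_one_or σ₀ with rfl | rfl <;>
        rcases Int.units_eq_one_or σ₁ with rfl | rfl <;>
        rcases Int.units_eq_one_or σ₂ with rfl | rfl <;>
        simp only [Units.val_one, Units.val_neg] at hsum <;>
        rcases abs_cases a with ha' | ha' <;> rcases abs_cases b with hb' | hb' <;>
        rcases abs_cases c with hc' | hc' <;> lia
    tauto
  have pa := abs_pos.2 ha
  have pb := abs_pos.2 hb
  have pc := abs_pos.2 hc
  rcases h3 with ⟨h1, h2⟩ | ⟨h1, h2⟩ | ⟨h1, h2⟩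
  · have := core a b c hb hc h1 h2
    refine ⟨?_, ?_, ?_⟩ <;> lia
  · have := core b a c ha hc h1 h2
    refine ⟨?_, ?_, ?_⟩ <;> lia
  · have := core c a b ha hb h1 h2
    refine ⟨?_, ?_, ?_⟩ <;> lia

end

/-! ### Quadratic vector fields on rapidly decreasing sequences -/

lemma sgn_add (σ : ℤˣ) (x y : ℂ) : sgn σ (x + y) = sgn σ x + sgn σ y := by
  unfold sgn; split_ifs <;> simp

lemma sgn_real_mul (σ : ℤˣ) (t : ℝ) (x : ℂ) : sgn σ ((t : ℂ) * x) = t * sgn σ x := by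
  unfold sgn; split_ifs <;> simp

lemma norm_sgn (σ : ℤˣ) (x : ℂ) : ‖sgn σ x‖ = ‖x‖ := by
  unfold sgn; split_ifs <;> simp

lemma conj_sgn (σ : ℤˣ) (x : ℂ) : conj (sgn σ x) = sgn (-σ) x := by
  rcases Int.units_eq_one_or σ with rfl | rfl <;> simp [sgn]

lemma continuous_sgn (σ : ℤˣ) : Continuous (sgn σ) := by
  unfold sgn
  split_ifs
  · exact continuous_id
  · exact Complex.continuous_conj

lemma abs_unit_mul_cast (σ : ℤˣ) (n : ℤ) : |(((σ : ℤ) * n : ℤ) : ℝ)| = |(n : ℝ)| := by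
  rcases Int.units_eq_one_or σ with rfl | rfl <;> simp

open Classical in
/-- A term of the series which defines `R(U)[Z]`. -/
noncomputable def bilinTerm (r : OpCoef) (ε σ σ' : ℤˣ) (u z : ℤ → ℂ) (j : ℤ) (p : ℤ × ℤ) : ℂ :=
  if p.1 ≠ 0 ∧ p.2 ≠ 0 ∧ (ε : ℤ) * p.1 + (σ' : ℤ) * p.2 = (σ : ℤ) * j then
    r ε σ σ' p.1 p.2 * sgn ε (u p.1) * sgn σ' (z p.2)
  else 0

/-- The bilinear map `R(U)[Z]`, of which `quadField` is the restriction to the diagonal. -/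
noncomputable def bilin (r : OpCoef) (u z : ℤ → ℂ) (σ : ℤˣ) (j : ℤ) : ℂ :=
  ∑ σ' : ℤˣ, ∑ ε : ℤˣ, ((1 / Real.sqrt (2 * Real.pi) : ℝ) : ℂ) *
    ∑' p : ℤ × ℤ, bilinTerm r ε σ σ' u z j p

lemma quadField_eq_bilin (r : OpCoef) (y : ℤ → ℂ) (σ : ℤˣ) (j : ℤ) :
    quadField r y σ j = bilin r y y σ j := rfl

lemma bilin_real_mul_left (r : OpCoef) (u z : ℤ → ℂ) (t : ℝ) (σ : ℤˣ) (j : ℤ) :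
    bilin r (fun n => (t : ℂ) * u n) z σ j = t * bilin r u z σ j := by
  simp only [bilin, Finset.mul_sum]
  refine Finset.sum_congr rfl fun σ' _ => Finset.sum_congr rfl fun ε _ => ?_
  rw [mul_left_comm]
  congr 1
  rw [← tsum_mul_left]
  refine tsum_congr fun p => ?_
  unfold bilinTerm
  split_ifs
  · rw [sgn_real_mul]; ring
  · simp

lemma bilin_real_mul_right (r : OpCoef) (u z : ℤ → ℂ) (t : ℝ) (σ : ℤˣ) (j : ℤ) :
    bilin r u (fun n => (t : ℂ) * z n) σ j = t * bilin r u z σ j := by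
  simp only [bilin, Finset.mul_sum]
  refine Finset.sum_congr rfl fun σ' _ => Finset.sum_congr rfl fun ε _ => ?_
  rw [mul_left_comm]
  congr 1
  rw [← tsum_mul_left]
  refine tsum_congr fun p => ?_
  unfold bilinTerm
  split_ifs
  · rw [sgn_real_mul]; ring
  · simp

/-- `|n|^N |u_n| ≤ A` for all `n ≠ 0`. -/
def DecayBound (N : ℕ) (A : ℝ) (u : ℤ → ℂ) : Prop :=
  ∀ n : ℤ, n ≠ 0 → |(n : ℝ)| ^ N * ‖u n‖ ≤ A

lemma DecayBound.nonneg {N : ℕ} {A : ℝ} {u : ℤ → ℂ} (h : DecayBound N A u) : 0 ≤ A :=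
  le_trans (by positivity) (h 1 one_ne_zero)

lemma DecayBound.add {N : ℕ} {A B : ℝ} {u v : ℤ → ℂ} (hu : DecayBound N A u)
    (hv : DecayBound N B v) : DecayBound N (A + B) (u + v) := fun n hn => by
  calc |(n : ℝ)| ^ N * ‖(u + v) n‖ ≤ |(n : ℝ)| ^ N * (‖u n‖ + ‖v n‖) := by
        gcongr; exact norm_add_le _ _
    _ ≤ A + B := by rw [mul_add]; exact add_le_add (hu n hn) (hv n hn)

lemma DecayBound.real_mul {N : ℕ} {A : ℝ} {u : ℤ → ℂ} (hu : DecayBound N A u) (t : ℝ) :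
    DecayBound N (|t| * A) (fun n => (t : ℂ) * u n) := fun n hn => by
  rw [norm_mul, Complex.norm_real, Real.norm_eq_abs, mul_left_comm]
  exact mul_le_mul_of_nonneg_left (hu n hn) (abs_nonneg t)

lemma summable_inv_sq_mul_inv_sq :
    Summable fun p : ℤ × ℤ => (1 / (p.1 : ℝ) ^ 2) * (1 / (p.2 : ℝ) ^ 2) := by
  have h : Summable fun n : ℤ => 1 / (n : ℝ) ^ 2 := Real.summable_one_div_int_pow.2 one_lt_two
  exact h.mul_of_nonneg h (fun _ => by positivity) (fun _ => by positivity)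

section

variable {m : ℝ} (hm : 0 ≤ m) {r : OpCoef} (hr : IsHomogeneousMap m r) {j : ℤ} (hj : j ≠ 0)

include hm hr hj

lemma exists_norm_bilinTerm_le : ∃ (M : ℕ) (K : ℝ), 0 ≤ K ∧
    ∀ (ε σ σ' : ℤˣ) (u z : ℤ → ℂ) (A B : ℝ), DecayBound M A u → DecayBound M B z →
      ∀ p : ℤ × ℤ, ‖bilinTerm r ε σ σ' u z j p‖ ≤
        K * A * B * ((1 / (p.1 : ℝ) ^ 2) * (1 / (p.2 : ℝ) ^ 2)) := by
  obtain ⟨C, hC⟩ := hr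
  refine ⟨⌈m⌉₊ + 2, |C| * (3 * |(j : ℝ)|) ^ m, by positivity, ?_⟩
  intro ε σ σ' u z A B hu hz p
  have hA := hu.nonneg
  have hB := hz.nonneg
  unfold bilinTerm
  split_ifs with hp
  swap
  · rw [norm_zero]; positivity
  obtain ⟨hn, hk, hsum⟩ := hp
  obtain ⟨n, k⟩ := p
  simp only at hn hk hsum ⊢
  have hσj : (σ : ℤ) * j ≠ 0 := mul_ne_zero σ.ne_zero hj
  have h1 := hC ε σ σ' n k hn hk (by rw [hsum]; exact hσj)
  rw [hsum, abs_unit_mul_cast] at h1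
  have an := one_le_abs_cast hn
  have ak := one_le_abs_cast hk
  have aj := one_le_abs_cast hj
  set a := |(n : ℝ)| with ha
  set b := |(k : ℝ)| with hb
  set c := |(j : ℝ)| with hc
  have h2 : a + b + c ≤ 3 * c * (a * b) := by
    have hab : 1 ≤ a * b := one_le_mul_of_one_le_of_one_le an ak
    have hac : 1 ≤ c * a := one_le_mul_of_one_le_of_one_le aj an
    have hbc : 1 ≤ c * b := one_le_mul_of_one_le_of_one_le aj ak
    nlinarith [mul_le_mul_of_nonneg_left hbc (by linarith : 0 ≤ a),
      mul_le_mul_of_nonneg_left hac (by linarith : 0 ≤ b),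
      mul_le_mul_of_nonneg_left hab (by linarith : 0 ≤ c)]
  have h3 : (a + b + c) ^ m ≤ (3 * c) ^ m * (a ^ ⌈m⌉₊ * b ^ ⌈m⌉₊) := by
    calc (a + b + c) ^ m ≤ (3 * c * (a * b)) ^ m :=
          Real.rpow_le_rpow (by positivity) h2 hm
      _ = (3 * c) ^ m * (a ^ m * b ^ m) := by
          rw [Real.mul_rpow (x := 3 * c) (by positivity) (by positivity),
            Real.mul_rpow (x := a) (by positivity) (by positivity)]
      _ ≤ (3 * c) ^ m * (a ^ (⌈m⌉₊ : ℝ) * b ^ (⌈m⌉₊ : ℝ)) := by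
          have := Nat.le_ceil m
          gcongr
      _ = _ := by rw [Real.rpow_natCast, Real.rpow_natCast]
  have h4 : ‖r ε σ σ' n k‖ ≤ |C| * ((3 * c) ^ m * (a ^ ⌈m⌉₊ * b ^ ⌈m⌉₊)) :=
    h1.trans (mul_le_mul (le_abs_self C) h3 (by positivity) (abs_nonneg C))
  have hu' := hu n hn
  have hz' := hz k hk
  rw [norm_mul, norm_mul, norm_sgn, norm_sgn, ← sq_abs (n : ℝ), ← sq_abs (k : ℝ), ← ha, ← hb]
  have ha2 : 0 < a ^ 2 := by positivity
  have hb2 : 0 < b ^ 2 := by positivity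
  rw [← mul_assoc, mul_one_div, mul_one_div, le_div_iff₀ hb2, le_div_iff₀ ha2]
  calc ‖r ε σ σ' n k‖ * ‖u n‖ * ‖z k‖ * b ^ 2 * a ^ 2
      ≤ |C| * ((3 * c) ^ m * (a ^ ⌈m⌉₊ * b ^ ⌈m⌉₊)) * ‖u n‖ * ‖z k‖ * b ^ 2 * a ^ 2 := by
        gcongr
    _ = |C| * (3 * c) ^ m * (a ^ (⌈m⌉₊ + 2) * ‖u n‖) * (b ^ (⌈m⌉₊ + 2) * ‖z k‖) := by ring
    _ ≤ |C| * (3 * c) ^ m * A * B := by gcongr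

/-- The basic properties of the series `R(U)[Z]`, for an integer `M` that depends on the order
of `R`: the terms with `M` bounds on `u` and `z` are dominated by a fixed summable family. -/
lemma exists_summable_bilinTerm : ∃ (M : ℕ) (b : ℤ × ℤ → ℝ), Summable b ∧ (∀ p, 0 ≤ b p) ∧
    ∀ (ε σ σ' : ℤˣ) (u z : ℤ → ℂ) (A B : ℝ), DecayBound M A u → DecayBound M B z →
      ∀ p : ℤ × ℤ, ‖bilinTerm r ε σ σ' u z j p‖ ≤ A * B * b p := by
  obtain ⟨M, K, hK, h⟩ := exists_norm_bilinTerm_le hm hr hj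
  refine ⟨M, fun p => K * ((1 / (p.1 : ℝ) ^ 2) * (1 / (p.2 : ℝ) ^ 2)),
    summable_inv_sq_mul_inv_sq.mul_left K, fun p => by positivity, ?_⟩
  intro ε σ σ' u z A B hu hz p
  refine (h ε σ σ' u z A B hu hz p).trans (le_of_eq ?_)
  ring

lemma exists_bilin_estimates : ∃ (M : ℕ) (K : ℝ), 0 ≤ K ∧
    (∀ (σ : ℤˣ) (u z : ℤ → ℂ) (A B : ℝ), DecayBound M A u → DecayBound M B z →
      ‖bilin r u z σ j‖ ≤ K * A * B) ∧
    (∀ (σ : ℤˣ) (u u' z : ℤ → ℂ) (A A' B : ℝ), DecayBound M A u → DecayBound M A' u' →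
      DecayBound M B z → bilin r (u + u') z σ j = bilin r u z σ j + bilin r u' z σ j) ∧
    (∀ (σ : ℤˣ) (u z z' : ℤ → ℂ) (A B B' : ℝ), DecayBound M A u → DecayBound M B z →
      DecayBound M B' z' → bilin r u (z + z') σ j = bilin r u z σ j + bilin r u z' σ j) := by
  obtain ⟨M, b, hb, hb0, h⟩ := exists_summable_bilinTerm hm hr hj
  have hs : ∀ (ε σ σ' : ℤˣ) (u z : ℤ → ℂ) (A B : ℝ), DecayBound M A u → DecayBound M B z →
      Summable (bilinTerm r ε σ σ' u z j) := fun ε σ σ' u z A B hu hz =>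
    Summable.of_norm_bounded (hb.mul_left (A * B)) (h ε σ σ' u z A B hu hz)
  refine ⟨M, ∑ _σ' : ℤˣ, ∑ _ε : ℤˣ, (1 / Real.sqrt (2 * Real.pi)) * ∑' p, b p, ?_, ?_, ?_, ?_⟩
  · have : 0 ≤ ∑' p, b p := tsum_nonneg hb0
    positivity
  · intro σ u z A B hu hz
    rw [Finset.sum_mul, Finset.sum_mul]
    refine norm_sum_le_of_le _ fun σ' _ => ?_
    rw [Finset.sum_mul, Finset.sum_mul]
    refine norm_sum_le_of_le _ fun ε _ => ?_
    rw [norm_mul, Complex.norm_real, Real.norm_of_nonneg (by positivity), mul_assoc, mul_assoc]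
    gcongr
    refine (tsum_of_norm_bounded (hb.mul_left (A * B)).hasSum
      (h ε σ σ' u z A B hu hz)).trans (le_of_eq ?_)
    rw [tsum_mul_left]
    ring
  · intro σ u u' z A A' B hu hu' hz
    simp only [bilin, ← Finset.sum_add_distrib, ← mul_add]
    refine Finset.sum_congr rfl fun σ' _ => Finset.sum_congr rfl fun ε _ => ?_
    rw [← (hs ε σ σ' u z A B hu hz).tsum_add (hs ε σ σ' u' z A' B hu' hz)]
    congr 1
    refine tsum_congr fun p => ?_
    unfold bilinTerm
    split_ifs
    · rw [Pi.add_apply, sgn_add]; ring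
    · simp
  · intro σ u z z' A B B' hu hz hz'
    simp only [bilin, ← Finset.sum_add_distrib, ← mul_add]
    refine Finset.sum_congr rfl fun σ' _ => Finset.sum_congr rfl fun ε _ => ?_
    rw [← (hs ε σ σ' u z A B hu hz).tsum_add (hs ε σ σ' u z' A B' hu hz')]
    congr 1
    refine tsum_congr fun p => ?_
    unfold bilinTerm
    split_ifs
    · rw [Pi.add_apply, sgn_add]; ring
    · simp

/-- Dominated convergence for `R(U)[Z]`. -/
lemma tendsto_bilin {ι : Type*} {l : Filter ι} (σ : ℤˣ) {u z : ι → ℤ → ℂ} {u₀ z₀ : ℤ → ℂ}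
    (hu : ∀ n, n ≠ 0 → Filter.Tendsto (fun i => u i n) l (nhds (u₀ n)))
    (hz : ∀ n, n ≠ 0 → Filter.Tendsto (fun i => z i n) l (nhds (z₀ n)))
    (hu' : ∀ M, ∃ A, ∀ᶠ i in l, DecayBound M A (u i))
    (hz' : ∀ M, ∃ A, ∀ᶠ i in l, DecayBound M A (z i)) :
    Filter.Tendsto (fun i => bilin r (u i) (z i) σ j) l (nhds (bilin r u₀ z₀ σ j)) := by
  obtain ⟨M, b, hb, hb0, h⟩ := exists_summable_bilinTerm hm hr hj
  obtain ⟨A, hA⟩ := hu' M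
  obtain ⟨B, hB⟩ := hz' M
  refine tendsto_finsetSum _ fun σ' _ => tendsto_finsetSum _ fun ε _ => ?_
  refine Filter.Tendsto.const_mul _ (tendsto_tsum_of_dominated_convergence
    (hb.mul_left (A * B)) (fun p => ?_) ?_)
  · unfold bilinTerm
    split_ifs with hp
    · exact (((continuous_sgn ε).tendsto _).comp (hu _ hp.1) |>.const_mul _).mul
        (((continuous_sgn σ').tendsto _).comp (hz _ hp.2.1))
    · exact tendsto_const_nhds
  · filter_upwards [hA, hB] with i hi hi'
    exact h ε σ σ' _ _ A B hi hi'

/-- The quadratic vector field `R(Y)[Y]` is differentiable along curves of smooth functions. -/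
lemma hasDerivAt_quadField {c : ℝ → ℤ → ℂ} {w v : ℤ → ℂ} (hc : IsCurveThrough c w v)
    (hw : ∀ M, ∃ A, DecayBound M A w) (hv : ∀ M, ∃ A, DecayBound M A v) (σ : ℤˣ) :
    HasDerivAt (fun t => quadField r (c t) σ j) (bilin r w v σ j + bilin r v w σ j) 0 := by
  obtain ⟨M, K, hK, hbd, hadd, hadd'⟩ := exists_bilin_estimates hm hr hj
  obtain ⟨A, hA⟩ := hw M
  obtain ⟨B, hB⟩ := hv M
  obtain ⟨hc0, -, hc1⟩ := hc
  have hA0 := hA.nonneg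
  have hB0 := hB.nonneg
  rw [hasDerivAt_iff_isLittleO, Asymptotics.isLittleO_iff]
  intro a ha
  set L := K * (2 * A) + 1 with hL
  set L' := K * (B + 1) ^ 2 + 1 with hL'
  have hLp : 0 < L := by positivity
  have hLp' : 0 < L' := by positivity
  set δ := min 1 (a / (2 * L)) with hδ
  have hδ0 : 0 < δ := lt_min one_pos (by positivity)
  have ht : ∀ᶠ t : ℝ in nhds 0, |t| < a / (2 * L') := by
    have : Filter.Tendsto (fun t : ℝ => |t|) (nhds 0) (nhds |0|) := continuous_abs.tendsto 0
    exact this.eventually (gt_mem_nhds (by rw [abs_zero]; positivity))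
  filter_upwards [hc1 M δ hδ0, ht] with t hct htt
  set e : ℤ → ℂ := fun n => c t n - w n - (t : ℂ) * v n with he
  set tv : ℤ → ℂ := fun n => (t : ℂ) * v n with htv
  have hE : DecayBound M (δ * |t|) e := hct
  have hTV : DecayBound M (|t| * B) tv := hB.real_mul t
  have hD := hTV.add hE
  have hct' : c t = w + (tv + e) := by
    ext n; simp [he, htv]
  have hexp : quadField r (c t) σ j = bilin r w w σ j + t * (bilin r w v σ j + bilin r v w σ j)
      + (bilin r w e σ j + bilin r e w σ j + bilin r (tv + e) (tv + e) σ j) := by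
    rw [quadField_eq_bilin, hct', hadd σ w (tv + e) (w + (tv + e)) _ _ _ hA hD (hA.add hD),
      hadd' σ w w (tv + e) _ _ _ hA hA hD, hadd' σ w tv e _ _ _ hA hTV hE,
      hadd' σ (tv + e) w (tv + e) _ _ _ hD hA hD, hadd σ tv e w _ _ _ hTV hE hA,
      bilin_real_mul_left, bilin_real_mul_right]
    ring
  have h1 := hbd σ w e _ _ hA hE
  have h2 := hbd σ e w _ _ hE hA
  have h3 := hbd σ (tv + e) (tv + e) _ _ hD hD
  have hq0 : quadField r (c 0) σ j = bilin r w w σ j := by rw [hc0, quadField_eq_bilin]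
  rw [hexp, hq0, sub_zero, Complex.real_smul, Real.norm_eq_abs]
  have h4 : L * δ ≤ a / 2 := by
    have : δ ≤ a / (2 * L) := min_le_right _ _
    rw [le_div_iff₀ (by positivity)] at this
    linarith
  have h5 : L' * |t| ≤ a / 2 := by
    rw [lt_div_iff₀ (by positivity)] at htt
    linarith
  have h6 : (|t| * B + δ * |t|) * (|t| * B + δ * |t|) ≤ (B + 1) ^ 2 * |t| * |t| := by
    have : |t| * B + δ * |t| ≤ (B + 1) * |t| := by
      nlinarith [abs_nonneg t, min_le_left 1 (a / (2 * L))]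
    calc _ ≤ ((B + 1) * |t|) * ((B + 1) * |t|) :=
          mul_le_mul this this (by positivity) (by positivity)
      _ = _ := by ring
  calc _ = ‖bilin r w e σ j + bilin r e w σ j + bilin r (tv + e) (tv + e) σ j‖ := by
        congr 1; ring
    _ ≤ ‖bilin r w e σ j‖ + ‖bilin r e w σ j‖ + ‖bilin r (tv + e) (tv + e) σ j‖ :=
        norm_add₃_le
    _ ≤ K * A * (δ * |t|) + K * (δ * |t|) * A +
        K * (|t| * B + δ * |t|) * (|t| * B + δ * |t|) := by gcongr
    _ ≤ K * A * (δ * |t|) + K * (δ * |t|) * A + K * ((B + 1) ^ 2 * |t| * |t|) := by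
        rw [mul_assoc K (|t| * B + δ * |t|)]
        gcongr
    _ ≤ (L * δ) * |t| + (L' * |t|) * |t| := by
        rw [hL, hL']
        nlinarith [mul_nonneg hδ0.le (abs_nonneg t), mul_nonneg (abs_nonneg t) (abs_nonneg t)]
    _ ≤ a / 2 * |t| + a / 2 * |t| := by gcongr
    _ = a * |t| := by ring

end

/-! ### Sobolev norms -/

lemma norm_le_of_sobolevNorm_le {s B : ℝ} (hB : 0 ≤ B) {u : ℤ → ℂ}
    (h : sobolevNorm s u ≤ ENNReal.ofReal B) {j : ℤ} (hj : j ≠ 0) :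
    ‖u j‖ ≤ |(j : ℝ)| ^ (-s) * B := by
  have hj' : 0 < |(j : ℝ)| := lt_of_lt_of_le one_pos (one_le_abs_cast hj)
  have h1 : ENNReal.ofReal (|(j : ℝ)| ^ (2 * s) * ‖u j‖ ^ 2) ≤ ENNReal.ofReal (B ^ 2) := by
    have h2 : ENNReal.ofReal (|(j : ℝ)| ^ (2 * s) * ‖u j‖ ^ 2) ≤
        ∑' n : ℤ, if n = 0 then 0 else ENNReal.ofReal (|(n : ℝ)| ^ (2 * s) * ‖u n‖ ^ 2) := by
      have := ENNReal.le_tsum (f := fun n : ℤ =>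
        if n = 0 then 0 else ENNReal.ofReal (|(n : ℝ)| ^ (2 * s) * ‖u n‖ ^ 2)) j
      simpa only [if_neg hj] using this
    refine h2.trans ?_
    have h3 := ENNReal.rpow_le_rpow h (by norm_num : (0 : ℝ) ≤ 2)
    rw [sobolevNorm, ← ENNReal.rpow_mul] at h3
    norm_num at h3
    rwa [ENNReal.ofReal_pow hB]
  rw [ENNReal.ofReal_le_ofReal_iff (by positivity), mul_comm 2 s, Real.rpow_mul hj'.le,
    Real.rpow_two, ← mul_pow] at h1
  have h4 := abs_le_of_sq_le_sq h1 hB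
  rw [Real.rpow_neg hj'.le, inv_mul_eq_div, le_div_iff₀ (by positivity), mul_comm]
  exact (le_abs_self _).trans h4

lemma exists_sobolevNorm_le (s : ℝ) : ∃ (N : ℕ) (K : ℝ), 0 ≤ K ∧
    ∀ (A : ℝ) (u : ℤ → ℂ), DecayBound N A u → sobolevNorm s u ≤ ENNReal.ofReal (K * A) := by
  have hs : Summable fun n : ℤ => 1 / (n : ℝ) ^ 2 := Real.summable_one_div_int_pow.2 one_lt_two
  refine ⟨⌈s + 1⌉₊, Real.sqrt (∑' n : ℤ, 1 / (n : ℝ) ^ 2), by positivity, ?_⟩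
  intro A u hu
  have hA := hu.nonneg
  have h1 : (∑' n : ℤ, if n = 0 then 0 else ENNReal.ofReal (|(n : ℝ)| ^ (2 * s) * ‖u n‖ ^ 2)) ≤
      ENNReal.ofReal ((∑' n : ℤ, 1 / (n : ℝ) ^ 2) * A ^ 2) := by
    rw [← tsum_mul_right, ENNReal.ofReal_tsum_of_nonneg (fun n => by positivity)
      (hs.mul_right _)]
    refine ENNReal.tsum_le_tsum fun n => ?_
    split_ifs with hn
    · exact bot_le
    refine ENNReal.ofReal_le_ofReal ?_
    have hn1 := one_le_abs_cast hn
    have hn' : 0 < |(n : ℝ)| := by linarith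
    have h2 : |(n : ℝ)| ^ s * ‖u n‖ * |(n : ℝ)| ≤ A := by
      calc |(n : ℝ)| ^ s * ‖u n‖ * |(n : ℝ)| = |(n : ℝ)| ^ (s + 1) * ‖u n‖ := by
            rw [Real.rpow_add_one hn'.ne']; ring
        _ ≤ |(n : ℝ)| ^ (⌈s + 1⌉₊ : ℝ) * ‖u n‖ := by
            gcongr
            exact Nat.le_ceil _
        _ ≤ A := by rw [Real.rpow_natCast]; exact hu n hn
    rw [mul_comm 2 s, Real.rpow_mul hn'.le, Real.rpow_two, ← mul_pow, one_div,
      inv_mul_eq_div, le_div_iff₀ (by positivity), ← sq_abs (n : ℝ), ← mul_pow]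
    exact pow_le_pow_left₀ (by positivity) h2 2
  calc sobolevNorm s u ≤ (ENNReal.ofReal ((∑' n : ℤ, 1 / (n : ℝ) ^ 2) * A ^ 2)) ^ (1 / 2 : ℝ) :=
        ENNReal.rpow_le_rpow h1 (by norm_num)
    _ = _ := by
        rw [ENNReal.ofReal_rpow_of_nonneg (by positivity) (by norm_num), ← Real.sqrt_eq_rpow,
          Real.sqrt_mul (by positivity), Real.sqrt_sq hA]

/-! ### Fourier coefficients of smooth families of functions -/

lemma norm_exp_neg_I_mul (n : ℤ) (x : ℝ) : ‖Complex.exp (-(Complex.I * n * x))‖ = 1 := by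
  have : -(Complex.I * n * x) = ((-(n * x) : ℝ) : ℂ) * Complex.I := by push_cast; ring
  rw [this, Complex.norm_exp_ofReal_mul_I]

lemma fourierCoef_const_mul (t : ℝ) (f : ℝ → ℝ) (n : ℤ) :
    fourierCoef (fun x => t * f x) n = t * fourierCoef f n := by
  unfold fourierCoef
  rw [mul_left_comm]
  congr 1
  rw [← intervalIntegral.integral_const_mul]
  refine intervalIntegral.integral_congr fun x _ => ?_
  push_cast
  ring

lemma norm_fourierCoef_le {f : ℝ → ℝ} {B : ℝ} (hB : ∀ x ∈ Set.Icc (0 : ℝ) (2 * Real.pi), |f x| ≤ B)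
    (n : ℤ) : ‖fourierCoef f n‖ ≤ (1 / Real.sqrt (2 * Real.pi)) * (B * (2 * Real.pi)) := by
  have h2π : 0 ≤ 2 * Real.pi := by positivity
  unfold fourierCoef
  rw [norm_mul, Complex.norm_real, Real.norm_of_nonneg (by positivity)]
  gcongr
  refine (intervalIntegral.norm_integral_le_of_norm_le_const (C := B) fun x hx => ?_).trans ?_
  · rw [norm_mul, norm_exp_neg_I_mul, mul_one, Complex.norm_real]
    rw [Set.uIoc_of_le h2π] at hx
    exact hB x ⟨hx.1.le, hx.2⟩
  · rw [sub_zero, abs_of_nonneg h2π]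

/-- Integration by parts. -/
lemma fourierCoef_deriv {f f' : ℝ → ℝ} (hf : ∀ x, HasDerivAt f (f' x) x) (hf' : Continuous f')
    (hper : ∀ x, f (x + 2 * Real.pi) = f x) (n : ℤ) :
    fourierCoef f' n = Complex.I * n * fourierCoef f n := by
  unfold fourierCoef
  rw [mul_left_comm]
  congr 1
  have hexp : ∀ x : ℝ, HasDerivAt (fun x : ℝ => Complex.exp (-(Complex.I * n * x)))
      (Complex.exp (-(Complex.I * n * x)) * (-(Complex.I * n))) x := by
    intro x
    have h1 : HasDerivAt (fun x : ℝ => -(Complex.I * n * (x : ℂ))) (-(Complex.I * n)) x := by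
      have := ((hasDerivAt_id x).ofReal_comp.const_mul (-(Complex.I * n)))
      simpa [neg_mul] using this
    exact h1.cexp
  have hcont : Continuous fun x : ℝ => Complex.exp (-(Complex.I * n * x)) := by fun_prop
  have h := intervalIntegral.integral_mul_deriv_eq_deriv_mul (a := 0) (b := 2 * Real.pi)
    (u := fun x : ℝ => Complex.exp (-(Complex.I * n * x)))
    (v := fun x : ℝ => (f x : ℂ)) (v' := fun x : ℝ => (f' x : ℂ))
    (fun x _ => hexp x) (fun x _ => (hf x).ofReal_comp)
    (Continuous.intervalIntegrable (by fun_prop) _ _)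
    (Continuous.intervalIntegrable (by fun_prop) _ _)
  have h0 : Complex.exp (-(Complex.I * n * (2 * Real.pi : ℝ))) = 1 := by
    rw [Complex.exp_eq_one_iff]
    exact ⟨-n, by push_cast; ring⟩
  have hf0 : f (2 * Real.pi) = f 0 := by simpa using hper 0
  rw [h0, hf0] at h
  simp only [Complex.ofReal_zero, mul_zero, neg_zero, Complex.exp_zero, sub_self, zero_sub] at h
  rw [← intervalIntegral.integral_const_mul]
  calc ∫ x in (0 : ℝ)..(2 * Real.pi), (f' x : ℂ) * Complex.exp (-(Complex.I * n * x))
      = ∫ x in (0 : ℝ)..(2 * Real.pi), Complex.exp (-(Complex.I * n * x)) * (f' x : ℂ) := by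
        refine intervalIntegral.integral_congr fun x _ => ?_
        exact mul_comm _ _
    _ = _ := by
        rw [h, ← intervalIntegral.integral_neg]
        refine intervalIntegral.integral_congr fun x _ => ?_
        ring

section

variable {F : ℝ × ℝ → ℝ}

lemma hasDerivAt_snd_of_contDiff (hF : ContDiff ℝ ∞ F) (ε x : ℝ) :
    HasDerivAt (fun x => F (ε, x)) (fderiv ℝ F (ε, x) (0, 1)) x := by
  have h1 : HasFDerivAt F (fderiv ℝ F (ε, x)) (ε, x) :=
    (hF.differentiable (by simp) _).hasFDerivAt
  have h2 : HasDerivAt (fun x : ℝ => (ε, x)) ((0 : ℝ), (1 : ℝ)) x :=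
    (hasDerivAt_const x ε).prodMk (hasDerivAt_id x)
  exact h1.comp_hasDerivAt x h2

lemma hasDerivAt_fst_of_contDiff (hF : ContDiff ℝ ∞ F) (ε x : ℝ) :
    HasDerivAt (fun ε => F (ε, x)) (fderiv ℝ F (ε, x) (1, 0)) ε := by
  have h1 : HasFDerivAt F (fderiv ℝ F (ε, x)) (ε, x) :=
    (hF.differentiable (by simp) _).hasFDerivAt
  have h2 : HasDerivAt (fun ε : ℝ => (ε, x)) ((1 : ℝ), (0 : ℝ)) ε :=
    (hasDerivAt_id ε).prodMk (hasDerivAt_const ε x)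
  exact h1.comp_hasDerivAt ε h2

lemma contDiff_fderiv_apply (hF : ContDiff ℝ ∞ F) (a : ℝ × ℝ) :
    ContDiff ℝ ∞ fun p => fderiv ℝ F p a :=
  (hF.fderiv_right (m := ∞) (by simp)).clm_apply contDiff_const

/-- The Fourier coefficients of a smooth family decay rapidly, uniformly on compact sets of
parameters. -/
lemma exists_decayBound_fourierCoef (N : ℕ) : ∀ {F : ℝ × ℝ → ℝ}, ContDiff ℝ ∞ F →
    (∀ ε x, F (ε, x + 2 * Real.pi) = F (ε, x)) →
    ∃ A : ℝ, ∀ ε ∈ Set.Icc (-1 : ℝ) 1, DecayBound N A (fourierCoef fun x => F (ε, x)) := by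
  induction N with
  | zero =>
    intro F hF _
    obtain ⟨B, hB⟩ := ((isCompact_Icc (a := (-1 : ℝ)) (b := 1)).prod
      (isCompact_Icc (a := (0 : ℝ)) (b := 2 * Real.pi))).exists_bound_of_continuousOn
      hF.continuous.continuousOn
    refine ⟨(1 / Real.sqrt (2 * Real.pi)) * (B * (2 * Real.pi)), fun ε hε n _ => ?_⟩
    rw [pow_zero, one_mul]
    exact norm_fourierCoef_le (fun x hx => hB (ε, x) ⟨hε, hx⟩) n
  | succ N ih =>
    intro F hF hper
    have hF' := contDiff_fderiv_apply hF (0, 1)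
    obtain ⟨A, hA⟩ := ih hF' (by
      intro ε x
      have h1 := hasDerivAt_snd_of_contDiff hF ε (x + 2 * Real.pi)
      have h2 := h1.comp_add_const x (2 * Real.pi)
      simp only [hper] at h2
      exact h2.unique (hasDerivAt_snd_of_contDiff hF ε x))
    refine ⟨A, fun ε hε n hn => ?_⟩
    have h1 := fourierCoef_deriv (hasDerivAt_snd_of_contDiff hF ε)
      (hF'.continuous.comp (by fun_prop : Continuous fun x : ℝ => (ε, x))) (hper ε) n
    have h2 := hA ε hε n hn
    have h3 : ‖fourierCoef (fun x => fderiv ℝ F (ε, x) (0, 1)) n‖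
        = |(n : ℝ)| * ‖fourierCoef (fun x => F (ε, x)) n‖ := by
      refine (congrArg norm h1).trans ?_
      rw [norm_mul, norm_mul, Complex.norm_I, one_mul, Complex.norm_intCast]
    rw [h3] at h2
    rwa [pow_succ, mul_assoc]

/-- Differentiation under the integral sign. -/
lemma hasDerivAt_fourierCoef (hF : ContDiff ℝ ∞ F) {F₁ : ℝ → ℝ}
    (hF₁ : ∀ x, HasDerivAt (fun ε => F (ε, x)) (F₁ x) 0) (n : ℤ) :
    HasDerivAt (fun ε : ℝ => fourierCoef (fun x => F (ε, x)) n) (fourierCoef F₁ n) 0 := by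
  have hF' := contDiff_fderiv_apply hF (1, 0)
  obtain ⟨B, hB⟩ := ((isCompact_Icc (a := (-1 : ℝ)) (b := 1)).prod
      (isCompact_Icc (a := (0 : ℝ)) (b := 2 * Real.pi))).exists_bound_of_continuousOn
      hF'.continuous.continuousOn
  have h1 : F₁ = fun x => fderiv ℝ F (0, x) (1, 0) :=
    funext fun x => (hF₁ x).unique (hasDerivAt_fst_of_contDiff hF 0 x)
  have h2π : 0 ≤ 2 * Real.pi := by positivity
  have hc := hF.continuous
  have hc' := hF'.continuous
  have hpair : ∀ ε : ℝ, Continuous fun x : ℝ => (ε, x) := fun ε => by fun_prop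
  have hcx : ∀ ε : ℝ, Continuous fun x : ℝ => F (ε, x) := fun ε => hc.comp (hpair ε)
  have hcx' : ∀ ε : ℝ, Continuous fun x : ℝ => fderiv ℝ F (ε, x) (1, 0) :=
    fun ε => hc'.comp (hpair ε)
  rw [h1]
  unfold fourierCoef
  refine HasDerivAt.const_mul _ (intervalIntegral.hasDerivAt_integral_of_dominated_loc_of_deriv_le
    (F := fun (ε : ℝ) (x : ℝ) => (F (ε, x) : ℂ) * Complex.exp (-(Complex.I * n * x)))
    (F' := fun (ε : ℝ) (x : ℝ) =>
      (fderiv ℝ F (ε, x) (1, 0) : ℂ) * Complex.exp (-(Complex.I * n * x)))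
    (bound := fun _ => B) (s := Set.Icc (-1 : ℝ) 1)
    (Icc_mem_nhds (by norm_num) (by norm_num)) ?_ ?_ ?_ ?_ ?_ ?_).2
  · refine Filter.Eventually.of_forall fun ε => ?_
    have := hcx ε
    exact Continuous.aestronglyMeasurable (by fun_prop)
  · have := hcx 0
    exact Continuous.intervalIntegrable (by fun_prop) _ _
  · have := hcx' 0
    exact Continuous.aestronglyMeasurable (by fun_prop)
  · refine Filter.Eventually.of_forall fun x hx ε hε => ?_
    rw [Set.uIoc_of_le h2π] at hx
    rw [norm_mul, norm_exp_neg_I_mul, mul_one, Complex.norm_real]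
    exact hB (ε, x) ⟨hε, hx.1.le, hx.2⟩
  · exact intervalIntegrable_const
  · refine Filter.Eventually.of_forall fun x _ ε _ => ?_
    exact (hasDerivAt_fst_of_contDiff hF ε x).ofReal_comp.mul_const _

end

/-! ### Families of states with an explicit velocity potential -/

/-- A function that is harmonic on the whole plane, `2π`-periodic in the first variable, and
satisfies the Neumann condition at the bottom.  It is the velocity potential of a state of the
fluid for every free surface. -/
structure IsEntirePotential (h : ℝ≥0∞) (Φ : ℝ × ℝ → ℝ) : Prop where
  smooth : ContDiff ℝ ∞ Φ
  periodic : ∀ x y, Φ (x + 2 * Real.pi, y) = Φ (x, y)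
  harmonic : ∀ x y,
    iteratedDeriv 2 (fun x' => Φ (x', y)) x + iteratedDeriv 2 (fun y' => Φ (x, y')) y = 0
  bottom : h ≠ ⊤ → ∀ x, deriv (fun y' => Φ (x, y')) (-h.toReal) = 0
  bottom_infinite : h = ⊤ →
    TendstoUniformly (fun y x => deriv (fun y' => Φ (x, y')) y) (fun _ => 0) Filter.atBot

lemma IsEntirePotential.isPotential {h : ℝ≥0∞} {Φ : ℝ × ℝ → ℝ} (hΦ : IsEntirePotential h Φ)
    (η : ℝ → ℝ) (ε : ℝ) :
    IsPotential h η (fun x => ε * Φ (x, η x)) (fun x y => ε * Φ (x, y)) where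
  smooth := contDiff_const.mul hΦ.smooth
  periodic x y := by rw [hΦ.periodic]
  harmonic x y _ := by
    rw [iteratedDeriv_const_mul_field, iteratedDeriv_const_mul_field, ← mul_add, hΦ.harmonic,
      mul_zero]
  bottom hh x := by
    rw [deriv_const_mul_field, hΦ.bottom hh, mul_zero]
  bottom_infinite hh := by
    have h1 := (uniformContinuous_const_smul (M := ℝ) (X := ℝ) ε).comp_tendstoUniformly
      (hΦ.bottom_infinite hh)
    simp only [deriv_const_mul_field]
    have h2 : (fun _ : ℝ => (0 : ℝ)) = (fun x : ℝ => ε • x) ∘ fun _ : ℝ => (0 : ℝ) := by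
      ext x; simp
    rw [h2]
    exact h1
  dirichlet _ := rfl

section

variable (g κ : ℝ) (Φ : ℝ × ℝ → ℝ) (η : ℝ → ℝ)

/-- The trace of `Φ` on the free surface `y = ε η(x)`, as a function of `(ε, x)`. -/
def traceFamily (a : ℝ × ℝ) : ℝ := Φ (a.2, a.1 * η a.2)

/-- `G(ε η)` applied to `traceFamily Φ η (ε, ·)`, as a function of `(ε, x)`. -/
noncomputable def normalVelocityFamily (a : ℝ × ℝ) : ℝ :=
  fderiv ℝ Φ (a.2, a.1 * η a.2) (0, 1) -
    a.1 * deriv η a.2 * fderiv ℝ Φ (a.2, a.1 * η a.2) (1, 0)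

/-- The right hand side of the equation for `ψ` at the state `(ε η, ε ψ)`, `ψ` the trace of `Φ`,
divided by `ε`, as a function of `(ε, x)`. -/
noncomputable def accelerationFamily (a : ℝ × ℝ) : ℝ :=
  -g * η a.2 + a.1 * (-(1 / 2) * fderiv ℝ (traceFamily Φ η) a (0, 1) ^ 2
    + (1 / 2) * (a.1 * deriv η a.2 * fderiv ℝ (traceFamily Φ η) a (0, 1)
      + normalVelocityFamily Φ η a) ^ 2 / (1 + (a.1 * deriv η a.2) ^ 2))
    + κ * (deriv (deriv η) a.2 / Real.sqrt (1 + (a.1 * deriv η a.2) ^ 2) ^ 3)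

variable {Φ η} (hΦ : ContDiff ℝ ∞ Φ) (hη : ContDiff ℝ ∞ η)

include hΦ hη

lemma contDiff_traceFamily : ContDiff ℝ ∞ (traceFamily Φ η) :=
  hΦ.comp (contDiff_snd.prodMk (contDiff_fst.mul (hη.comp contDiff_snd)))

lemma contDiff_normalVelocityFamily : ContDiff ℝ ∞ (normalVelocityFamily Φ η) := by
  have hp : ContDiff ℝ ∞ fun a : ℝ × ℝ => (a.2, a.1 * η a.2) :=
    contDiff_snd.prodMk (contDiff_fst.mul (hη.comp contDiff_snd))
  have hη' : ContDiff ℝ ∞ (deriv η) := (contDiff_infty_iff_deriv.1 hη).2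
  exact ((contDiff_fderiv_apply hΦ (0, 1)).comp hp).sub
    ((contDiff_fst.mul (hη'.comp contDiff_snd)).mul ((contDiff_fderiv_apply hΦ (1, 0)).comp hp))

lemma contDiff_accelerationFamily : ContDiff ℝ ∞ (accelerationFamily g κ Φ η) := by
  have hη' : ContDiff ℝ ∞ (deriv η) := (contDiff_infty_iff_deriv.1 hη).2
  have hη'' : ContDiff ℝ ∞ (deriv (deriv η)) := (contDiff_infty_iff_deriv.1 hη').2
  have h0 : ContDiff ℝ ∞ fun a : ℝ × ℝ => η a.2 := hη.comp contDiff_snd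
  have h1 : ContDiff ℝ ∞ fun a : ℝ × ℝ => a.1 * deriv η a.2 :=
    contDiff_fst.mul (hη'.comp contDiff_snd)
  have h2 : ContDiff ℝ ∞ fun a : ℝ × ℝ => deriv (deriv η) a.2 := hη''.comp contDiff_snd
  have h3 := contDiff_fderiv_apply (contDiff_traceFamily hΦ hη) (0, 1)
  have h4 := contDiff_normalVelocityFamily hΦ hη
  have h5 : ContDiff ℝ ∞ fun a : ℝ × ℝ => 1 + (a.1 * deriv η a.2) ^ 2 :=
    contDiff_const.add (h1.pow 2)
  have h6 : ∀ a : ℝ × ℝ, 1 + (a.1 * deriv η a.2) ^ 2 ≠ 0 := fun a => by positivity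
  have h7 : ∀ a : ℝ × ℝ, Real.sqrt (1 + (a.1 * deriv η a.2) ^ 2) ^ 3 ≠ 0 := fun a => by
    have : 0 < 1 + (a.1 * deriv η a.2) ^ 2 := by positivity
    positivity
  exact ((contDiff_const.mul h0).add (contDiff_fst.mul ((contDiff_const.mul (h3.pow 2)).add
    ((contDiff_const.mul (((h1.mul h3).add h4).pow 2)).div h5 h6)))).add
    (contDiff_const.mul (h2.div ((h5.sqrt h6).pow 3) h7))

lemma hasDerivAt_trace_snd (ε x : ℝ) : HasDerivAt (fun x => traceFamily Φ η (ε, x))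
    (fderiv ℝ (traceFamily Φ η) (ε, x) (0, 1)) x :=
  hasDerivAt_snd_of_contDiff (contDiff_traceFamily hΦ hη) ε x

lemma fderiv_traceFamily_zero (x : ℝ) :
    fderiv ℝ (traceFamily Φ η) (0, x) (0, 1) = fderiv ℝ Φ (x, 0) (1, 0) := by
  have h1 := hasDerivAt_trace_snd hΦ hη 0 x
  simp only [traceFamily, zero_mul] at h1
  exact h1.unique (hasDerivAt_fst_of_contDiff hΦ x 0)

omit hη in
lemma hasDerivAt_traceFamily (x : ℝ) : HasDerivAt (fun ε => traceFamily Φ η (ε, x))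
    (η x * fderiv ℝ Φ (x, 0) (0, 1)) 0 := by
  have h1 : HasDerivAt (fun ε : ℝ => ε * η x) (η x) 0 := by
    simpa using (hasDerivAt_id (0 : ℝ)).mul_const (η x)
  have h2 : HasDerivAt (fun y => Φ (x, y)) (fderiv ℝ Φ (x, 0) (0, 1)) (0 * η x) := by
    simpa using hasDerivAt_snd_of_contDiff hΦ x 0
  have h3 := h2.comp (0 : ℝ) h1
  rwa [mul_comm] at h3

omit hη in
lemma hasDerivAt_normalVelocityFamily (x : ℝ) {Φyy : ℝ}
    (hyy : HasDerivAt (fun y => fderiv ℝ Φ (x, y) (0, 1)) Φyy 0) :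
    HasDerivAt (fun ε => normalVelocityFamily Φ η (ε, x))
      (η x * Φyy - deriv η x * fderiv ℝ Φ (x, 0) (1, 0)) 0 := by
  have h1 : HasDerivAt (fun ε : ℝ => ε * η x) (η x) 0 := by
    simpa using (hasDerivAt_id (0 : ℝ)).mul_const (η x)
  have h2 : HasDerivAt (fun y => fderiv ℝ Φ (x, y) (0, 1)) Φyy (0 * η x) := by
    simpa using hyy
  have h3 := h2.comp (0 : ℝ) h1
  have h4 : HasDerivAt (fun ε : ℝ => ε * deriv η x) (deriv η x) 0 := by
    simpa using (hasDerivAt_id (0 : ℝ)).mul_const (deriv η x)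
  have h5 : HasDerivAt (fun y => fderiv ℝ Φ (x, y) (1, 0))
      (fderiv ℝ (fun p => fderiv ℝ Φ p (1, 0)) (x, 0) (0, 1)) (0 * η x) := by
    simpa using hasDerivAt_snd_of_contDiff (contDiff_fderiv_apply hΦ (1, 0)) x 0
  have h6 := h3.sub (h4.mul (h5.comp (0 : ℝ) h1))
  refine HasDerivAt.congr_deriv h6 ?_
  simp only [Function.comp_apply, zero_mul]
  ring

/-- The gravity and capillary terms do not contribute to the quadratic part. -/
lemma hasDerivAt_accelerationFamily (x : ℝ) :
    HasDerivAt (fun ε => accelerationFamily g κ Φ η (ε, x))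
      (-(1 / 2) * fderiv ℝ Φ (x, 0) (1, 0) ^ 2 + (1 / 2) * fderiv ℝ Φ (x, 0) (0, 1) ^ 2) 0 := by
  have hη' : ContDiff ℝ ∞ (deriv η) := (contDiff_infty_iff_deriv.1 hη).2
  have h1 : ContDiff ℝ ∞ fun a : ℝ × ℝ => a.1 * deriv η a.2 :=
    contDiff_fst.mul (hη'.comp contDiff_snd)
  have h3 := contDiff_fderiv_apply (contDiff_traceFamily hΦ hη) (0, 1)
  have h4 := contDiff_normalVelocityFamily hΦ hη
  have h5 : ContDiff ℝ ∞ fun a : ℝ × ℝ => 1 + (a.1 * deriv η a.2) ^ 2 :=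
    contDiff_const.add (h1.pow 2)
  have h6 : ∀ a : ℝ × ℝ, 1 + (a.1 * deriv η a.2) ^ 2 ≠ 0 := fun a => by positivity
  have h7 : ContDiff ℝ ∞ fun a : ℝ × ℝ => -(1 / 2) * fderiv ℝ (traceFamily Φ η) a (0, 1) ^ 2
      + (1 / 2) * (a.1 * deriv η a.2 * fderiv ℝ (traceFamily Φ η) a (0, 1)
      + normalVelocityFamily Φ η a) ^ 2 / (1 + (a.1 * deriv η a.2) ^ 2) :=
    (contDiff_const.mul (h3.pow 2)).add
      ((contDiff_const.mul (((h1.mul h3).add h4).pow 2)).div h5 h6)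
  have h8 := (hasDerivAt_id (0 : ℝ)).mul (hasDerivAt_fst_of_contDiff h7 0 x)
  -- the capillary term is even in `ε`
  have h9 : HasDerivAt (fun ε : ℝ => 1 + (ε * deriv η x) ^ 2) 0 0 := by
    have := (((hasDerivAt_id (0 : ℝ)).mul_const (deriv η x)).pow 2).const_add 1
    simpa using this
  have h10 := (h9.sqrt (by simp)).pow 3
  have h11 := (hasDerivAt_const (0 : ℝ) (deriv (deriv η) x)).div h10 (by simp)
  have h12 := ((hasDerivAt_const (0 : ℝ) (-g * η x)).add h8).add (h11.const_mul κ)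
  refine HasDerivAt.congr_deriv h12 ?_
  simp [fderiv_traceFamily_zero hΦ hη, normalVelocityFamily]

end

lemma isWaterWavesVelocity_family (g κ : ℝ) {h : ℝ≥0∞} {Φ : ℝ × ℝ → ℝ}
    (hΦ : IsEntirePotential h Φ) {η : ℝ → ℝ} (hη : ContDiff ℝ ∞ η)
    (hper : ∀ x, η (x + 2 * Real.pi) = η x) (havg : ∫ x in (0 : ℝ)..(2 * Real.pi), η x = 0)
    {ε : ℝ} (hε : h ≠ ⊤ → ∀ x, -h.toReal < ε * η x) :
    IsWaterWavesVelocity g κ h (fun x => ε * η x) (fun x => ε * traceFamily Φ η (ε, x))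
      (fun x => ε * normalVelocityFamily Φ η (ε, x))
      (fun x => ε * accelerationFamily g κ Φ η (ε, x)) := by
  have hη' : ContDiff ℝ ∞ (deriv η) := (contDiff_infty_iff_deriv.1 hη).2
  have hdη : ∀ x, HasDerivAt η (deriv η x) x := fun x =>
    (hη.differentiable (by simp) x).hasDerivAt
  have hdη' : ∀ x, HasDerivAt (deriv η) (deriv (deriv η) x) x := fun x =>
    (hη'.differentiable (by simp) x).hasDerivAt
  have hd : deriv (fun x => ε * η x) = fun x => ε * deriv η x :=
    funext fun x => ((hdη x).const_mul ε).deriv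
  have hdψ : deriv (fun x => ε * traceFamily Φ η (ε, x)) =
      fun x => ε * fderiv ℝ (traceFamily Φ η) (ε, x) (0, 1) :=
    funext fun x => ((hasDerivAt_trace_snd hΦ.smooth hη ε x).const_mul ε).deriv
  have hpair : ContDiff ℝ ∞ fun x : ℝ => (ε, x) := contDiff_const.prodMk contDiff_id
  refine ⟨contDiff_const.mul hη,
    contDiff_const.mul ((contDiff_traceFamily hΦ.smooth hη).comp hpair),
    fun x => by rw [hper], fun x => by simp only [traceFamily]; rw [hper, hΦ.periodic],
    by rw [intervalIntegral.integral_const_mul, havg, mul_zero], hε,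
    ⟨fun x y => ε * Φ (x, y), hΦ.isPotential _ ε, fun x => ?_⟩, fun x => ?_⟩
  · rw [hd, deriv_const_mul_field, deriv_const_mul_field,
      (hasDerivAt_snd_of_contDiff hΦ.smooth x (ε * η x)).deriv,
      (hasDerivAt_fst_of_contDiff hΦ.smooth x (ε * η x)).deriv]
    simp only [normalVelocityFamily]
    ring
  · have hpos : ∀ x, 0 < 1 + (ε * deriv η x) ^ 2 := fun x => by positivity
    have hu := (hdη' x).const_mul ε
    have hs := ((hu.pow 2).const_add 1).sqrt (hpos x).ne'
    have hq := (hu.div hs (Real.sqrt_pos.2 (hpos x)).ne').deriv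
    have hcap : deriv (fun x' => ε * deriv η x' / Real.sqrt (1 + (ε * deriv η x') ^ 2)) x =
        ε * (deriv (deriv η) x / Real.sqrt (1 + (ε * deriv η x) ^ 2) ^ 3) := by
      refine hq.trans ?_
      have h1 : Real.sqrt (1 + (ε * deriv η x) ^ 2) ≠ 0 := (Real.sqrt_pos.2 (hpos x)).ne'
      have h2 : Real.sqrt (1 + (ε * deriv η x) ^ 2) ^ 2 = 1 + (ε * deriv η x) ^ 2 :=
        Real.sq_sqrt (hpos x).le
      simp only [Pi.pow_apply]
      set S := Real.sqrt (1 + (ε * deriv η x) ^ 2)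
      field_simp
      rw [h2]
      ring
    rw [hdψ, hd]
    simp only
    rw [hcap, accelerationFamily]
    ring

/-! ### Resonant quadratic vector fields -/

lemma bilinTerm_resonantPart (g κ : ℝ) (h : ℝ≥0∞) (r : OpCoef) (ε σ σ' : ℤˣ) (u z : ℤ → ℂ)
    (j : ℤ) (p : ℤ × ℤ) [Decidable (((σ : ℤ) : ℝ) * Ω g κ h j - ((σ' : ℤ) : ℝ) * Ω g κ h p.2
      - ((ε : ℤ) : ℝ) * Ω g κ h p.1 = 0)] :
    bilinTerm (resonantPart g κ h r) ε σ σ' u z j p =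
      if ((σ : ℤ) : ℝ) * Ω g κ h j - ((σ' : ℤ) : ℝ) * Ω g κ h p.2
        - ((ε : ℤ) : ℝ) * Ω g κ h p.1 = 0 then bilinTerm r ε σ σ' u z j p else 0 := by
  unfold bilinTerm resonantPart
  by_cases hp : p.1 ≠ 0 ∧ p.2 ≠ 0 ∧ (ε : ℤ) * p.1 + (σ' : ℤ) * p.2 = (σ : ℤ) * j
  · have hσ : (σ : ℤ) * ((ε : ℤ) * p.1 + (σ' : ℤ) * p.2) = j := by
      rw [hp.2.2, ← mul_assoc, ← Units.val_mul, Int.units_mul_self, Units.val_one, one_mul]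
    rw [if_pos hp, if_pos hp, hσ]
    split_ifs <;> simp
  · rw [if_neg hp, if_neg hp, ite_self]

section

variable {g κ : ℝ} (hg : 0 ≤ g) (hκ : 0 < κ) {h : ℝ≥0∞} (hh : 0 < h)

include hg hκ hh

/-- A finite set of nonzero integers contains all the modes of the three waves resonances. -/
lemma exists_resonant_modes : ∃ S : Finset ℤ, 0 ∉ S ∧ ∀ (σ₀ σ₁ σ₂ : ℤˣ) (a b c : ℤ),
    a ≠ 0 → b ≠ 0 → c ≠ 0 → (σ₀ : ℤ) * a + (σ₁ : ℤ) * b + (σ₂ : ℤ) * c = 0 →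
    ((σ₀ : ℤ) : ℝ) * Ω g κ h a + ((σ₁ : ℤ) : ℝ) * Ω g κ h b + ((σ₂ : ℤ) : ℝ) * Ω g κ h c = 0 →
    a ∈ S ∧ b ∈ S ∧ c ∈ S := by
  obtain ⟨A, hA⟩ := exists_resonance_bound hg hκ hh
  refine ⟨(Finset.Icc (-A) A).erase 0, by simp, fun σ₀ σ₁ σ₂ a b c ha hb hc h1 h2 => ?_⟩
  obtain ⟨h3, h4, h5⟩ := hA σ₀ σ₁ σ₂ a b c ha hb hc h1 h2
  simp only [Finset.mem_erase, Finset.mem_Icc]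
  exact ⟨⟨ha, abs_le.1 h3⟩, ⟨hb, abs_le.1 h4⟩, ⟨hc, abs_le.1 h5⟩⟩

end

section

variable {g κ : ℝ} {h : ℝ≥0∞} {S : Finset ℤ}
  (hS : ∀ (σ₀ σ₁ σ₂ : ℤˣ) (a b c : ℤ),
    a ≠ 0 → b ≠ 0 → c ≠ 0 → (σ₀ : ℤ) * a + (σ₁ : ℤ) * b + (σ₂ : ℤ) * c = 0 →
    ((σ₀ : ℤ) : ℝ) * Ω g κ h a + ((σ₁ : ℤ) : ℝ) * Ω g κ h b + ((σ₂ : ℤ) : ℝ) * Ω g κ h c = 0 →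
    a ∈ S ∧ b ∈ S ∧ c ∈ S)

include hS

lemma quadField_resonantPart_eq_sum (r : OpCoef) (y : ℤ → ℂ) (σ : ℤˣ) {j : ℤ} (hj : j ≠ 0) :
    quadField (resonantPart g κ h r) y σ j =
      ∑ σ' : ℤˣ, ∑ ε : ℤˣ, ((1 / Real.sqrt (2 * Real.pi) : ℝ) : ℂ) *
        ∑ p ∈ S ×ˢ S, bilinTerm (resonantPart g κ h r) ε σ σ' y y j p := by
  classical
  rw [quadField_eq_bilin, bilin]
  refine Finset.sum_congr rfl fun σ' _ => Finset.sum_congr rfl fun ε _ => ?_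
  congr 1
  refine tsum_eq_sum fun p hp => ?_
  rw [bilinTerm_resonantPart]
  split_ifs with h1
  swap
  · rfl
  unfold bilinTerm
  refine if_neg fun h2 => hp ?_
  obtain ⟨h3, h4, -⟩ := hS σ' ε (-σ) p.2 p.1 j h2.2.1 h2.1 hj
    (by rw [Units.val_neg]; linarith [h2.2.2]) (by push_cast; linarith)
  exact Finset.mk_mem_product h4 h3

/-- Only finitely many modes enter, so no summability is needed. -/
lemma continuous_quadField_resonantPart (r : OpCoef) (σ : ℤˣ) {j : ℤ} (hj : j ≠ 0) :
    Continuous fun y : ℤ → ℂ => quadField (resonantPart g κ h r) y σ j := by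
  simp only [quadField_resonantPart_eq_sum hS r _ σ hj]
  refine continuous_finsetSum _ fun σ' _ => continuous_finsetSum _ fun ε _ =>
    continuous_const.mul (continuous_finsetSum _ fun p _ => ?_)
  unfold bilinTerm
  split_ifs
  · exact (continuous_const.mul ((continuous_sgn ε).comp (continuous_apply _))).mul
      ((continuous_sgn σ').comp (continuous_apply _))
  · exact continuous_const

end

/-- The value `y 0` is irrelevant. -/
lemma quadField_congr (r : OpCoef) {y z : ℤ → ℂ} (hyz : ∀ n, n ≠ 0 → y n = z n) (σ : ℤˣ) (j : ℤ) :
    quadField r y σ j = quadField r z σ j := by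
  rw [quadField_eq_bilin, quadField_eq_bilin, bilin, bilin]
  refine Finset.sum_congr rfl fun σ' _ => Finset.sum_congr rfl fun ε _ => ?_
  congr 1
  refine tsum_congr fun p => ?_
  unfold bilinTerm
  split_ifs with hp
  · rw [hyz _ hp.1, hyz _ hp.2.1]
  · rfl

/-! ### The complex variable along smooth families -/

lemma complexVar_const_mul (g κ : ℝ) (h : ℝ≥0∞) (ε : ℝ) (η ψ : ℝ → ℝ) :
    complexVar g κ h (fun x => ε * η x) (fun x => ε * ψ x) =
      fun n => (ε : ℂ) * complexVar g κ h η ψ n := by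
  ext n
  unfold complexVar
  rw [fourierCoef_const_mul, fourierCoef_const_mul]
  ring

lemma exists_decayBound_complexVar {g κ : ℝ} (hg : 0 ≤ g) (hκ : 0 < κ) {h : ℝ≥0∞} (hh : 0 < h)
    {F F' : ℝ × ℝ → ℝ} (hF : ContDiff ℝ ∞ F) (hF' : ContDiff ℝ ∞ F')
    (hper : ∀ ε x, F (ε, x + 2 * Real.pi) = F (ε, x))
    (hper' : ∀ ε x, F' (ε, x + 2 * Real.pi) = F' (ε, x)) (N : ℕ) :
    ∃ A : ℝ, ∀ ε ∈ Set.Icc (-1 : ℝ) 1,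
      DecayBound N A (complexVar g κ h (fun x => F (ε, x)) (fun x => F' (ε, x))) := by
  obtain ⟨A, hA⟩ := exists_decayBound_fourierCoef (N + 1) hF hper
  obtain ⟨A', hA'⟩ := exists_decayBound_fourierCoef N hF' hper'
  obtain ⟨K, hK, hΛ⟩ := exists_Λ_le hg hκ hh
  refine ⟨K * A' + K * A, fun ε hε n hn => ?_⟩
  have h1 := hA ε hε n hn
  have h2 := hA' ε hε n hn
  obtain ⟨h3, h4⟩ := hΛ n hn
  have hΛ0 := Λ_pos hg hκ hh hn
  have hsq : ‖((1 / Real.sqrt 2 : ℝ) : ℂ)‖ ≤ 1 := by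
    rw [Complex.norm_real, Real.norm_of_nonneg (by positivity), div_le_one (by positivity)]
    exact Real.one_le_sqrt.2 one_le_two
  set a := fourierCoef (fun x => F (ε, x)) n
  set a' := fourierCoef (fun x => F' (ε, x)) n
  unfold complexVar
  rw [norm_mul]
  calc |(n : ℝ)| ^ N * (‖((1 / Real.sqrt 2 : ℝ) : ℂ)‖ *
        ‖(Λ g κ h n : ℂ) * a' + Complex.I * ((Λ g κ h n)⁻¹ : ℝ) * a‖)
      ≤ |(n : ℝ)| ^ N * (1 * (Λ g κ h n * ‖a'‖ + (Λ g κ h n)⁻¹ * ‖a‖)) := by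
        gcongr
        refine (norm_add_le _ _).trans (le_of_eq ?_)
        rw [norm_mul, norm_mul, norm_mul, Complex.norm_I, Complex.norm_real, Complex.norm_real,
          Real.norm_of_nonneg hΛ0.le, Real.norm_of_nonneg (inv_nonneg.2 hΛ0.le), one_mul]
    _ ≤ |(n : ℝ)| ^ N * (1 * (K * ‖a'‖ + (K * |(n : ℝ)|) * ‖a‖)) := by gcongr
    _ = K * (|(n : ℝ)| ^ N * ‖a'‖) + K * (|(n : ℝ)| ^ (N + 1) * ‖a‖) := by ring
    _ ≤ K * A' + K * A := by gcongr

lemma hasDerivAt_complexVar (g κ : ℝ) (h : ℝ≥0∞) {F F' : ℝ × ℝ → ℝ} (hF : ContDiff ℝ ∞ F)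
    (hF' : ContDiff ℝ ∞ F') {F₁ F₁' : ℝ → ℝ}
    (hd : ∀ x, HasDerivAt (fun ε => F (ε, x)) (F₁ x) 0)
    (hd' : ∀ x, HasDerivAt (fun ε => F' (ε, x)) (F₁' x) 0) (n : ℤ) :
    HasDerivAt (fun ε : ℝ => complexVar g κ h (fun x => F (ε, x)) (fun x => F' (ε, x)) n)
      (complexVar g κ h F₁ F₁' n) 0 :=
  (((hasDerivAt_fourierCoef hF' hd' n).const_mul _).add
    ((hasDerivAt_fourierCoef hF hd n).const_mul _)).const_mul _

section

variable {g κ : ℝ} {Φ : ℝ × ℝ → ℝ} {η : ℝ → ℝ}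
  (hperΦ : ∀ x y, Φ (x + 2 * Real.pi, y) = Φ (x, y)) (hper : ∀ x, η (x + 2 * Real.pi) = η x)

include hperΦ hper

lemma traceFamily_periodic (ε x : ℝ) :
    traceFamily Φ η (ε, x + 2 * Real.pi) = traceFamily Φ η (ε, x) := by
  simp only [traceFamily]
  rw [hper, hperΦ]

lemma normalVelocityFamily_periodic (ε x : ℝ) :
    normalVelocityFamily Φ η (ε, x + 2 * Real.pi) = normalVelocityFamily Φ η (ε, x) := by
  have h1 : ∀ y, fderiv ℝ Φ (x + 2 * Real.pi, y) = fderiv ℝ Φ (x, y) := by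
    intro y
    have := fderiv_comp_add_right (𝕜 := ℝ) (f := Φ) (x := (x, y)) (2 * Real.pi, (0 : ℝ))
    rw [show (fun p : ℝ × ℝ => Φ (p + (2 * Real.pi, (0 : ℝ)))) = Φ from
      funext fun p => by
        rw [show p + (2 * Real.pi, (0 : ℝ)) = (p.1 + 2 * Real.pi, p.2) by ext <;> simp, hperΦ]] at this
    simpa using this.symm
  have h2 : deriv η (x + 2 * Real.pi) = deriv η x := by
    rw [← deriv_comp_add_const, show (fun x => η (x + 2 * Real.pi)) = η from funext hper]
  simp only [normalVelocityFamily]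
  rw [h2, hper, h1]

lemma accelerationFamily_periodic (ε x : ℝ) :
    accelerationFamily g κ Φ η (ε, x + 2 * Real.pi) = accelerationFamily g κ Φ η (ε, x) := by
  have h1 : fderiv ℝ (traceFamily Φ η) (ε, x + 2 * Real.pi) =
      fderiv ℝ (traceFamily Φ η) (ε, x) := by
    have := fderiv_comp_add_right (𝕜 := ℝ) (f := traceFamily Φ η) (x := (ε, x))
      ((0 : ℝ), 2 * Real.pi)
    rw [show (fun p : ℝ × ℝ => traceFamily Φ η (p + ((0 : ℝ), 2 * Real.pi))) = traceFamily Φ η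
      from funext fun p => by
        rw [show p + ((0 : ℝ), 2 * Real.pi) = (p.1, p.2 + 2 * Real.pi) by ext <;> simp,
          traceFamily_periodic hperΦ hper]] at this
    simpa using this.symm
  have h2 : ∀ x, deriv η (x + 2 * Real.pi) = deriv η x := fun x => by
    rw [← deriv_comp_add_const, show (fun x => η (x + 2 * Real.pi)) = η from funext hper]
  have h3 : deriv (deriv η) (x + 2 * Real.pi) = deriv (deriv η) x := by
    rw [← deriv_comp_add_const, show (fun x => deriv η (x + 2 * Real.pi)) = deriv η from funext h2]
  simp only [accelerationFamily]
  rw [h1, h2, h3, hper, normalVelocityFamily_periodic hperΦ hper]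

end

/-! ### The quadratic terms of the conjugated equation -/

lemma sobolevNorm_cube_le {s s' B : ℝ} {C : ℝ≥0} (hB : 0 ≤ B) {u w : ℤ → ℂ}
    (hu : sobolevNorm s' u ≤ C * sobolevNorm s w ^ 3) (hw : sobolevNorm s w ≤ ENNReal.ofReal B)
    {j : ℤ} (hj : j ≠ 0) : ‖u j‖ ≤ |(j : ℝ)| ^ (-s') * (C * B ^ 3) := by
  refine norm_le_of_sobolevNorm_le (by positivity) (hu.trans ?_) hj
  rw [ENNReal.ofReal_mul C.coe_nonneg, ENNReal.ofReal_pow hB, ENNReal.ofReal_coe_nnreal]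
  gcongr

/-- The quadratic part of the conjugated equation, read on the states with free surface `ε η` and
velocity potential `ε Φ`, in the limit `ε → 0`.  The complex variable of such a state is
`ε W(ε)` and its velocity is `ε V(ε)`; the derivative `D` of `V - i Ω(D) W` at `ε = 0` is the
quadratic part of the water waves vector field. -/
lemma quadratic_part_of_conjugation {g κ : ℝ} (hg : 0 ≤ g) (hκ : 0 < κ) {h : ℝ≥0∞} (hh : 0 < h)
    {s m : ℝ} (hm : 0 ≤ m) {M₁ : OpCoef} (hM₁ : IsHomogeneousMap m M₁)
    {N : (ℤ → ℂ) → ℤ → ℂ} {R₁ : OpCoef}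
    (hconj : ConjugatesTo g κ h s m M₁ N (resonantPart g κ h R₁))
    {Φ : ℝ × ℝ → ℝ} (hΦ : IsEntirePotential h Φ) {η : ℝ → ℝ} (hη : ContDiff ℝ ∞ η)
    (hper : ∀ x, η (x + 2 * Real.pi) = η x) (havg : ∫ x in (0 : ℝ)..(2 * Real.pi), η x = 0)
    {W₀ V₀ : ℤ → ℂ}
    (hW₀ : ∀ n, n ≠ 0 → complexVar g κ h η (fun x => traceFamily Φ η (0, x)) n = W₀ n)
    (hV₀ : ∀ n, n ≠ 0 → complexVar g κ h (fun x => normalVelocityFamily Φ η (0, x))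
      (fun x => accelerationFamily g κ Φ η (0, x)) n = V₀ n)
    {j : ℤ} (hj : j ≠ 0) (hlin : V₀ j = Complex.I * (Ω g κ h j : ℂ) * W₀ j) {D : ℂ}
    (hD : HasDerivAt (fun ε : ℝ => complexVar g κ h (fun x => normalVelocityFamily Φ η (ε, x))
        (fun x => accelerationFamily g κ Φ η (ε, x)) j - Complex.I * (Ω g κ h j : ℂ) *
        complexVar g κ h η (fun x => traceFamily Φ η (ε, x)) j) D 0) :
    D + bilin M₁ W₀ V₀ 1 j + bilin M₁ V₀ W₀ 1 j - Complex.I * (Ω g κ h j : ℂ) * bilin M₁ W₀ W₀ 1 j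
      = quadField (resonantPart g κ h R₁) W₀ 1 j := by
  classical
  set W : ℝ → ℤ → ℂ := fun ε => complexVar g κ h η (fun x => traceFamily Φ η (ε, x)) with hWdef
  set V : ℝ → ℤ → ℂ := fun ε => complexVar g κ h (fun x => normalVelocityFamily Φ η (ε, x))
        (fun x => accelerationFamily g κ Φ η (ε, x)) with hVdef
  set iΩ : ℂ := Complex.I * (Ω g κ h j : ℂ) with hiΩ
  have hT := contDiff_traceFamily hΦ.smooth hη
  have hNV := contDiff_normalVelocityFamily hΦ.smooth hη
  have hAc := contDiff_accelerationFamily g κ hΦ.smooth hη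
  have hη2 : ContDiff ℝ ∞ fun a : ℝ × ℝ => η a.2 := hη.comp contDiff_snd
  have hWdec : ∀ M, ∃ A, ∀ ε ∈ Set.Icc (-1 : ℝ) 1, DecayBound M A (W ε) := fun M =>
    exists_decayBound_complexVar hg hκ hh hη2 hT (fun ε x => hper x)
      (traceFamily_periodic hΦ.periodic hper) M
  have hVdec : ∀ M, ∃ A, ∀ ε ∈ Set.Icc (-1 : ℝ) 1, DecayBound M A (V ε) := fun M =>
    exists_decayBound_complexVar hg hκ hh hNV hAc (normalVelocityFamily_periodic hΦ.periodic hper)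
      (accelerationFamily_periodic hΦ.periodic hper) M
  have hWt : ∀ n, n ≠ 0 → Filter.Tendsto (fun ε => W ε n) (nhdsWithin 0 (Set.Ioi 0))
      (nhds (W₀ n)) := fun n hn => by
    rw [← hW₀ n hn]
    exact (hasDerivAt_complexVar g κ h hη2 hT (fun x => hasDerivAt_const 0 (η x))
      (fun x => hasDerivAt_fst_of_contDiff hT 0 x) n).continuousAt.tendsto.mono_left
      nhdsWithin_le_nhds
  have hVt : ∀ n, n ≠ 0 → Filter.Tendsto (fun ε => V ε n) (nhdsWithin 0 (Set.Ioi 0))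
      (nhds (V₀ n)) := fun n hn => by
    rw [← hV₀ n hn]
    exact (hasDerivAt_complexVar g κ h hNV hAc (fun x => hasDerivAt_fst_of_contDiff hNV 0 x)
      (fun x => hasDerivAt_fst_of_contDiff hAc 0 x) n).continuousAt.tendsto.mono_left
      nhdsWithin_le_nhds
  have hIoc : ∀ᶠ ε : ℝ in nhdsWithin 0 (Set.Ioi 0), ε ∈ Set.Ioc (0 : ℝ) 1 :=
    Ioc_mem_nhdsGT one_pos
  have hWdec' : ∀ M, ∃ A, ∀ᶠ ε in nhdsWithin 0 (Set.Ioi 0), DecayBound M A (W ε) := fun M => by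
    obtain ⟨A, hA⟩ := hWdec M
    exact ⟨A, hIoc.mono fun ε hε => hA ε ⟨by linarith [hε.1], hε.2⟩⟩
  have hVdec' : ∀ M, ∃ A, ∀ᶠ ε in nhdsWithin 0 (Set.Ioi 0), DecayBound M A (V ε) := fun M => by
    obtain ⟨A, hA⟩ := hVdec M
    exact ⟨A, hIoc.mono fun ε hε => hA ε ⟨by linarith [hε.1], hε.2⟩⟩
  obtain ⟨r, C, hr, hcj⟩ := hconj
  -- the states have size `O(ε)` in the Sobolev norm
  obtain ⟨M, K, hK, hsob⟩ := exists_sobolevNorm_le s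
  obtain ⟨A, hA⟩ := hWdec M
  have hA0 : 0 ≤ A := (hA 0 (by simp)).nonneg
  set B := K * A with hB
  have hB0 : 0 ≤ B := mul_nonneg hK hA0
  have hsobW : ∀ ε ∈ Set.Ioc (0 : ℝ) 1,
      sobolevNorm s (fun n => (ε : ℂ) * W ε n) ≤ ENNReal.ofReal (B * ε) := by
    intro ε hε
    refine (hsob _ _ ((hA ε ⟨by linarith [hε.1], hε.2⟩).real_mul ε)).trans (le_of_eq ?_)
    rw [abs_of_pos hε.1, hB]
    congr 1
    ring
  have hsmall : ∀ᶠ ε : ℝ in nhdsWithin 0 (Set.Ioi 0), ENNReal.ofReal (B * ε) < r := by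
    have h1 : Filter.Tendsto (fun ε : ℝ => ENNReal.ofReal (B * ε)) (nhdsWithin 0 (Set.Ioi 0))
        (nhds (ENNReal.ofReal (B * 0))) :=
      (ENNReal.continuous_ofReal.comp (continuous_const.mul continuous_id)).tendsto 0
        |>.mono_left nhdsWithin_le_nhds
    rw [mul_zero, ENNReal.ofReal_zero] at h1
    exact h1.eventually (gt_mem_nhds hr)
  have hbot : ∀ᶠ ε : ℝ in nhdsWithin 0 (Set.Ioi 0), h ≠ ⊤ → ∀ x, -h.toReal < ε * η x := by
    by_cases ht : h = ⊤
    · exact Filter.Eventually.of_forall fun ε h' => absurd ht h'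
    obtain ⟨H, hH⟩ := (isCompact_Icc (a := (0 : ℝ)) (b := 2 * Real.pi)).exists_bound_of_continuousOn
      hη.continuous.continuousOn
    have hH' : ∀ x, |η x| ≤ H := by
      intro x
      obtain ⟨y, hy, hxy⟩ := Function.Periodic.exists_mem_Ico₀ (f := η) (c := 2 * Real.pi) hper
        (by positivity) x
      rw [hxy]
      exact hH y ⟨hy.1, hy.2.le⟩
    have hh' : 0 < h.toReal := ENNReal.toReal_pos hh.ne' ht
    have h1 : Filter.Tendsto (fun ε : ℝ => H * ε) (nhdsWithin 0 (Set.Ioi 0)) (nhds (H * 0)) :=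
      (continuous_const.mul continuous_id).tendsto 0 |>.mono_left nhdsWithin_le_nhds
    rw [mul_zero] at h1
    filter_upwards [hIoc, h1.eventually (gt_mem_nhds hh')] with ε hε hε' _ x
    have h2 := (abs_le.1 (hH' x)).1
    nlinarith [hε.1]
  -- the conjugated equation divided by `ε²`: here `changeVar M₁ N (ε W) = ε Q`
  set Q : ℝ → ℤ → ℂ := fun ε k => W ε k + ε * bilin M₁ (W ε) (W ε) 1 k +
    (ε : ℂ)⁻¹ * N (fun n => (ε : ℂ) * W ε n) k with hQ
  have hmain : ∀ᶠ ε : ℝ in nhdsWithin 0 (Set.Ioi 0),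
      (∀ k, k ≠ 0 → ‖N (fun n => (ε : ℂ) * W ε n) k‖ ≤
        |(k : ℝ)| ^ (-(s - m)) * (C * (B * ε) ^ 3)) ∧
      ‖((ε : ℂ)⁻¹ * (V ε j - iΩ * W ε j) + bilin M₁ (W ε) (V ε) 1 j + bilin M₁ (V ε) (W ε) 1 j
        - iΩ * bilin M₁ (W ε) (W ε) 1 j) - quadField (resonantPart g κ h R₁) (Q ε) 1 j‖ ≤
        (2 + ‖iΩ‖) * (|(j : ℝ)| ^ (-(s - m)) * (C * B ^ 3)) * ε := by
    filter_upwards [hIoc, hsmall, hbot] with ε hε hεr hεb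
    have hε0 : (ε : ℂ) ≠ 0 := by exact_mod_cast hε.1.ne'
    have hεI : ε ∈ Set.Icc (-1 : ℝ) 1 := ⟨by linarith [hε.1], hε.2⟩
    have hw := complexVar_const_mul g κ h ε η (fun x => traceFamily Φ η (ε, x))
    have hv := complexVar_const_mul g κ h ε (fun x => normalVelocityFamily Φ η (ε, x))
        (fun x => accelerationFamily g κ Φ η (ε, x))
    set w : ℤ → ℂ := fun n => (ε : ℂ) * W ε n with hwdef
    set v : ℤ → ℂ := fun n => (ε : ℂ) * V ε n with hvdef
    have hsw := hsobW ε hε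
    obtain ⟨hN, c, N', X, hc, hN1, hN2, hY, hX⟩ := hcj _ _ _ _ w v
      (isWaterWavesVelocity_family g κ hΦ hη hper havg hεb) hw.symm hv.symm (hsw.trans_lt hεr)
    have hBε : 0 ≤ B * ε := mul_nonneg hB0 hε.1.le
    have hNk : ∀ k, k ≠ 0 → ‖N w k‖ ≤ |(k : ℝ)| ^ (-(s - m)) * (C * (B * ε) ^ 3) :=
      fun k hk => sobolevNorm_cube_le hBε hN hsw hk
    have hN'j := sobolevNorm_cube_le hBε hN2 hsw hj
    have hXj := sobolevNorm_cube_le hBε hX hsw hj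
    refine ⟨hNk, ?_⟩
    have hwd : ∀ M, ∃ A, DecayBound M A w := fun M => by
      obtain ⟨A, hA⟩ := hWdec M
      exact ⟨_, (hA ε hεI).real_mul ε⟩
    have hvd : ∀ M, ∃ A, DecayBound M A v := fun M => by
      obtain ⟨A, hA⟩ := hVdec M
      exact ⟨_, (hA ε hεI).real_mul ε⟩
    have hcj1 : HasDerivAt (fun t => c t j) (v j) 0 := by
      rw [hasDerivAt_iff_isLittleO, Asymptotics.isLittleO_iff]
      intro a ha
      filter_upwards [hc.2.2 0 a ha] with t ht
      have := ht j hj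
      rw [pow_zero, one_mul] at this
      rwa [hc.1, sub_zero, Complex.real_smul, Real.norm_eq_abs]
    have heq := ((hcj1.add (hasDerivAt_quadField hm hM₁ hj hc hwd hvd 1)).add (hN1 j hj)).unique
      (hY j hj)
    have hbil1 : bilin M₁ w v 1 j = ε * (ε * bilin M₁ (W ε) (V ε) 1 j) := by
      rw [hwdef, hvdef, bilin_real_mul_left, bilin_real_mul_right]
    have hbil2 : bilin M₁ v w 1 j = ε * (ε * bilin M₁ (V ε) (W ε) 1 j) := by
      rw [hwdef, hvdef, bilin_real_mul_left, bilin_real_mul_right]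
    have hbil3 : ∀ k, bilin M₁ w w 1 k = ε * (ε * bilin M₁ (W ε) (W ε) 1 k) := fun k => by
      rw [hwdef, bilin_real_mul_left, bilin_real_mul_right]
    have hchange : changeVar M₁ N w = fun k => (ε : ℂ) * Q ε k := by
      ext k
      rw [changeVar, quadField_eq_bilin, hbil3, hQ]
      simp only [hwdef]
      field_simp
    have hquad : quadField (resonantPart g κ h R₁) (changeVar M₁ N w) 1 j =
        ε * (ε * quadField (resonantPart g κ h R₁) (Q ε) 1 j) := by
      rw [hchange, quadField_eq_bilin, bilin_real_mul_left, bilin_real_mul_right,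
        quadField_eq_bilin]
    rw [hquad, hbil1, hbil2, changeVar, quadField_eq_bilin, hbil3] at heq
    have hid : ((ε : ℂ)⁻¹ * (V ε j - iΩ * W ε j) + bilin M₁ (W ε) (V ε) 1 j +
        bilin M₁ (V ε) (W ε) 1 j - iΩ * bilin M₁ (W ε) (W ε) 1 j) -
        quadField (resonantPart g κ h R₁) (Q ε) 1 j =
        ((ε : ℂ) ^ 2)⁻¹ * (iΩ * N w j + X j - N' j) := by
      simp only [hwdef, hvdef] at heq ⊢
      field_simp
      linear_combination heq
    rw [hid, norm_mul, norm_inv, norm_pow, Complex.norm_real, Real.norm_of_nonneg hε.1.le,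
      inv_mul_le_iff₀ (by have := hε.1; positivity)]
    calc ‖iΩ * N w j + X j - N' j‖ ≤ ‖iΩ‖ * ‖N w j‖ + ‖X j‖ + ‖N' j‖ := by
          rw [← norm_mul]
          exact (norm_sub_le _ _).trans (by gcongr; exact norm_add_le _ _)
      _ ≤ ‖iΩ‖ * (|(j : ℝ)| ^ (-(s - m)) * (C * (B * ε) ^ 3)) +
          (|(j : ℝ)| ^ (-(s - m)) * (C * (B * ε) ^ 3)) +
          (|(j : ℝ)| ^ (-(s - m)) * (C * (B * ε) ^ 3)) := by
          have := hNk j hj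
          gcongr
      _ = _ := by ring
  -- in the limit, the resonant vector field is continuous for pointwise convergence, which is all
  -- that is known of `Q ε`; the value at `0` is replaced by `W₀ 0` since it is not controlled
  obtain ⟨S, -, hS⟩ := exists_resonant_modes hg hκ hh
  have hε0 : Filter.Tendsto (fun ε : ℝ => (ε : ℂ)) (nhdsWithin 0 (Set.Ioi 0)) (nhds 0) := by
    have := (Complex.continuous_ofReal.tendsto 0).mono_left
      (nhdsWithin_le_nhds (s := Set.Ioi (0 : ℝ)))
    simpa using this
  have hε0' : Filter.Tendsto (fun ε : ℝ => ε) (nhdsWithin 0 (Set.Ioi 0)) (nhds 0) :=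
    Filter.tendsto_id.mono_left nhdsWithin_le_nhds
  have hQt : Filter.Tendsto (fun ε => fun k => if k = 0 then W₀ 0 else Q ε k)
      (nhdsWithin 0 (Set.Ioi 0)) (nhds W₀) := by
    rw [tendsto_pi_nhds]
    intro k
    by_cases hk : k = 0
    · simp only [hk, if_true]
      exact tendsto_const_nhds
    simp only [if_neg hk]
    have h1 := hε0.mul (tendsto_bilin hm hM₁ hk 1 hWt hWt hWdec' hWdec')
    have h2 : Filter.Tendsto (fun ε : ℝ => (ε : ℂ)⁻¹ * N (fun n => (ε : ℂ) * W ε n) k)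
        (nhdsWithin 0 (Set.Ioi 0)) (nhds 0) := by
      have h3 : Filter.Tendsto (fun ε : ℝ => |(k : ℝ)| ^ (-(s - m)) * (C * B ^ 3) * ε ^ 2)
          (nhdsWithin 0 (Set.Ioi 0)) (nhds 0) := by
        simpa using (hε0'.pow 2).const_mul (|(k : ℝ)| ^ (-(s - m)) * (C * B ^ 3))
      refine squeeze_zero_norm' ?_ h3
      filter_upwards [hmain, hIoc] with ε hε hε1
      have hε1' := hε1.1
      rw [norm_mul, norm_inv, Complex.norm_real, Real.norm_of_nonneg hε1.1.le,
        inv_mul_le_iff₀ hε1.1]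
      refine (hε.1 k hk).trans (le_of_eq ?_)
      ring
    have h4 := ((hWt k hk).add h1).add h2
    simpa using h4
  have hR := ((continuous_quadField_resonantPart hS R₁ 1 hj).tendsto W₀).comp hQt
  have hR' : Filter.Tendsto (fun ε => quadField (resonantPart g κ h R₁) (Q ε) 1 j)
      (nhdsWithin 0 (Set.Ioi 0)) (nhds (quadField (resonantPart g κ h R₁) W₀ 1 j)) := by
    refine hR.congr fun ε => ?_
    exact quadField_congr _ (fun n hn => if_neg hn) 1 j
  have hslope : Filter.Tendsto (fun ε : ℝ => (ε : ℂ)⁻¹ * (V ε j - iΩ * W ε j))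
      (nhdsWithin 0 (Set.Ioi 0)) (nhds D) := by
    have h1 := (hasDerivAt_iff_tendsto_slope.1 hD).mono_left
      (nhdsWithin_mono 0 (fun x (hx : x ∈ Set.Ioi (0 : ℝ)) => ne_of_gt hx))
    refine h1.congr fun ε => ?_
    have h2 : V 0 j - iΩ * W 0 j = 0 := by
      have e1 : W 0 j = W₀ j := hW₀ j hj
      have e2 : V 0 j = V₀ j := hV₀ j hj
      rw [e1, e2, hlin, sub_self]
    rw [slope_def_module, sub_zero, Complex.real_smul]
    push_cast
    congr 1
    rw [sub_eq_self]
    exact h2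
  have hE := ((hslope.add (tendsto_bilin hm hM₁ hj 1 hWt hVt hWdec' hVdec')).add
    (tendsto_bilin hm hM₁ hj 1 hVt hWt hVdec' hWdec')).sub
    ((tendsto_bilin hm hM₁ hj 1 hWt hWt hWdec' hWdec').const_mul iΩ)
  have hdiff := squeeze_zero_norm' (hmain.mono fun ε hε => hε.2) (by
    simpa using hε0'.const_mul ((2 + ‖iΩ‖) * (|(j : ℝ)| ^ (-(s - m)) * (C * B ^ 3))))
  exact sub_eq_zero.1 (tendsto_nhds_unique (hE.sub hR') hdiff)

/-! ### Trigonometric polynomials -/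

/-- The real part of `z e^{i n x}`. -/
noncomputable def waveRe (z : ℂ) (n : ℤ) (x : ℝ) : ℝ :=
  z.re * Real.cos (n * x) - z.im * Real.sin (n * x)

/-- The imaginary part of `z e^{i n x}`. -/
noncomputable def waveIm (z : ℂ) (n : ℤ) (x : ℝ) : ℝ :=
  z.re * Real.sin (n * x) + z.im * Real.cos (n * x)

lemma hasDerivAt_waveRe (z : ℂ) (n : ℤ) (x : ℝ) :
    HasDerivAt (waveRe z n) (-(n * waveIm z n x)) x := by
  have h : HasDerivAt (fun x : ℝ => (n : ℝ) * x) n x := by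
    simpa using (hasDerivAt_id x).const_mul (n : ℝ)
  refine HasDerivAt.congr_deriv ((h.cos.const_mul z.re).sub (h.sin.const_mul z.im)) ?_
  unfold waveIm
  ring

lemma hasDerivAt_waveIm (z : ℂ) (n : ℤ) (x : ℝ) :
    HasDerivAt (waveIm z n) (n * waveRe z n x) x := by
  have h : HasDerivAt (fun x : ℝ => (n : ℝ) * x) n x := by
    simpa using (hasDerivAt_id x).const_mul (n : ℝ)
  refine HasDerivAt.congr_deriv ((h.sin.const_mul z.re).add (h.cos.const_mul z.im)) ?_
  unfold waveRe
  ring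

lemma contDiff_waveRe (z : ℂ) (n : ℤ) : ContDiff ℝ ∞ (waveRe z n) := by
  unfold waveRe
  fun_prop

lemma contDiff_waveIm (z : ℂ) (n : ℤ) : ContDiff ℝ ∞ (waveIm z n) := by
  unfold waveIm
  fun_prop

lemma waveRe_periodic (z : ℂ) (n : ℤ) (x : ℝ) : waveRe z n (x + 2 * Real.pi) = waveRe z n x := by
  unfold waveRe
  rw [mul_add, Real.cos_add_int_mul_two_pi, Real.sin_add_int_mul_two_pi]

lemma waveIm_periodic (z : ℂ) (n : ℤ) (x : ℝ) : waveIm z n (x + 2 * Real.pi) = waveIm z n x := by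
  unfold waveIm
  rw [mul_add, Real.cos_add_int_mul_two_pi, Real.sin_add_int_mul_two_pi]

lemma abs_waveRe_le (z : ℂ) (n : ℤ) (x : ℝ) : |waveRe z n x| ≤ |z.re| + |z.im| := by
  unfold waveRe
  refine (abs_sub _ _).trans ?_
  rw [abs_mul, abs_mul]
  exact add_le_add (mul_le_of_le_one_right (abs_nonneg _) (Real.abs_cos_le_one _))
    (mul_le_of_le_one_right (abs_nonneg _) (Real.abs_sin_le_one _))

/-- The wave number `σ n` of the monomial `w_n^σ e^{i σ n x}`. -/
def waveNumber (i : ℤˣ × ℤ) : ℤ := (i.1 : ℤ) * i.2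

/-- The indices `(σ, n)`, `n ∈ S`. -/
def modes (S : Finset ℤ) : Finset (ℤˣ × ℤ) := Finset.univ ×ˢ S

lemma sum_modes (S : Finset ℤ) (f : ℤˣ × ℤ → ℂ) :
    ∑ i ∈ modes S, f i = ∑ n ∈ S, (f (1, n) + f (-1, n)) := by
  rw [modes, Finset.sum_product_right]
  refine Finset.sum_congr rfl fun n _ => ?_
  rw [show (Finset.univ : Finset ℤˣ) = {1, -1} from rfl, Finset.sum_pair (by decide)]

/-- `f` is the trigonometric polynomial with coefficients `c (σ, n)` on `e^{i σ n x}`. -/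
def HasTrig (S : Finset ℤ) (f : ℝ → ℝ) (c : ℤˣ × ℤ → ℂ) : Prop :=
  ∀ x, (f x : ℂ) = ∑ i ∈ modes S, c i * Complex.exp (Complex.I * waveNumber i * x)

lemma waveRe_eq_exp (z : ℂ) (n : ℤ) (x : ℝ) : (waveRe z n x : ℂ) =
    (1 / 2) * z * Complex.exp (Complex.I * waveNumber (1, n) * x) +
      (1 / 2) * conj z * Complex.exp (Complex.I * waveNumber (-1, n) * x) := by
  have h1 : Complex.I * waveNumber (1, n) * x = ((n * x : ℝ) : ℂ) * Complex.I := by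
    simp [waveNumber]; ring
  have h2 : Complex.I * waveNumber (-1, n) * x = ((-(n * x) : ℝ) : ℂ) * Complex.I := by
    simp [waveNumber]; ring
  rw [h1, h2, Complex.exp_mul_I, Complex.exp_mul_I, ← Complex.ofReal_cos, ← Complex.ofReal_sin,
    ← Complex.ofReal_cos, ← Complex.ofReal_sin, Real.cos_neg, Real.sin_neg]
  unfold waveRe
  generalize Real.cos (n * x) = C
  generalize Real.sin (n * x) = S
  apply Complex.ext
  · simp; ring
  · simp; ring

lemma waveIm_eq_exp (z : ℂ) (n : ℤ) (x : ℝ) : (waveIm z n x : ℂ) =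
    (-Complex.I / 2) * z * Complex.exp (Complex.I * waveNumber (1, n) * x) +
      (Complex.I / 2) * conj z * Complex.exp (Complex.I * waveNumber (-1, n) * x) := by
  have h1 : Complex.I * waveNumber (1, n) * x = ((n * x : ℝ) : ℂ) * Complex.I := by
    simp [waveNumber]; ring
  have h2 : Complex.I * waveNumber (-1, n) * x = ((-(n * x) : ℝ) : ℂ) * Complex.I := by
    simp [waveNumber]; ring
  rw [h1, h2, Complex.exp_mul_I, Complex.exp_mul_I, ← Complex.ofReal_cos, ← Complex.ofReal_sin,
    ← Complex.ofReal_cos, ← Complex.ofReal_sin, Real.cos_neg, Real.sin_neg]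
  unfold waveIm
  generalize Real.cos (n * x) = C
  generalize Real.sin (n * x) = S
  apply Complex.ext
  · simp; ring
  · simp; ring

lemma hasTrig_sum_waveRe (S : Finset ℤ) (a : ℤ → ℝ) (w : ℤ → ℂ) :
    HasTrig S (fun x => ∑ n ∈ S, a n * waveRe (w n) n x)
      (fun i => (1 / 2) * a i.2 * sgn i.1 (w i.2)) := fun x => by
  rw [sum_modes]
  push_cast
  refine Finset.sum_congr rfl fun n _ => ?_
  rw [waveRe_eq_exp]
  simp [sgn]
  ring

lemma hasTrig_sum_waveIm (S : Finset ℤ) (a : ℤ → ℝ) (w : ℤ → ℂ) :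
    HasTrig S (fun x => ∑ n ∈ S, a n * waveIm (w n) n x)
      (fun i => (-Complex.I * (i.1 : ℤ) / 2) * a i.2 * sgn i.1 (w i.2)) := fun x => by
  rw [sum_modes]
  push_cast
  refine Finset.sum_congr rfl fun n _ => ?_
  rw [waveIm_eq_exp]
  simp [sgn]
  ring

lemma integral_exp_I_mul (k : ℤ) :
    ∫ x in (0 : ℝ)..(2 * Real.pi), Complex.exp (Complex.I * k * x) =
      if k = 0 then 2 * Real.pi else 0 := by
  split_ifs with hk
  · simp [hk]
  · have hc : Complex.I * k ≠ 0 := mul_ne_zero Complex.I_ne_zero (by exact_mod_cast hk)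
    rw [integral_exp_mul_complex hc]
    have h0 : Complex.exp (Complex.I * k * (2 * Real.pi : ℝ)) = 1 := by
      rw [Complex.exp_eq_one_iff]
      exact ⟨k, by push_cast; ring⟩
    rw [h0]
    simp

lemma fourierCoef_of_eq_sum {ι : Type*} {s : Finset ι} {f : ℝ → ℝ} {c : ι → ℂ} {k : ι → ℤ}
    (hf : ∀ x, (f x : ℂ) = ∑ i ∈ s, c i * Complex.exp (Complex.I * k i * x)) (j : ℤ) :
    fourierCoef f j = Real.sqrt (2 * Real.pi) * ∑ i ∈ s, if k i = j then c i else 0 := by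
  have h1 : ∫ x in (0 : ℝ)..(2 * Real.pi), (f x : ℂ) * Complex.exp (-(Complex.I * j * x)) =
      ∑ i ∈ s, c i * if k i - j = 0 then 2 * Real.pi else 0 := by
    simp only [hf, Finset.sum_mul]
    rw [intervalIntegral.integral_finsetSum
      (fun i _ => Continuous.intervalIntegrable (by fun_prop) _ _)]
    refine Finset.sum_congr rfl fun i _ => ?_
    rw [← integral_exp_I_mul, ← intervalIntegral.integral_const_mul]
    refine intervalIntegral.integral_congr fun x _ => ?_
    rw [mul_assoc, ← Complex.exp_add]
    congr 2
    push_cast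
    ring
  rw [fourierCoef, h1, Finset.mul_sum, Finset.mul_sum]
  refine Finset.sum_congr rfl fun i _ => ?_
  simp only [sub_eq_zero]
  split_ifs
  · have h2 : ((Real.sqrt (2 * Real.pi) : ℝ) : ℂ) ≠ 0 := by
      exact_mod_cast (Real.sqrt_pos.2 (by positivity)).ne'
    have h3 : ((2 * Real.pi : ℝ) : ℂ) = (Real.sqrt (2 * Real.pi) : ℂ) ^ 2 := by
      rw [← Complex.ofReal_pow, Real.sq_sqrt (by positivity)]
    rw [h3]
    push_cast
    field_simp
  · simp

/-- The expansion of a sum of two products, indexed by the pairs of modes. -/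
lemma HasTrig.mul_add_mul {S : Finset ℤ} {f₁ f₂ f₃ f₄ : ℝ → ℝ} {c₁ c₂ c₃ c₄ : ℤˣ × ℤ → ℂ}
    (h₁ : HasTrig S f₁ c₁) (h₂ : HasTrig S f₂ c₂) (h₃ : HasTrig S f₃ c₃) (h₄ : HasTrig S f₄ c₄)
    (a b : ℝ) (x : ℝ) : ((a * (f₁ x * f₂ x) + b * (f₃ x * f₄ x) : ℝ) : ℂ) =
      ∑ p ∈ modes S ×ˢ modes S, (a * (c₁ p.1 * c₂ p.2) + b * (c₃ p.1 * c₄ p.2)) *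
        Complex.exp (Complex.I * ((waveNumber p.1 + waveNumber p.2 : ℤ) : ℂ) * x) := by
  have key : ∀ c c' : ℤˣ × ℤ → ℂ,
      (∑ i ∈ modes S, c i * Complex.exp (Complex.I * waveNumber i * x)) *
      (∑ i ∈ modes S, c' i * Complex.exp (Complex.I * waveNumber i * x)) =
      ∑ p ∈ modes S ×ˢ modes S, (c p.1 * c' p.2) *
        Complex.exp (Complex.I * ((waveNumber p.1 + waveNumber p.2 : ℤ) : ℂ) * x) := by
    intro c c'
    rw [Finset.sum_mul_sum, ← Finset.sum_product']
    refine Finset.sum_congr rfl fun p _ => ?_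
    rw [mul_mul_mul_comm, ← Complex.exp_add]
    congr 2
    push_cast
    ring
  rw [Complex.ofReal_add, Complex.ofReal_mul, Complex.ofReal_mul, Complex.ofReal_mul,
    Complex.ofReal_mul, h₁ x, h₂ x, h₃ x, h₄ x, key, key, Finset.mul_sum, Finset.mul_sum,
    ← Finset.sum_add_distrib]
  refine Finset.sum_congr rfl fun p _ => ?_
  ring

/-! ### States with finitely many modes -/

/-- The profile in the vertical variable of the harmonic functions with wave number `n`, with
the Neumann condition at the bottom. -/
noncomputable def profile (h : ℝ≥0∞) (n : ℤ) (y : ℝ) : ℝ :=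
  Real.cosh (|(n : ℝ)| * y) + tanhDepth h n * Real.sinh (|(n : ℝ)| * y)

/-- The derivative of `profile`. -/
noncomputable def profileDeriv (h : ℝ≥0∞) (n : ℤ) (y : ℝ) : ℝ :=
  |(n : ℝ)| * (Real.sinh (|(n : ℝ)| * y) + tanhDepth h n * Real.cosh (|(n : ℝ)| * y))

lemma contDiff_profile (h : ℝ≥0∞) (n : ℤ) : ContDiff ℝ ∞ (profile h n) := by
  unfold profile
  have h1 : ContDiff ℝ ∞ fun y : ℝ => |(n : ℝ)| * y := by fun_prop
  exact h1.cosh.add (contDiff_const.mul h1.sinh)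

lemma hasDerivAt_profile (h : ℝ≥0∞) (n : ℤ) (y : ℝ) :
    HasDerivAt (profile h n) (profileDeriv h n y) y := by
  have h1 : HasDerivAt (fun y : ℝ => |(n : ℝ)| * y) |(n : ℝ)| y := by
    simpa using (hasDerivAt_id y).const_mul |(n : ℝ)|
  refine HasDerivAt.congr_deriv (h1.cosh.add (h1.sinh.const_mul (tanhDepth h n))) ?_
  unfold profileDeriv
  ring

lemma hasDerivAt_profileDeriv (h : ℝ≥0∞) (n : ℤ) (y : ℝ) :
    HasDerivAt (profileDeriv h n) ((n : ℝ) ^ 2 * profile h n y) y := by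
  have h1 : HasDerivAt (fun y : ℝ => |(n : ℝ)| * y) |(n : ℝ)| y := by
    simpa using (hasDerivAt_id y).const_mul |(n : ℝ)|
  refine HasDerivAt.congr_deriv
    ((h1.sinh.add (h1.cosh.const_mul (tanhDepth h n))).const_mul |(n : ℝ)|) ?_
  unfold profile
  rw [← sq_abs (n : ℝ)]
  ring

lemma profile_zero (h : ℝ≥0∞) (n : ℤ) : profile h n 0 = 1 := by simp [profile]

lemma profileDeriv_zero (h : ℝ≥0∞) (n : ℤ) : profileDeriv h n 0 = G₀ h n := by
  simp [profileDeriv, G₀, mul_comm]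

lemma profileDeriv_bottom {h : ℝ≥0∞} (hh : h ≠ ⊤) (n : ℤ) : profileDeriv h n (-h.toReal) = 0 := by
  have h1 := (Real.cosh_pos (h.toReal * |(n : ℝ)|)).ne'
  rw [profileDeriv, tanhDepth, if_neg hh, mul_neg, Real.sinh_neg, Real.cosh_neg, mul_comm _ h.toReal,
    Real.tanh_eq_sinh_div_cosh, div_mul_cancel₀ _ h1, neg_add_cancel, mul_zero]

lemma profileDeriv_top (n : ℤ) (y : ℝ) :
    profileDeriv ⊤ n y = |(n : ℝ)| * Real.exp (|(n : ℝ)| * y) := by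
  rw [profileDeriv, tanhDepth, if_pos rfl, one_mul, Real.sinh_add_cosh]

section

variable (h : ℝ≥0∞) (S : Finset ℤ) (a : ℤ → ℝ) (w : ℤ → ℂ)

/-- The harmonic function with trace `∑ a_n Re (w_n e^{i n x})` on `y = 0`. -/
noncomputable def potential (p : ℝ × ℝ) : ℝ :=
  ∑ n ∈ S, a n * (waveRe (w n) n p.1 * profile h n p.2)

lemma contDiff_potential : ContDiff ℝ ∞ (potential h S a w) := by
  unfold potential
  exact ContDiff.sum fun n _ => contDiff_const.mul
    (((contDiff_waveRe _ _).comp contDiff_fst).mul ((contDiff_profile _ _).comp contDiff_snd))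

lemma hasDerivAt_potential_fst (x y : ℝ) : HasDerivAt (fun x => potential h S a w (x, y))
    (∑ n ∈ S, a n * (-(n * waveIm (w n) n x) * profile h n y)) x := by
  simp only [potential]
  exact HasDerivAt.fun_sum fun n _ => ((hasDerivAt_waveRe _ _ _).mul_const _).const_mul _

lemma hasDerivAt_potential_snd (x y : ℝ) : HasDerivAt (fun y => potential h S a w (x, y))
    (∑ n ∈ S, a n * (waveRe (w n) n x * profileDeriv h n y)) y := by
  simp only [potential]
  exact HasDerivAt.fun_sum fun n _ => ((hasDerivAt_profile _ _ _).const_mul _).const_mul _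

lemma fderiv_potential_fst (x y : ℝ) : fderiv ℝ (potential h S a w) (x, y) (1, 0) =
    ∑ n ∈ S, a n * (-(n * waveIm (w n) n x) * profile h n y) :=
  (hasDerivAt_fst_of_contDiff (contDiff_potential h S a w) x y).unique
    (hasDerivAt_potential_fst h S a w x y)

lemma fderiv_potential_snd (x y : ℝ) : fderiv ℝ (potential h S a w) (x, y) (0, 1) =
    ∑ n ∈ S, a n * (waveRe (w n) n x * profileDeriv h n y) :=
  (hasDerivAt_snd_of_contDiff (contDiff_potential h S a w) x y).unique
    (hasDerivAt_potential_snd h S a w x y)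

lemma hasDerivAt_fderiv_potential_snd (x y : ℝ) :
    HasDerivAt (fun y => fderiv ℝ (potential h S a w) (x, y) (0, 1))
    (∑ n ∈ S, a n * (waveRe (w n) n x * ((n : ℝ) ^ 2 * profile h n y))) y := by
  simp only [fderiv_potential_snd]
  exact HasDerivAt.fun_sum fun n _ => ((hasDerivAt_profileDeriv _ _ _).const_mul _).const_mul _

lemma isEntirePotential_potential (hS : 0 ∉ S) : IsEntirePotential h (potential h S a w) where
  smooth := contDiff_potential h S a w
  periodic x y := by simp only [potential, waveRe_periodic]
  harmonic x y := by
    have h1 : deriv (fun x' => potential h S a w (x', y)) =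
        fun x => ∑ n ∈ S, a n * (-(n * waveIm (w n) n x) * profile h n y) :=
      funext fun x => (hasDerivAt_potential_fst h S a w x y).deriv
    have h2 : deriv (fun y' => potential h S a w (x, y')) =
        fun y => ∑ n ∈ S, a n * (waveRe (w n) n x * profileDeriv h n y) :=
      funext fun y => (hasDerivAt_potential_snd h S a w x y).deriv
    have h3 : HasDerivAt (fun x => ∑ n ∈ S, a n * (-(n * waveIm (w n) n x) * profile h n y))
        (∑ n ∈ S, a n * (-(n * (n * waveRe (w n) n x)) * profile h n y)) x :=
      HasDerivAt.fun_sum fun n _ =>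
        (((hasDerivAt_waveIm _ _ _).const_mul _).neg.mul_const _).const_mul _
    have h4 : HasDerivAt (fun y => ∑ n ∈ S, a n * (waveRe (w n) n x * profileDeriv h n y))
        (∑ n ∈ S, a n * (waveRe (w n) n x * ((n : ℝ) ^ 2 * profile h n y))) y :=
      HasDerivAt.fun_sum fun n _ => ((hasDerivAt_profileDeriv _ _ _).const_mul _).const_mul _
    rw [iteratedDeriv_succ, iteratedDeriv_one, iteratedDeriv_succ, iteratedDeriv_one, h1, h2,
      h3.deriv, h4.deriv, ← Finset.sum_add_distrib]
    refine Finset.sum_eq_zero fun n _ => ?_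
    ring
  bottom hh x := by
    rw [(hasDerivAt_potential_snd h S a w x _).deriv]
    refine Finset.sum_eq_zero fun n _ => ?_
    rw [profileDeriv_bottom hh, mul_zero, mul_zero]
  bottom_infinite hh := by
    subst hh
    have h1 : Filter.Tendsto (fun y : ℝ => ∑ n ∈ S, |a n| * ((|(w n).re| + |(w n).im|) *
        (|(n : ℝ)| * Real.exp (|(n : ℝ)| * y)))) Filter.atBot (nhds 0) := by
      rw [← Finset.sum_const_zero (s := S)]
      refine tendsto_finsetSum _ fun n hn => ?_
      have hn0 : n ≠ 0 := fun h0 => hS (h0 ▸ hn)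
      have hn1 : 0 < |(n : ℝ)| := lt_of_lt_of_le one_pos (one_le_abs_cast hn0)
      have h2 := Real.tendsto_exp_atBot.comp (Filter.tendsto_id.const_mul_atBot hn1)
      simpa using ((h2.const_mul |(n : ℝ)|).const_mul (|(w n).re| + |(w n).im|)).const_mul |a n|
    rw [Metric.tendstoUniformly_iff]
    intro δ hδ
    filter_upwards [h1.eventually (gt_mem_nhds hδ)] with y hy x
    rw [dist_zero_left, (hasDerivAt_potential_snd ⊤ S a w x y).deriv]
    refine lt_of_le_of_lt (norm_sum_le_of_le _ fun n _ => ?_) hy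
    rw [profileDeriv_top, norm_mul, norm_mul, Real.norm_eq_abs, Real.norm_eq_abs,
      Real.norm_of_nonneg (by positivity : 0 ≤ |(n : ℝ)| * Real.exp (|(n : ℝ)| * y))]
    have := abs_waveRe_le (w n) n x
    gcongr

end

section

variable (g κ : ℝ) (h : ℝ≥0∞) (S : Finset ℤ) (w : ℤ → ℂ)

/-- The free surface of the state with complex variable `w`, to first order. -/
noncomputable def surface (x : ℝ) : ℝ :=
  ∑ n ∈ S, (Λ g κ h n / Real.sqrt Real.pi) * waveIm (w n) n x

lemma contDiff_surface : ContDiff ℝ ∞ (surface g κ h S w) := by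
  unfold surface
  exact ContDiff.sum fun n _ => contDiff_const.mul (contDiff_waveIm _ _)

lemma surface_periodic (x : ℝ) : surface g κ h S w (x + 2 * Real.pi) = surface g κ h S w x := by
  simp only [surface, waveIm_periodic]

lemma deriv_surface : deriv (surface g κ h S w) =
    fun x => ∑ n ∈ S, (Λ g κ h n / Real.sqrt Real.pi * n) * waveRe (w n) n x := by
  funext x
  have h1 : HasDerivAt (surface g κ h S w)
      (∑ n ∈ S, (Λ g κ h n / Real.sqrt Real.pi) * (n * waveRe (w n) n x)) x := by
    unfold surface
    exact HasDerivAt.fun_sum fun n _ => (hasDerivAt_waveIm _ _ _).const_mul _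
  rw [h1.deriv]
  exact Finset.sum_congr rfl fun n _ => by ring

lemma deriv_deriv_surface : deriv (deriv (surface g κ h S w)) =
    fun x => ∑ n ∈ S, -(Λ g κ h n / Real.sqrt Real.pi * n ^ 2) * waveIm (w n) n x := by
  funext x
  have h1 : HasDerivAt (fun x => ∑ n ∈ S, (Λ g κ h n / Real.sqrt Real.pi * n) * waveRe (w n) n x)
      (∑ n ∈ S, (Λ g κ h n / Real.sqrt Real.pi * n) * (-(n * waveIm (w n) n x))) x :=
    HasDerivAt.fun_sum fun n _ => (hasDerivAt_waveRe _ _ _).const_mul _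
  rw [deriv_surface, h1.deriv]
  exact Finset.sum_congr rfl fun n _ => by ring

lemma integral_surface {S : Finset ℤ} (hS : 0 ∉ S) :
    ∫ x in (0 : ℝ)..(2 * Real.pi), surface g κ h S w x = 0 := by
  have h1 := fourierCoef_of_eq_sum (hasTrig_sum_waveIm S (fun n => Λ g κ h n / Real.sqrt Real.pi) w)
    0
  rw [Finset.sum_eq_zero, mul_zero, fourierCoef] at h1
  · have h2 : ((1 / Real.sqrt (2 * Real.pi) : ℝ) : ℂ) ≠ 0 := by
      have : 0 < Real.sqrt (2 * Real.pi) := Real.sqrt_pos.2 (by positivity)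
      exact_mod_cast (one_div_pos.2 this).ne'
    have h3 := (mul_eq_zero.1 h1).resolve_left h2
    simp only [Int.cast_zero, mul_zero, zero_mul, neg_zero, Complex.exp_zero, mul_one] at h3
    rw [intervalIntegral.integral_ofReal] at h3
    exact_mod_cast h3
  · intro i hi
    refine if_neg fun h0 => ?_
    rcases mul_eq_zero.1 h0 with h4 | h4
    · exact i.1.ne_zero h4
    · exact hS (h4 ▸ (Finset.mem_product.1 hi).2)

lemma sqrt_two_pi_div_sqrt_two :
    ((1 / Real.sqrt 2 : ℝ) : ℂ) * (Real.sqrt (2 * Real.pi) : ℂ) = (Real.sqrt Real.pi : ℂ) := by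
  rw [← Complex.ofReal_mul, Real.sqrt_mul zero_le_two]
  congr 1
  have : Real.sqrt 2 ≠ 0 := by positivity
  field_simp

variable {g κ h S}

/-- The complex variable of a pair of trigonometric polynomials.  The second relation between the
coefficients says that `conj (w_n)` does not contribute to the mode `-n`. -/
lemma complexVar_of_hasTrig (hg : 0 ≤ g) (hκ : 0 < κ) (hh : 0 < h) (hS : 0 ∉ S) {f f' : ℝ → ℝ}
    {c c' : ℤˣ × ℤ → ℂ} {b : ℤ → ℂ} (hf : HasTrig S f c) (hf' : HasTrig S f' c')
    (hb : ∀ n ∈ S, (Λ g κ h n : ℂ) ^ 2 * c' (1, n) + Complex.I * c (1, n) =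
      (Real.sqrt Real.pi : ℂ)⁻¹ * (Λ g κ h n * b n))
    (hb' : ∀ n ∈ S, (Λ g κ h n : ℂ) ^ 2 * c' (-1, n) + Complex.I * c (-1, n) = 0) (n : ℤ) :
    complexVar g κ h f f' n = if n ∈ S then b n else 0 := by
  have hπ : (Real.sqrt Real.pi : ℂ) ≠ 0 := by
    exact_mod_cast (Real.sqrt_pos.2 Real.pi_pos).ne'
  have h1 : complexVar g κ h f f' n = Real.sqrt Real.pi * ∑ i ∈ modes S,
      if waveNumber i = n then (Λ g κ h n * c' i + Complex.I * ((Λ g κ h n)⁻¹ : ℝ) * c i) else 0 := by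
    have h2 : ∀ i, (if waveNumber i = n then
        ((Λ g κ h n : ℂ) * c' i + Complex.I * ((Λ g κ h n)⁻¹ : ℝ) * c i) else 0) =
        (Λ g κ h n : ℂ) * (if waveNumber i = n then c' i else 0) +
        Complex.I * ((Λ g κ h n)⁻¹ : ℝ) * (if waveNumber i = n then c i else 0) := by
      intro i; split_ifs <;> simp
    rw [complexVar, fourierCoef_of_eq_sum hf, fourierCoef_of_eq_sum hf',
      ← sqrt_two_pi_div_sqrt_two]
    simp only [h2]
    rw [Finset.sum_add_distrib, ← Finset.mul_sum, ← Finset.mul_sum]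
    ring
  rw [h1, sum_modes, Finset.mul_sum, ← Finset.sum_ite_eq S n b]
  refine Finset.sum_congr rfl fun m hm => ?_
  have hm0 : m ≠ 0 := fun h0 => hS (h0 ▸ hm)
  have hΛ : (Λ g κ h m : ℂ) ≠ 0 := by exact_mod_cast (Λ_pos hg hκ hh hm0).ne'
  have e1 : waveNumber (1, m) = m := by simp [waveNumber]
  have e2 : waveNumber (-1, m) = -m := by simp [waveNumber]
  rw [e1, e2]
  have t1 : (Λ g κ h m : ℂ) * c' (1, m) + Complex.I * ((Λ g κ h m)⁻¹ : ℝ) * c (1, m) =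
      (Real.sqrt Real.pi : ℂ)⁻¹ * b m := by
    have := hb m hm
    push_cast
    field_simp at this ⊢
    linear_combination this
  have t2 : (Λ g κ h m : ℂ) * c' (-1, m) + Complex.I * ((Λ g κ h m)⁻¹ : ℝ) * c (-1, m) = 0 := by
    have := hb' m hm
    push_cast
    field_simp
    linear_combination this
  have t3 : (if -m = n then
      (Λ g κ h n : ℂ) * c' (-1, m) + Complex.I * ((Λ g κ h n)⁻¹ : ℝ) * c (-1, m) else 0) = 0 := by
    split_ifs with h0
    · rw [← h0, Λ_neg, t2]
    · rfl
  rw [t3, add_zero]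
  by_cases hmn : m = n
  · subst hmn
    rw [if_pos rfl, if_pos rfl, t1, mul_inv_cancel_left₀ hπ]
  · rw [if_neg hmn, if_neg (Ne.symm hmn), mul_zero]

variable (g κ h) in
/-- The coefficients of the quadratic part of the water waves vector field in the complex
variable: the sum over `i = (σ, n)` and `i' = (σ', k)` with `σ n + σ' k = j` of
`fieldCoef g κ h j i i' * w_n^σ * w_k^σ'`.  The index `i` comes from `η` in the second summand,
and the index `i'` from `ψ`. -/
noncomputable def fieldCoef (j : ℤ) (i i' : ℤˣ × ℤ) : ℂ :=
  (Λ g κ h j * (waveNumber i * waveNumber i' + G₀ h i.2 * G₀ h i'.2) /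
    (8 * Real.sqrt Real.pi * (Λ g κ h i.2 * Λ g κ h i'.2)) : ℝ) +
  ((i.1 : ℤ) * (j * waveNumber i' - G₀ h j * G₀ h i'.2) * Λ g κ h i.2 /
    (4 * Real.sqrt Real.pi * (Λ g κ h i'.2 * Λ g κ h j)) : ℝ)

/-- `fieldCoef` from the expansion at second order of the two equations.  On the left hand side:
the terms `-ψ_x² / 2 + (G(0)ψ)² / 2` of the equation for `ψ`; the terms
`η Φ_yy - η_x Φ_x = -(η ψ_x)_x` of the equation for `η`; and the term `η G(0)ψ`, which is the
quadratic part of the trace `ψ` itself.  Here `a` and `b` are the amplitudes of `ψ` and `η`. -/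
lemma fieldCoef_identity (hg : 0 ≤ g) (hκ : 0 < κ) (hh : 0 < h) {j : ℤ} (hj : j ≠ 0)
    {i i' : ℤˣ × ℤ} (hi : i.2 ≠ 0) (hi' : i'.2 ≠ 0) (hk : waveNumber i + waveNumber i' = j)
    (s s' : ℂ) (a : ℤ → ℝ) (ha : ∀ n, a n = (Λ g κ h n)⁻¹ / Real.sqrt Real.pi)
    (b : ℤ → ℝ) (hb : ∀ n, b n = Λ g κ h n / Real.sqrt Real.pi) :
    (Real.sqrt Real.pi : ℂ) * ((Λ g κ h j : ℂ) *
      (((-(1 / 2) : ℝ) : ℂ) * (((-Complex.I * (i.1 : ℤ) / 2) * ((-(a i.2 * i.2) : ℝ) : ℂ) * s) *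
        ((-Complex.I * (i'.1 : ℤ) / 2) * ((-(a i'.2 * i'.2) : ℝ) : ℂ) * s')) +
      ((1 / 2 : ℝ) : ℂ) * (((1 / 2) * ((a i.2 * G₀ h i.2 : ℝ) : ℂ) * s) *
        ((1 / 2) * ((a i'.2 * G₀ h i'.2 : ℝ) : ℂ) * s'))) +
      Complex.I * ((Λ g κ h j)⁻¹ : ℝ) *
      (((1 : ℝ) : ℂ) * (((-Complex.I * (i.1 : ℤ) / 2) * (b i.2 : ℂ) * s) *
        ((1 / 2) * ((a i'.2 * (i'.2 : ℝ) ^ 2 : ℝ) : ℂ) * s')) +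
      ((-1 : ℝ) : ℂ) * (((1 / 2) * ((b i.2 * i.2 : ℝ) : ℂ) * s) *
        ((-Complex.I * (i'.1 : ℤ) / 2) * ((-(a i'.2 * i'.2) : ℝ) : ℂ) * s'))) -
      Complex.I * (Ω g κ h j : ℂ) * (Λ g κ h j : ℂ) *
      (((1 : ℝ) : ℂ) * (((-Complex.I * (i.1 : ℤ) / 2) * (b i.2 : ℂ) * s) *
        ((1 / 2) * ((a i'.2 * G₀ h i'.2 : ℝ) : ℂ) * s')))) =
      fieldCoef g κ h j i i' * s * s' := by
  obtain ⟨σ, n⟩ := i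
  obtain ⟨σ', k⟩ := i'
  simp only at hi hi'
  have hπ : (Real.sqrt Real.pi : ℂ) ≠ 0 := by
    exact_mod_cast (Real.sqrt_pos.2 Real.pi_pos).ne'
  have hΩ : (Ω g κ h j : ℂ) * (Λ g κ h j : ℂ) = (Λ g κ h j : ℂ)⁻¹ * (G₀ h j : ℂ) := by
    exact_mod_cast Ω_mul_Λ hg hκ hh hj
  have hΛj : (Λ g κ h j : ℂ) ≠ 0 := by exact_mod_cast (Λ_pos hg hκ hh hj).ne'
  have hΛn : (Λ g κ h n : ℂ) ≠ 0 := by exact_mod_cast (Λ_pos hg hκ hh hi).ne'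
  have hΛk : (Λ g κ h k : ℂ) ≠ 0 := by exact_mod_cast (Λ_pos hg hκ hh hi').ne'
  have hj' : (j : ℂ) = (σ : ℤ) * n + (σ' : ℤ) * k := by
    rw [← hk]; simp [waveNumber]
  rw [mul_assoc Complex.I (Ω g κ h j : ℂ), hΩ, fieldCoef]
  simp only [ha, hb, waveNumber]
  push_cast
  rw [hj']
  have hI : Complex.I ^ 2 = -1 := Complex.I_sq
  rcases Int.units_eq_one_or σ with rfl | rfl <;> rcases Int.units_eq_one_or σ' with rfl | rfl <;>
    push_cast <;> field_simp <;> rw [hI] <;> ring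

/-- The quadratic part of the conjugated equation, for every `w` supported on `S`. -/
lemma quadratic_identity (hg : 0 ≤ g) (hκ : 0 < κ) (hh : 0 < h)
    {s m : ℝ} (hm : 0 ≤ m) {M₁ : OpCoef} (hM₁ : IsHomogeneousMap m M₁)
    {N : (ℤ → ℂ) → ℤ → ℂ} {R₁ : OpCoef}
    (hconj : ConjugatesTo g κ h s m M₁ N (resonantPart g κ h R₁))
    (hS : 0 ∉ S) {j : ℤ} (hj : j ≠ 0) {W₀ V₀ : ℤ → ℂ} (hW₀ : ∀ n, W₀ n = if n ∈ S then w n else 0)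
    (hV₀ : ∀ n, V₀ n = Complex.I * (Ω g κ h n : ℂ) * W₀ n) :
    (∑ p ∈ modes S ×ˢ modes S, if waveNumber p.1 + waveNumber p.2 = j then
      fieldCoef g κ h j p.1 p.2 * sgn p.1.1 (w p.1.2) * sgn p.2.1 (w p.2.2) else 0) +
      bilin M₁ W₀ V₀ 1 j + bilin M₁ V₀ W₀ 1 j -
        Complex.I * (Ω g κ h j : ℂ) * bilin M₁ W₀ W₀ 1 j =
      quadField (resonantPart g κ h R₁) W₀ 1 j := by
  have hπ : (Real.sqrt Real.pi : ℂ) ≠ 0 := by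
    exact_mod_cast (Real.sqrt_pos.2 Real.pi_pos).ne'
  set a : ℤ → ℝ := fun n => (Λ g κ h n)⁻¹ / Real.sqrt Real.pi with ha
  set b : ℤ → ℝ := fun n => Λ g κ h n / Real.sqrt Real.pi with hb
  set η := surface g κ h S w with hη
  set Φ := potential h S a w with hΦ
  have hηs : ContDiff ℝ ∞ η := contDiff_surface g κ h S w
  have hΦs : ContDiff ℝ ∞ Φ := contDiff_potential h S a w
  -- the trigonometric polynomials that enter the expansion
  have tη : HasTrig S η _ := hasTrig_sum_waveIm S b w
  have tη' : HasTrig S (deriv η)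
      (fun i => (1 / 2) * ((b i.2 * i.2 : ℝ) : ℂ) * sgn i.1 (w i.2)) := by
    rw [hη, deriv_surface]
    exact hasTrig_sum_waveRe S (fun n => b n * n) w
  have tψ : HasTrig S (fun x => traceFamily Φ η (0, x))
      (fun i => (1 / 2) * ((a i.2 : ℝ) : ℂ) * sgn i.1 (w i.2)) := by
    simp only [traceFamily, zero_mul, hΦ, potential, profile_zero, mul_one]
    exact hasTrig_sum_waveRe S a w
  have tx : HasTrig S (fun x => fderiv ℝ Φ (x, 0) (1, 0))
      (fun i => (-Complex.I * (i.1 : ℤ) / 2) * ((-(a i.2 * i.2) : ℝ) : ℂ) * sgn i.1 (w i.2)) := by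
    have : (fun x => fderiv ℝ Φ (x, 0) (1, 0)) =
        fun x => ∑ n ∈ S, (-(a n * n)) * waveIm (w n) n x := by
      funext x
      rw [hΦ, fderiv_potential_fst]
      refine Finset.sum_congr rfl fun n _ => ?_
      rw [profile_zero]; ring
    rw [this]
    exact hasTrig_sum_waveIm S (fun n => -(a n * n)) w
  have ty : HasTrig S (fun x => fderiv ℝ Φ (x, 0) (0, 1))
      (fun i => (1 / 2) * ((a i.2 * G₀ h i.2 : ℝ) : ℂ) * sgn i.1 (w i.2)) := by
    have : (fun x => fderiv ℝ Φ (x, 0) (0, 1)) =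
        fun x => ∑ n ∈ S, (a n * G₀ h n) * waveRe (w n) n x := by
      funext x
      rw [hΦ, fderiv_potential_snd]
      refine Finset.sum_congr rfl fun n _ => ?_
      rw [profileDeriv_zero]; ring
    rw [this]
    exact hasTrig_sum_waveRe S (fun n => a n * G₀ h n) w
  have tyy : HasTrig S (fun x => ∑ n ∈ S, (a n * (n : ℝ) ^ 2) * waveRe (w n) n x) _ :=
    hasTrig_sum_waveRe S (fun n => a n * (n : ℝ) ^ 2) w
  have tq : HasTrig S (fun x => normalVelocityFamily Φ η (0, x))
      (fun i => (1 / 2) * ((a i.2 * G₀ h i.2 : ℝ) : ℂ) * sgn i.1 (w i.2)) := by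
    simpa only [normalVelocityFamily, zero_mul, sub_zero] using ty
  have tr : HasTrig S (fun x => accelerationFamily g κ Φ η (0, x))
      (fun i => (-Complex.I * (i.1 : ℤ) / 2) * ((-((g + κ * (i.2 : ℝ) ^ 2) * b i.2) : ℝ) : ℂ) * sgn i.1 (w i.2)) := by
    have : (fun x => accelerationFamily g κ Φ η (0, x)) =
        fun x => ∑ n ∈ S, (-((g + κ * (n : ℝ) ^ 2) * b n)) * waveIm (w n) n x := by
      funext x
      rw [accelerationFamily]
      simp only [zero_mul, add_zero, ne_eq, OfNat.ofNat_ne_zero, not_false_eq_true, zero_pow,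
        Real.sqrt_one, one_pow, div_one]
      rw [hη, deriv_deriv_surface, surface, Finset.mul_sum, Finset.mul_sum,
        ← Finset.sum_add_distrib]
      refine Finset.sum_congr rfl fun n _ => ?_
      rw [hb]; ring
    rw [this]
    exact hasTrig_sum_waveIm S (fun n => -((g + κ * (n : ℝ) ^ 2) * b n)) w
  -- the linear part
  have hW : ∀ n, n ≠ 0 → complexVar g κ h η (fun x => traceFamily Φ η (0, x)) n = W₀ n := by
    intro n _
    rw [hW₀]
    refine complexVar_of_hasTrig hg hκ hh hS tη tψ (fun k hk => ?_) (fun k hk => ?_) n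
    all_goals
      have hk0 : k ≠ 0 := fun h0 => hS (h0 ▸ hk)
      have hΛ : (Λ g κ h k : ℂ) ≠ 0 := by exact_mod_cast (Λ_pos hg hκ hh hk0).ne'
      simp only [ha, hb, sgn]
      push_cast
      field_simp
      rw [Complex.I_sq]
      ring
  have hV : ∀ n, n ≠ 0 → complexVar g κ h (fun x => normalVelocityFamily Φ η (0, x))
      (fun x => accelerationFamily g κ Φ η (0, x)) n = V₀ n := by
    intro n _
    have hv : V₀ n = if n ∈ S then Complex.I * (Ω g κ h n : ℂ) * w n else 0 := by
      rw [hV₀, hW₀]; split_ifs <;> simp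
    rw [hv]
    refine complexVar_of_hasTrig (b := fun n => Complex.I * (Ω g κ h n : ℂ) * w n)
      hg hκ hh hS tq tr (fun k hk => ?_) (fun k hk => ?_) n
    all_goals
      have hk0 : k ≠ 0 := fun h0 => hS (h0 ▸ hk)
      have hΛ : (Λ g κ h k : ℂ) ≠ 0 := by exact_mod_cast (Λ_pos hg hκ hh hk0).ne'
      have e1 : (Λ g κ h k : ℂ) * (g + κ * (k : ℂ) ^ 2) = Ω g κ h k * (Λ g κ h k : ℂ)⁻¹ := by
        exact_mod_cast Λ_mul_gravity_capillary hg hκ hh hk0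
      have e2 : (Ω g κ h k : ℂ) * (Λ g κ h k : ℂ) = (Λ g κ h k : ℂ)⁻¹ * (G₀ h k : ℂ) := by
        exact_mod_cast Ω_mul_Λ hg hκ hh hk0
      have e3 : (Λ g κ h k : ℂ) ^ 2 * (g + κ * (k : ℂ) ^ 2) = Ω g κ h k := by
        field_simp at e1
        linear_combination e1
      have e4 : (G₀ h k : ℂ) = Ω g κ h k * (Λ g κ h k : ℂ) ^ 2 := by
        field_simp at e2
        linear_combination -e2
      simp only [ha, hb, sgn]
      push_cast
      rw [e4]
      field_simp
      rw [e3]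
      ring
  -- the quadratic part
  have hyy : ∀ x, HasDerivAt (fun y => fderiv ℝ Φ (x, y) (0, 1))
      (∑ n ∈ S, (a n * (n : ℝ) ^ 2) * waveRe (w n) n x) 0 := fun x => by
    refine (hasDerivAt_fderiv_potential_snd h S a w x 0).congr_deriv ?_
    refine Finset.sum_congr rfl fun n _ => ?_
    rw [profile_zero]; ring
  have hD := (hasDerivAt_complexVar g κ h (contDiff_normalVelocityFamily hΦs hηs)
      (contDiff_accelerationFamily g κ hΦs hηs)
      (fun x => hasDerivAt_normalVelocityFamily hΦs x (hyy x))
      (fun x => hasDerivAt_accelerationFamily g κ hΦs hηs x) j).sub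
    ((hasDerivAt_complexVar g κ h (hηs.comp contDiff_snd : ContDiff ℝ ∞ fun a : ℝ × ℝ => η a.2)
      (contDiff_traceFamily hΦs hηs) (fun x => hasDerivAt_const 0 (η x))
      (fun x => hasDerivAt_traceFamily hΦs x) j).const_mul (Complex.I * (Ω g κ h j : ℂ)))
  have hmain := quadratic_part_of_conjugation hg hκ hh hm hM₁ hconj
    (isEntirePotential_potential h S a w hS) hηs (surface_periodic g κ h S w)
    (integral_surface g κ h w hS) hW hV hj (hV₀ j) hD
  rw [← hmain]
  congr 3
  have f1 := fourierCoef_of_eq_sum (f := fun x => η x * (∑ n ∈ S, (a n * (n : ℝ) ^ 2) *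
      waveRe (w n) n x) - deriv η x * fderiv ℝ Φ (x, 0) (1, 0)) (fun x => by
    refine Eq.trans ?_ (HasTrig.mul_add_mul tη tyy tη' tx 1 (-1) x)
    congr 1
    ring) j
  have f2 := fourierCoef_of_eq_sum (f := fun x => -(1 / 2) * fderiv ℝ Φ (x, 0) (1, 0) ^ 2 +
      (1 / 2) * fderiv ℝ Φ (x, 0) (0, 1) ^ 2) (fun x => by
    refine Eq.trans ?_ (HasTrig.mul_add_mul tx tx ty ty (-(1 / 2)) (1 / 2) x)
    congr 1
    ring) j
  have f3 := fourierCoef_of_eq_sum (f := fun x => η x * fderiv ℝ Φ (x, 0) (0, 1)) (fun x => by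
    refine Eq.trans ?_ (HasTrig.mul_add_mul tη ty tη ty 1 0 x)
    congr 1
    ring) j
  have f4 : fourierCoef (fun _ => 0) j = 0 := by
    unfold fourierCoef; simp
  rw [complexVar, complexVar, f1, f2, f3, f4]
  have hcomb : ∀ (A B C L L' Ωj : ℂ),
      ((1 / Real.sqrt 2 : ℝ) : ℂ) * (L * (Real.sqrt (2 * Real.pi) * B) + Complex.I * L' *
        (Real.sqrt (2 * Real.pi) * A)) - Complex.I * Ωj * (((1 / Real.sqrt 2 : ℝ) : ℂ) *
        (L * (Real.sqrt (2 * Real.pi) * C) + Complex.I * L' * 0)) =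
      Real.sqrt Real.pi * (L * B + Complex.I * L' * A - Complex.I * Ωj * L * C) := by
    intro A B C L L' Ωj
    rw [← sqrt_two_pi_div_sqrt_two]
    ring
  rw [hcomb, Finset.mul_sum, Finset.mul_sum, Finset.mul_sum, ← Finset.sum_add_distrib,
    ← Finset.sum_sub_distrib, Finset.mul_sum]
  refine Finset.sum_congr rfl fun p hp => ?_
  obtain ⟨hp1, hp2⟩ := Finset.mem_product.1 hp
  have hn1 : p.1.2 ≠ 0 := fun h0 => hS (h0 ▸ (Finset.mem_product.1 hp1).2)
  have hn2 : p.2.2 ≠ 0 := fun h0 => hS (h0 ▸ (Finset.mem_product.1 hp2).2)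
  split_ifs with hk
  · rw [← fieldCoef_identity hg hκ hh hj hn1 hn2 hk _ _ a (fun _ => rfl) b (fun _ => rfl)]
    rw [Complex.ofReal_zero, zero_mul, add_zero]
  · simp

end

/-! ### Extraction of the resonant monomials -/

/-- A vanishing exponential sum vanishes frequency by frequency: the characters `t ↦ e^{i θ t}`
of `ℝ` are linearly independent. -/
lemma sum_filter_eq_zero_of_sum_exp_eq_zero {ι : Type*} (s : Finset ι) (C : ι → ℂ) (θ : ι → ℝ)
    (hC : ∀ t : ℝ, ∑ i ∈ s, C i * Complex.exp (Complex.I * θ i * t) = 0) (θ₀ : ℝ) :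
    ∑ i ∈ s with θ i = θ₀, C i = 0 := by
  classical
  let χ : ℝ → (Multiplicative ℝ →* ℂ) := fun a =>
    { toFun := fun t => Complex.exp (Complex.I * a * (Multiplicative.toAdd t : ℝ))
      map_one' := by simp
      map_mul' := fun x y => by
        rw [← Complex.exp_add, toAdd_mul]
        congr 1
        push_cast
        ring }
  have hχ : Function.Injective χ := by
    intro a b hab
    have h1 : (fun t : ℝ => Complex.exp (Complex.I * a * (t : ℝ))) =
        fun t : ℝ => Complex.exp (Complex.I * b * (t : ℝ)) :=
      funext fun t => DFunLike.congr_fun hab (Multiplicative.ofAdd t)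
    have hd : ∀ a : ℝ, HasDerivAt (fun t : ℝ => Complex.exp (Complex.I * a * (t : ℝ)))
        (Complex.I * a) 0 := by
      intro a
      have h2 : HasDerivAt (fun t : ℝ => Complex.I * a * (t : ℂ)) (Complex.I * a) 0 := by
        simpa using (hasDerivAt_id (0 : ℝ)).ofReal_comp.const_mul (Complex.I * a)
      simpa using h2.cexp
    have h3 := hd a
    rw [h1] at h3
    exact_mod_cast mul_left_cancel₀ Complex.I_ne_zero (h3.unique (hd b))
  have hli := (linearIndependent_monoidHom (Multiplicative ℝ) ℂ).comp χ hχ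
  have hsum : ∑ a ∈ s.image θ, (∑ i ∈ s with θ i = a, C i) • (χ a : Multiplicative ℝ → ℂ) = 0 := by
    funext t
    rw [Finset.sum_apply, Pi.zero_apply, ← hC (Multiplicative.toAdd t),
      ← Finset.sum_fiberwise_of_maps_to (t := s.image θ) (g := θ)
        (fun i hi => Finset.mem_image_of_mem θ hi)]
    refine Finset.sum_congr rfl fun a _ => ?_
    rw [Pi.smul_apply, smul_eq_mul, Finset.sum_mul]
    refine Finset.sum_congr rfl fun i hi => ?_
    rw [(Finset.mem_filter.1 hi).2]
    rfl
  by_cases hθ : θ₀ ∈ s.image θ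
  · exact linearIndependent_iff'.1 hli (s.image θ) _ hsum θ₀ hθ
  · refine Finset.sum_eq_zero fun i hi => absurd ?_ hθ
    obtain ⟨h1, h2⟩ := Finset.mem_filter.1 hi
    exact h2 ▸ Finset.mem_image_of_mem θ h1

/-- On finitely supported sequences `R(U)[Z]` is a finite sum over pairs of modes. -/
lemma bilin_eq_sum_modes (r : OpCoef) {S : Finset ℤ} (hS : 0 ∉ S) {u z : ℤ → ℂ}
    (hu : ∀ n, n ∉ S → u n = 0) (hz : ∀ n, n ∉ S → z n = 0) (j : ℤ) :
    bilin r u z 1 j = ∑ p ∈ modes S ×ˢ modes S, if waveNumber p.1 + waveNumber p.2 = j then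
      ((1 / Real.sqrt (2 * Real.pi) : ℝ) : ℂ) * r p.1.1 1 p.2.1 p.1.2 p.2.2 *
        sgn p.1.1 (u p.1.2) * sgn p.2.1 (z p.2.2) else 0 := by
  have h0 : ∀ σ, sgn σ 0 = 0 := fun σ => by unfold sgn; split_ifs <;> simp
  have h1 : ∀ ε σ' : ℤˣ, ((1 / Real.sqrt (2 * Real.pi) : ℝ) : ℂ) *
      ∑' p : ℤ × ℤ, bilinTerm r ε 1 σ' u z j p = ∑ n ∈ S, ∑ k ∈ S,
        if waveNumber (ε, n) + waveNumber (σ', k) = j then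
        ((1 / Real.sqrt (2 * Real.pi) : ℝ) : ℂ) * r ε 1 σ' n k * sgn ε (u n) * sgn σ' (z k)
        else 0 := by
    intro ε σ'
    rw [tsum_eq_sum (s := S ×ˢ S), Finset.sum_product, Finset.mul_sum]
    · refine Finset.sum_congr rfl fun n hn => ?_
      rw [Finset.mul_sum]
      refine Finset.sum_congr rfl fun k hk => ?_
      have hn0 : n ≠ 0 := fun h => hS (h ▸ hn)
      have hk0 : k ≠ 0 := fun h => hS (h ▸ hk)
      by_cases hc : waveNumber (ε, n) + waveNumber (σ', k) = j
      · rw [if_pos hc, bilinTerm, if_pos ⟨hn0, hk0, by simpa [waveNumber] using hc⟩]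
        ring
      · rw [if_neg hc, bilinTerm, if_neg, mul_zero]
        exact fun h => hc (by simpa [waveNumber] using h.2.2)
    · intro p hp
      rw [Finset.mem_product, not_and_or] at hp
      unfold bilinTerm
      split_ifs
      · rcases hp with hp | hp
        · rw [hu _ hp, h0]; ring
        · rw [hz _ hp, h0]; ring
      · rfl
  rw [bilin, Finset.sum_comm, Finset.sum_product, modes, Finset.sum_product]
  refine Finset.sum_congr rfl fun ε _ => ?_
  simp only [h1]
  rw [Finset.sum_comm]
  refine Finset.sum_congr rfl fun n _ => ?_
  rw [Finset.sum_product]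

lemma sgn_exp_mul (σ : ℤˣ) (a t : ℝ) (z : ℂ) :
    sgn σ (Complex.exp (Complex.I * a * t) * z) =
      Complex.exp (Complex.I * ((σ : ℤ) * a : ℝ) * t) * sgn σ z := by
  rcases Int.units_eq_one_or σ with rfl | rfl
  · simp [sgn]
  · simp [sgn, ← Complex.exp_conj]

lemma sgn_I_mul (σ : ℤˣ) (a : ℝ) (z : ℂ) :
    sgn σ (Complex.I * a * z) = Complex.I * ((σ : ℤ) * a : ℝ) * sgn σ z := by
  rcases Int.units_eq_one_or σ with rfl | rfl <;> simp [sgn]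

/-- The frequency of the monomial `w_n^σ` along the flow of the linearized system. -/
noncomputable def frequency (g κ : ℝ) (h : ℝ≥0∞) (i : ℤˣ × ℤ) : ℝ := ((i.1 : ℤ) : ℝ) * Ω g κ h i.2

section

variable {g κ : ℝ} (hg : 0 ≤ g) (hκ : 0 < κ) {h : ℝ≥0∞} (hh : 0 < h)

include hg hκ hh

/-- The quadratic identity holds for `e^{i Ω(D) t} w`, `t ∈ ℝ`, in place of `w`, which multiplies
each monomial by `e^{i θ t}`, with `θ` its frequency.  The monomials with `θ = Ω(j)` therefore
cancel among themselves; the homological term, with factor `θ - Ω(j)`, does not contribute. -/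
lemma resonant_identity
    {s m : ℝ} (hm : 0 ≤ m) {M₁ : OpCoef} (hM₁ : IsHomogeneousMap m M₁)
    {N : (ℤ → ℂ) → ℤ → ℂ} {R₁ : OpCoef}
    (hconj : ConjugatesTo g κ h s m M₁ N (resonantPart g κ h R₁))
    {S : Finset ℤ} (hS : 0 ∉ S) {j : ℤ} (hj : j ≠ 0) (w : ℤ → ℂ) :
    quadField (resonantPart g κ h R₁) (fun n => if n ∈ S then w n else 0) 1 j =
      ∑ p ∈ modes S ×ˢ modes S with frequency g κ h p.1 + frequency g κ h p.2 = Ω g κ h j,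
        if waveNumber p.1 + waveNumber p.2 = j then
          fieldCoef g κ h j p.1 p.2 * sgn p.1.1 (w p.1.2) * sgn p.2.1 (w p.2.2) else 0 := by
  set c : ℂ := ((1 / Real.sqrt (2 * Real.pi) : ℝ) : ℂ) with hc
  -- coefficients of the quadratic identity
  set A : (ℤˣ × ℤ) × (ℤˣ × ℤ) → ℂ := fun p => fieldCoef g κ h j p.1 p.2 +
    c * M₁ p.1.1 1 p.2.1 p.1.2 p.2.2 * (Complex.I *
      ((frequency g κ h p.1 + frequency g κ h p.2 - Ω g κ h j : ℝ) : ℂ)) -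
    c * resonantPart g κ h R₁ p.1.1 1 p.2.1 p.1.2 p.2.2 with hA
  have key : ∀ y : ℤ → ℂ, ∑ p ∈ modes S ×ˢ modes S, (if waveNumber p.1 + waveNumber p.2 = j then
      A p * sgn p.1.1 (y p.1.2) * sgn p.2.1 (y p.2.2) else 0) = 0 := by
    intro y
    set W₀ : ℤ → ℂ := fun n => if n ∈ S then y n else 0 with hW₀
    set V₀ : ℤ → ℂ := fun n => Complex.I * (Ω g κ h n : ℂ) * W₀ n with hV₀
    have hW : ∀ n, n ∉ S → W₀ n = 0 := fun n hn => if_neg hn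
    have hV : ∀ n, n ∉ S → V₀ n = 0 := fun n hn => by rw [hV₀]; simp only [hW n hn, mul_zero]
    have h1 := quadratic_identity hg hκ hh hm hM₁ hconj hS hj (w := y) (W₀ := W₀) (V₀ := V₀)
      (fun _ => rfl) (fun _ => rfl)
    rw [quadField_eq_bilin, bilin_eq_sum_modes _ hS hW hV, bilin_eq_sum_modes _ hS hV hW,
      bilin_eq_sum_modes _ hS hW hW, bilin_eq_sum_modes _ hS hW hW, ← sub_eq_zero,
      Finset.mul_sum, ← Finset.sum_add_distrib, ← Finset.sum_add_distrib,
      ← Finset.sum_sub_distrib, ← Finset.sum_sub_distrib] at h1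
    refine Eq.trans (Finset.sum_congr rfl fun p hp => ?_) h1
    obtain ⟨hp1, hp2⟩ := Finset.mem_product.1 hp
    have hn1 : p.1.2 ∈ S := (Finset.mem_product.1 hp1).2
    have hn2 : p.2.2 ∈ S := (Finset.mem_product.1 hp2).2
    by_cases hk : waveNumber p.1 + waveNumber p.2 = j
    · simp only [if_pos hk, hV₀, sgn_I_mul]
      simp only [hW₀, if_pos hn1, if_pos hn2, hA, hc, frequency]
      push_cast
      ring
    · simp only [if_neg hk]
      ring
  have key2 : ∀ t : ℝ, ∑ p ∈ modes S ×ˢ modes S,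
      (if waveNumber p.1 + waveNumber p.2 = j then
        A p * sgn p.1.1 (w p.1.2) * sgn p.2.1 (w p.2.2) else 0) *
      Complex.exp (Complex.I * ((frequency g κ h p.1 + frequency g κ h p.2 : ℝ) : ℂ) * t) = 0 := by
    intro t
    refine Eq.trans (Finset.sum_congr rfl fun p _ => ?_)
      (key fun n => Complex.exp (Complex.I * Ω g κ h n * t) * w n)
    split_ifs
    · rw [sgn_exp_mul, sgn_exp_mul]
      have : Complex.exp (Complex.I * ((frequency g κ h p.1 + frequency g κ h p.2 : ℝ) : ℂ) * t) =
          Complex.exp (Complex.I * (((p.1.1 : ℤ) : ℝ) * Ω g κ h p.1.2 : ℝ) * t) *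
          Complex.exp (Complex.I * (((p.2.1 : ℤ) : ℝ) * Ω g κ h p.2.2 : ℝ) * t) := by
        rw [← Complex.exp_add]
        congr 1
        simp only [frequency]
        push_cast
        ring
      rw [this]
      ring
    · simp
  have key3 := sum_filter_eq_zero_of_sum_exp_eq_zero _ _ _ key2 (Ω g κ h j)
  have hW : ∀ n, n ∉ S → (if n ∈ S then w n else 0) = 0 := fun n hn => if_neg hn
  rw [quadField_eq_bilin, bilin_eq_sum_modes _ hS hW hW, eq_comm, ← sub_eq_zero,
    Finset.sum_filter, ← Finset.sum_sub_distrib]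
  rw [Finset.sum_filter] at key3
  refine Eq.trans (Finset.sum_congr rfl fun p hp => ?_) key3
  obtain ⟨hp1, hp2⟩ := Finset.mem_product.1 hp
  have hn1 : p.1.2 ∈ S := (Finset.mem_product.1 hp1).2
  have hn2 : p.2.2 ∈ S := (Finset.mem_product.1 hp2).2
  simp only [hn1, hn2, if_true, hA, hc]
  by_cases hk : waveNumber p.1 + waveNumber p.2 = j
  swap
  · simp [hk]
  simp only [if_pos hk]
  split_ifs with hf
  · rw [hf, sub_self, Complex.ofReal_zero]
    ring
  · have : resonantPart g κ h R₁ p.1.1 1 p.2.1 p.1.2 p.2.2 = 0 := by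
      unfold resonantPart
      refine if_neg fun h0 => hf ?_
      simp only [waveNumber] at hk
      rw [hk] at h0
      simp only [Units.val_one, one_mul, Int.cast_one] at h0
      simp only [frequency]
      linarith
    rw [this]
    ring

end

/-! ### The Birkhoff normal form Hamiltonian -/

/-- The triple of modes `(σ₀, j₀), (σ₁, j₁), (σ₂, j₂)` is resonant. -/
def IsResonantTriple (g κ : ℝ) (h : ℝ≥0∞) (a b c : ℤˣ × ℤ) : Prop :=
  IsResonant g κ h ![a.1, b.1, c.1] ![a.2, b.2, c.2]

lemma isResonantTriple_iff {g κ : ℝ} {h : ℝ≥0∞} {a b c : ℤˣ × ℤ} :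
    IsResonantTriple g κ h a b c ↔ (a.2 ≠ 0 ∧ b.2 ≠ 0 ∧ c.2 ≠ 0) ∧
      waveNumber a + waveNumber b + waveNumber c = 0 ∧
      frequency g κ h a + frequency g κ h b + frequency g κ h c = 0 := by
  simp [IsResonantTriple, IsResonant, Fin.sum_univ_three, Fin.forall_fin_succ, waveNumber,
    frequency]

/-- The coefficient of the cubic Hamiltonian on a triple of modes. -/
noncomputable def hamTriple (g κ : ℝ) (h : ℝ≥0∞) (a b c : ℤˣ × ℤ) : ℂ :=
  hamCoef g κ h ![a.1, b.1, c.1] ![a.2, b.2, c.2]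

open Classical in
/-- The coefficient of the resonant cubic Hamiltonian on a triple of modes. -/
noncomputable def resHam (g κ : ℝ) (h : ℝ≥0∞) (a b c : ℤˣ × ℤ) : ℂ :=
  if IsResonantTriple g κ h a b c then hamTriple g κ h a b c else 0

section

variable {g κ : ℝ} {h : ℝ≥0∞} {S : Finset ℤ}
  (hS : ∀ (σ₀ σ₁ σ₂ : ℤˣ) (a b c : ℤ),
    a ≠ 0 → b ≠ 0 → c ≠ 0 → (σ₀ : ℤ) * a + (σ₁ : ℤ) * b + (σ₂ : ℤ) * c = 0 →
    ((σ₀ : ℤ) : ℝ) * Ω g κ h a + ((σ₁ : ℤ) : ℝ) * Ω g κ h b + ((σ₂ : ℤ) : ℝ) * Ω g κ h c = 0 →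
    a ∈ S ∧ b ∈ S ∧ c ∈ S)

include hS

lemma HBNF_eq_sum (y : ℤ → ℂ) : HBNF g κ h y =
    ∑ a ∈ modes S, ∑ b ∈ modes S, ∑ c ∈ modes S, resHam g κ h a b c *
      (sgn a.1 (y a.2) * sgn b.1 (y b.2) * sgn c.1 (y c.2)) := by
  classical
  have h1 : HBNF g κ h y = ∑ σ : Fin 3 → ℤˣ, ∑ j ∈ Fintype.piFinset fun _ => S,
      if IsResonant g κ h σ j then hamCoef g κ h σ j * ∏ i, sgn (σ i) (y (j i)) else 0 := by
    unfold HBNF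
    refine Finset.sum_congr rfl fun σ _ => tsum_eq_sum fun j hj => if_neg fun hr => hj ?_
    obtain ⟨h0, h1, h2⟩ := hr
    rw [Fin.sum_univ_three] at h1 h2
    obtain ⟨ha, hb, hc⟩ := hS _ _ _ _ _ _ (h0 0) (h0 1) (h0 2) h1 h2
    rw [Fintype.mem_piFinset]
    intro i
    fin_cases i
    · exact ha
    · exact hb
    · exact hc
  rw [h1, ← Finset.sum_product', ← Finset.sum_product', ← Finset.sum_product']
  refine Finset.sum_bij' (fun q _ => (((q.1 0, q.2 0), (q.1 1, q.2 1)), (q.1 2, q.2 2)))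
    (fun q _ => (![q.1.1.1, q.1.2.1, q.2.1], ![q.1.1.2, q.1.2.2, q.2.2])) ?_ ?_ ?_ ?_ ?_
  · intro q hq
    have := Fintype.mem_piFinset.1 (Finset.mem_product.1 hq).2
    simp only [modes, Finset.mem_product, Finset.mem_univ, true_and]
    exact ⟨⟨this 0, this 1⟩, this 2⟩
  · intro q hq
    simp only [modes, Finset.mem_product, Finset.mem_univ, true_and] at hq
    simp only [Finset.mem_product, Finset.mem_univ, true_and, Fintype.mem_piFinset]
    intro i
    fin_cases i
    · exact hq.1.1
    · exact hq.1.2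
    · exact hq.2
  · intro q _
    ext i <;> fin_cases i <;> rfl
  · intro q _
    rfl
  · intro q _
    have e1 : ![q.1 0, q.1 1, q.1 2] = q.1 := by ext i; fin_cases i <;> rfl
    have e2 : ![q.2 0, q.2 1, q.2 2] = q.2 := by ext i; fin_cases i <;> rfl
    simp only [resHam, IsResonantTriple, hamTriple, e1, e2, Fin.prod_univ_three]
    split_ifs <;> simp

/-- The Wirtinger derivatives of the resonant Hamiltonian. -/
lemma wirtinger_HBNF (y : ℤ → ℂ) (τ : ℤˣ) {k : ℤ} (hk : k ∈ S) :
    wirtinger (HBNF g κ h) y τ k = ∑ a ∈ modes S, ∑ b ∈ modes S,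
      (resHam g κ h (τ, k) a b + resHam g κ h a (τ, k) b + resHam g κ h b a (τ, k)) *
        (sgn a.1 (y a.2) * sgn b.1 (y b.2)) := by
  classical
  -- the derivative of the monomials
  set δ : ℂ → ℤˣ × ℤ → ℂ := fun α i => if i.2 = k then sgn i.1 α else 0 with hδ
  have hf : ∀ (α : ℂ) (i : ℤˣ × ℤ), HasDerivAt
      (fun t : ℝ => sgn i.1 ((y + Pi.single k ((t : ℂ) * α) : ℤ → ℂ) i.2)) (δ α i) 0 := by
    intro α i
    have h1 : ∀ t : ℝ, sgn i.1 ((y + Pi.single k ((t : ℂ) * α) : ℤ → ℂ) i.2) =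
        sgn i.1 (y i.2) + t * δ α i := by
      intro t
      rw [Pi.add_apply, sgn_add, Pi.single_apply, hδ]
      simp only
      split_ifs
      · rw [sgn_real_mul]
      · simp [sgn]
    simp only [h1]
    have h2 := ((hasDerivAt_id (0 : ℝ)).ofReal_comp.mul_const (δ α i)).const_add (sgn i.1 (y i.2))
    simpa using h2
  have h0 : ∀ (α : ℂ) (i : ℤˣ × ℤ), sgn i.1 ((y + Pi.single k (((0 : ℝ) : ℂ) * α) : ℤ → ℂ) i.2) =
      sgn i.1 (y i.2) := by
    intro α i; simp
  have hd : ∀ α : ℂ, deriv (fun t : ℝ => HBNF g κ h (y + Pi.single k ((t : ℂ) * α))) 0 =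
      ∑ a ∈ modes S, ∑ b ∈ modes S, ∑ c ∈ modes S, resHam g κ h a b c *
        ((δ α a * sgn b.1 (y b.2) + sgn a.1 (y a.2) * δ α b) * sgn c.1 (y c.2) +
          sgn a.1 (y a.2) * sgn b.1 (y b.2) * δ α c) := by
    intro α
    simp only [HBNF_eq_sum hS]
    refine HasDerivAt.deriv (HasDerivAt.fun_sum fun a _ => HasDerivAt.fun_sum fun b _ =>
      HasDerivAt.fun_sum fun c _ => ?_)
    have := ((((hf α a).mul (hf α b)).mul (hf α c)).const_mul (resHam g κ h a b c))
    simpa only [h0, Pi.mul_apply] using this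
  have hw : ∀ i : ℤˣ × ℤ, (1 / 2) * (δ 1 i - ((τ : ℤ) : ℂ) * Complex.I * δ Complex.I i) =
      if i = (τ, k) then 1 else 0 := by
    rintro ⟨σ, n⟩
    by_cases hn : n = k
    · rcases Int.units_eq_one_or σ with rfl | rfl <;> rcases Int.units_eq_one_or τ with rfl | rfl <;>
        simp [hδ, hn, sgn] <;> norm_num
    · simp [hδ, hn]
  have hd1 := hd 1
  simp only [mul_one] at hd1
  have hJ : (τ, k) ∈ modes S := Finset.mem_product.2 ⟨Finset.mem_univ _, hk⟩
  rw [wirtinger, hd1, hd]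
  have h3 : (1 / 2 : ℂ) * ((∑ a ∈ modes S, ∑ b ∈ modes S, ∑ c ∈ modes S, resHam g κ h a b c *
        ((δ 1 a * sgn b.1 (y b.2) + sgn a.1 (y a.2) * δ 1 b) * sgn c.1 (y c.2) +
          sgn a.1 (y a.2) * sgn b.1 (y b.2) * δ 1 c)) - ((τ : ℤ) : ℂ) * Complex.I *
      ∑ a ∈ modes S, ∑ b ∈ modes S, ∑ c ∈ modes S, resHam g κ h a b c *
        ((δ Complex.I a * sgn b.1 (y b.2) + sgn a.1 (y a.2) * δ Complex.I b) * sgn c.1 (y c.2) +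
          sgn a.1 (y a.2) * sgn b.1 (y b.2) * δ Complex.I c)) =
      ∑ a ∈ modes S, ∑ b ∈ modes S, ∑ c ∈ modes S, resHam g κ h a b c *
        (((if a = (τ, k) then 1 else 0) * sgn b.1 (y b.2) +
          sgn a.1 (y a.2) * (if b = (τ, k) then 1 else 0)) * sgn c.1 (y c.2) +
          sgn a.1 (y a.2) * sgn b.1 (y b.2) * (if c = (τ, k) then 1 else 0)) := by
    simp only [Finset.mul_sum, ← Finset.sum_sub_distrib]
    refine Finset.sum_congr rfl fun a _ => Finset.sum_congr rfl fun b _ =>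
      Finset.sum_congr rfl fun c _ => ?_
    rw [← hw a, ← hw b, ← hw c]
    ring
  rw [h3]
  have h4 : ∀ a b c : ℤˣ × ℤ, resHam g κ h a b c *
        (((if a = (τ, k) then 1 else 0) * sgn b.1 (y b.2) +
          sgn a.1 (y a.2) * (if b = (τ, k) then 1 else 0)) * sgn c.1 (y c.2) +
          sgn a.1 (y a.2) * sgn b.1 (y b.2) * (if c = (τ, k) then 1 else 0)) =
      (if a = (τ, k) then resHam g κ h a b c * (sgn b.1 (y b.2) * sgn c.1 (y c.2)) else 0) +
      (if b = (τ, k) then resHam g κ h a b c * (sgn a.1 (y a.2) * sgn c.1 (y c.2)) else 0) +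
      (if c = (τ, k) then resHam g κ h a b c * (sgn b.1 (y b.2) * sgn a.1 (y a.2)) else 0) := by
    intro a b c
    split_ifs <;> ring
  simp only [h4, Finset.sum_add_distrib]
  have h5 : ∀ f : ℤˣ × ℤ → ℤˣ × ℤ → ℤˣ × ℤ → ℂ,
      ∑ a ∈ modes S, ∑ b ∈ modes S, ∑ c ∈ modes S, (if a = (τ, k) then f a b c else 0) =
      ∑ b ∈ modes S, ∑ c ∈ modes S, f (τ, k) b c := by
    intro f
    rw [Finset.sum_eq_single_of_mem _ hJ]
    · simp
    · intro a _ ha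
      simp [ha]
  have h6 : ∀ f : ℤˣ × ℤ → ℤˣ × ℤ → ℤˣ × ℤ → ℂ,
      ∑ a ∈ modes S, ∑ b ∈ modes S, ∑ c ∈ modes S, (if b = (τ, k) then f a b c else 0) =
      ∑ a ∈ modes S, ∑ c ∈ modes S, f a (τ, k) c := by
    intro f
    refine Finset.sum_congr rfl fun a _ => ?_
    rw [Finset.sum_eq_single_of_mem _ hJ]
    · simp
    · intro b _ hb
      simp [hb]
  have h7 : ∀ f : ℤˣ × ℤ → ℤˣ × ℤ → ℤˣ × ℤ → ℂ,
      ∑ a ∈ modes S, ∑ b ∈ modes S, ∑ c ∈ modes S, (if c = (τ, k) then f a b c else 0) =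
      ∑ b ∈ modes S, ∑ a ∈ modes S, f a b (τ, k) := by
    intro f
    rw [Finset.sum_comm]
    refine Finset.sum_congr rfl fun a _ => Finset.sum_congr rfl fun b _ => ?_
    rw [Finset.sum_eq_single_of_mem _ hJ]
    · simp
    · intro c _ hc
      simp [hc]
  rw [h5, h6, h7, ← Finset.sum_add_distrib, ← Finset.sum_add_distrib]
  refine Finset.sum_congr rfl fun a _ => ?_
  rw [← Finset.sum_add_distrib, ← Finset.sum_add_distrib]
  refine Finset.sum_congr rfl fun b _ => ?_
  ring

end

/-- The three slots of the cubic Hamiltonian give the coefficients of the quadratic part of the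
water waves vector field: the outer slots the equation for `η`, the middle slot that for `ψ`. -/
lemma I_mul_hamTriple_eq_fieldCoef (g κ : ℝ) (h : ℝ≥0∞) (j : ℤ) (a b : ℤˣ × ℤ) :
    Complex.I * (hamTriple g κ h (-1, j) a b + hamTriple g κ h a (-1, j) b +
      hamTriple g κ h b a (-1, j)) = fieldCoef g κ h j a b := by
  simp only [hamTriple, hamCoef, fieldCoef, waveNumber, Matrix.cons_val_zero, Matrix.cons_val_one,
    Matrix.cons_val]
  have hI : Complex.I * Complex.I = -1 := Complex.I_mul_I
  push_cast
  rw [mul_add, mul_add]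
  simp only [mul_div_assoc, ← mul_assoc, hI]
  ring

/-- The three placements of the mode `(-1, j)` are resonant together, so the Hamiltonian
vector field of the resonant Hamiltonian is the resonant part of the quadratic vector field. -/
lemma resHam_eq (g κ : ℝ) (h : ℝ≥0∞) {j : ℤ} (hj : j ≠ 0) {a b : ℤˣ × ℤ} (ha : a.2 ≠ 0)
    (hb : b.2 ≠ 0) [Decidable (frequency g κ h a + frequency g κ h b = Ω g κ h j)] :
    Complex.I * (resHam g κ h (-1, j) a b + resHam g κ h a (-1, j) b + resHam g κ h b a (-1, j)) =
      if frequency g κ h a + frequency g κ h b = Ω g κ h j then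
        if waveNumber a + waveNumber b = j then fieldCoef g κ h j a b else 0 else 0 := by
  have e1 : waveNumber (-1, j) = -j := by simp [waveNumber]
  have e2 : frequency g κ h (-1, j) = -Ω g κ h j := by simp [frequency]
  have r1 : IsResonantTriple g κ h (-1, j) a b ↔ waveNumber a + waveNumber b = j ∧
      frequency g κ h a + frequency g κ h b = Ω g κ h j := by
    rw [isResonantTriple_iff, e1, e2]
    constructor
    · rintro ⟨-, h1, h2⟩; exact ⟨by linarith, by linarith⟩
    · rintro ⟨h1, h2⟩; exact ⟨⟨hj, ha, hb⟩, by linarith, by linarith⟩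
  have r2 : IsResonantTriple g κ h a (-1, j) b ↔ waveNumber a + waveNumber b = j ∧
      frequency g κ h a + frequency g κ h b = Ω g κ h j := by
    rw [isResonantTriple_iff, e1, e2]
    constructor
    · rintro ⟨-, h1, h2⟩; exact ⟨by linarith, by linarith⟩
    · rintro ⟨h1, h2⟩; exact ⟨⟨ha, hj, hb⟩, by linarith, by linarith⟩
  have r3 : IsResonantTriple g κ h b a (-1, j) ↔ waveNumber a + waveNumber b = j ∧
      frequency g κ h a + frequency g κ h b = Ω g κ h j := by
    rw [isResonantTriple_iff, e1, e2]
    constructor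
    · rintro ⟨-, h1, h2⟩; exact ⟨by linarith, by linarith⟩
    · rintro ⟨h1, h2⟩; exact ⟨⟨hb, ha, hj⟩, by linarith, by linarith⟩
  simp only [resHam, r1, r2, r3]
  by_cases h1 : frequency g κ h a + frequency g κ h b = Ω g κ h j <;>
    by_cases h2 : waveNumber a + waveNumber b = j <;>
    simp [h1, h2, I_mul_hamTriple_eq_fieldCoef]

/-! ### Reality -/

lemma conj_quadField_resonantPart (g κ : ℝ) (h : ℝ≥0∞) {r : OpCoef} (hr : IsRealToReal r)
    (y : ℤ → ℂ) (σ : ℤˣ) (j : ℤ) :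
    conj (quadField (resonantPart g κ h r) y σ j) =
      quadField (resonantPart g κ h r) y (-σ) j := by
  classical
  rw [quadField_eq_bilin, quadField_eq_bilin, bilin, bilin, map_sum]
  rw [← Equiv.sum_comp (Equiv.neg ℤˣ)]
  refine Finset.sum_congr rfl fun σ' _ => ?_
  rw [map_sum, ← Equiv.sum_comp (Equiv.neg ℤˣ)]
  refine Finset.sum_congr rfl fun ε _ => ?_
  rw [map_mul, Complex.conj_ofReal, Complex.conj_tsum]
  congr 1
  refine tsum_congr fun p => ?_
  simp only [Equiv.neg_apply]
  rw [bilinTerm_resonantPart, bilinTerm_resonantPart]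
  have h1 : (((-σ : ℤˣ) : ℤ) : ℝ) * Ω g κ h j - ((σ' : ℤ) : ℝ) * Ω g κ h p.2 -
      ((ε : ℤ) : ℝ) * Ω g κ h p.1 = 0 ↔ ((σ : ℤ) : ℝ) * Ω g κ h j -
      (((-σ' : ℤˣ) : ℤ) : ℝ) * Ω g κ h p.2 - (((-ε : ℤˣ) : ℤ) : ℝ) * Ω g κ h p.1 = 0 := by
    push_cast
    constructor <;> intro h0 <;> linarith
  have h2 : ((ε : ℤ) * p.1 + (σ' : ℤ) * p.2 = ((-σ : ℤˣ) : ℤ) * j) ↔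
      (((-ε : ℤˣ) : ℤ) * p.1 + ((-σ' : ℤˣ) : ℤ) * p.2 = (σ : ℤ) * j) := by
    push_cast
    constructor <;> intro h0 <;> linarith
  simp only [h1, bilinTerm, h2]
  split_ifs
  · rw [map_mul, map_mul, conj_sgn, conj_sgn, neg_neg, neg_neg, ← hr, neg_neg, neg_neg]
  · simp
  · simp

lemma conj_HBNF (g κ : ℝ) (h : ℝ≥0∞) (y : ℤ → ℂ) : conj (HBNF g κ h y) = HBNF g κ h y := by
  classical
  unfold HBNF
  rw [map_sum, ← Equiv.sum_comp (Equiv.neg (Fin 3 → ℤˣ))]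
  refine Finset.sum_congr rfl fun σ _ => ?_
  rw [Complex.conj_tsum]
  refine tsum_congr fun j => ?_
  have h1 : IsResonant g κ h (-σ) j ↔ IsResonant g κ h σ j := by
    unfold IsResonant
    simp only [Fin.sum_univ_three, Pi.neg_apply, Units.val_neg, Int.cast_neg]
    refine and_congr_right fun _ => and_congr ?_ ?_ <;>
      constructor <;> intro h0 <;> linarith
  simp only [Equiv.neg_apply, h1]
  split_ifs
  · rw [map_mul, map_prod]
    congr 1
    · simp only [hamCoef, map_mul, map_div₀, Complex.conj_ofReal, Complex.conj_I, Pi.neg_apply,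
        Units.val_neg]
      simp
    · refine Finset.prod_congr rfl fun i _ => ?_
      rw [conj_sgn, Pi.neg_apply, neg_neg]
  · simp

lemma conj_hamField_HBNF (g κ : ℝ) (h : ℝ≥0∞) (y : ℤ → ℂ) (σ : ℤˣ) (j : ℤ) :
    conj (hamField (HBNF g κ h) y σ j) = hamField (HBNF g κ h) y (-σ) j := by
  have h1 : ∀ f : ℝ → ℂ, (∀ t, conj (f t) = f t) → conj (deriv f 0) = deriv f 0 := by
    intro f hf
    have h2 := deriv.star (f := f) (x := (0 : ℝ))
    rw [show (fun y => star (f y)) = f from funext hf] at h2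
    exact h2.symm
  simp only [hamField, wirtinger, map_mul, map_sub, neg_neg]
  rw [h1 _ fun t => conj_HBNF g κ h _, h1 _ fun t => conj_HBNF g κ h _]
  have h2 : conj (1 / 2 : ℂ) = 1 / 2 := by
    rw [map_div₀, map_one, map_ofNat]
  rw [h2, Complex.conj_I, Units.val_neg]
  push_cast
  simp only [map_neg, map_intCast]
  ring

end WaterWaves

theorem proposition5p1 (g κ : ℝ) (hg : 0 ≤ g) (hκ : 0 < κ) (h : ℝ≥0∞) (hh : 0 < h)
    (s m ρ : ℝ) (hm : 0 ≤ m) (hρ : 0 ≤ ρ)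
    (M₁ : WaterWaves.OpCoef) (hM₁ : WaterWaves.IsRealToReal M₁)
    (hM₁' : WaterWaves.IsHomogeneousMap m M₁) (N : (ℤ → ℂ) → ℤ → ℂ)
    (R₁ : WaterWaves.OpCoef) (hR₁ : WaterWaves.IsRealToReal R₁)
    (hR₁' : WaterWaves.IsSmoothingOp ρ R₁)
    (hconj : WaterWaves.ConjugatesTo g κ h s m M₁ N (WaterWaves.resonantPart g κ h R₁)) :
    ∀ (y : ℤ → ℂ) (σ : ℤˣ) (j : ℤ), j ≠ 0 →
      WaterWaves.quadField (WaterWaves.resonantPart g κ h R₁) y σ j =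
        WaterWaves.hamField (WaterWaves.HBNF g κ h) y σ j := by
  open WaterWaves in
  have main : ∀ (y : ℤ → ℂ) (j : ℤ), j ≠ 0 →
      quadField (resonantPart g κ h R₁) y 1 j = hamField (HBNF g κ h) y 1 j := by
    intro y j hj
    obtain ⟨S₀, hS₀, hres₀⟩ := exists_resonant_modes hg hκ hh
    -- adding `j` makes it an index of the sums over modes even if no resonance involves it
    set S := insert j S₀ with hSdef
    have hS : 0 ∉ S := by
      rw [hSdef, Finset.mem_insert, not_or]
      exact ⟨hj.symm, hS₀⟩
    have hres : ∀ (σ₀ σ₁ σ₂ : ℤˣ) (a b c : ℤ), a ≠ 0 → b ≠ 0 → c ≠ 0 →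
        (σ₀ : ℤ) * a + (σ₁ : ℤ) * b + (σ₂ : ℤ) * c = 0 →
        ((σ₀ : ℤ) : ℝ) * Ω g κ h a + ((σ₁ : ℤ) : ℝ) * Ω g κ h b + ((σ₂ : ℤ) : ℝ) * Ω g κ h c = 0 →
        a ∈ S ∧ b ∈ S ∧ c ∈ S := fun σ₀ σ₁ σ₂ a b c ha hb hc h1 h2 => by
      obtain ⟨h3, h4, h5⟩ := hres₀ σ₀ σ₁ σ₂ a b c ha hb hc h1 h2
      exact ⟨Finset.mem_insert_of_mem h3, Finset.mem_insert_of_mem h4, Finset.mem_insert_of_mem h5⟩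
    have htrunc : quadField (resonantPart g κ h R₁) y 1 j =
        quadField (resonantPart g κ h R₁) (fun n => if n ∈ S then y n else 0) 1 j := by
      rw [quadField_resonantPart_eq_sum hres R₁ _ 1 hj,
        quadField_resonantPart_eq_sum hres R₁ _ 1 hj]
      refine Finset.sum_congr rfl fun σ' _ => Finset.sum_congr rfl fun ε _ => ?_
      congr 1
      refine Finset.sum_congr rfl fun p hp => ?_
      obtain ⟨h1, h2⟩ := Finset.mem_product.1 hp
      simp only [bilinTerm, if_pos h1, if_pos h2]
    rw [htrunc, resonant_identity hg hκ hh hm hM₁' hconj hS hj y, hamField,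
      wirtinger_HBNF hres y (-1) (Finset.mem_insert_self j S₀), Finset.sum_filter,
      Finset.sum_product, Finset.mul_sum]
    refine Finset.sum_congr rfl fun a ha => ?_
    rw [Finset.mul_sum]
    refine Finset.sum_congr rfl fun b hb => ?_
    have ha0 : a.2 ≠ 0 := fun h0 => hS (h0 ▸ (Finset.mem_product.1 ha).2)
    have hb0 : b.2 ≠ 0 := fun h0 => hS (h0 ▸ (Finset.mem_product.1 hb).2)
    rw [Units.val_one, Int.cast_one, mul_one, ← mul_assoc, resHam_eq g κ h hj ha0 hb0]
    split_ifs <;> ring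
  intro y σ j hj
  rcases Int.units_eq_one_or σ with rfl | rfl
  · exact main y j hj
  · rw [← WaterWaves.conj_quadField_resonantPart g κ h hR₁, main y j hj,
      WaterWaves.conj_hamField_HBNF]
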